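/- Let $G$ be a connected compact semisimple Lie group with Lie algebra $\mathfrak g$ and exponential map $\exp$, let $\langle\cdot,\cdot\rangle=-c\,\kappa$ with $c>0$ and $\kappa$ the Killing form of $\mathfrak g$, and equip $G$ with the corresponding bi-invariant Riemannian metric. Let $\sigma$ be an automorphism of $G$; its differential on $\mathfrak g$ and the complex-linear extension to $\mathfrak g^{\mathbb C}$ are also denoted by $\sigma$. The group $G(\sigma)=\{(b,\sigma(b)) : b\in G\}$ acts on $G$ by $(b,\sigma(b))\cdot a=b\,a\,\sigma(b)^{-1}$. Let $\mathfrak t$ be a maximal abelian subspace of $\mathfrak g^\sigma=\{x\in\mathfrak g:\sigma(x)=x\}$. For $\alpha\in\mathfrak t$ and $\epsilon\in U(1)=\{\epsilon\in\mathbb C:|\epsilon|=1\}$ put $$\mathfrak g(\alpha)=\{z\in\mathfrak g^{\mathbb C} : \operatorname{ad}(\eta)z=\sqrt{-1}\,\langle\alpha,\eta\rangle z\ \text{ for all }\eta\in\mathfrak t\},\qquad \mathfrak g(\alpha,\epsilon)=\{z\in\mathfrak g(\alpha):\sigma(z)=\epsilon z\},$$ $$\mathfrak g_{\alpha,\epsilon}=\bigl(\mathfrak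 g(\alpha,\epsilon)+\mathfrak g(-\alpha,\epsilon^{-1})\bigr)\cap\mathfrak g .$$ Let $\Delta=\{\alpha\in\mathfrak t\setminus\{0\}:\mathfrak g(\alpha)\neq0\}$, and let $\Delta^+\subset\Delta$ contain exactly one element of each pair $\pm\alpha$ (for example a system of positive roots). Let $\arg\epsilon\in(-\pi,\pi]$ be the argument of $\epsilon$. Let $w\in\mathfrak t$, $a=\exp w$, $N=G(\sigma)\cdot a$, and let $dl_a:\mathfrak g\to T_aG$ be the differential of the left translation by $a$. Then $$T_aN=dl_a\Bigl(\sum_{\substack{\epsilon\in U(1),\ \operatorname{Im}\epsilon\ge0\\ \epsilon\ne1}}\mathfrak g_{0,\epsilon}+\sum_{\alpha\in\Delta^+}\ \sum_{\substack{\epsilon\in U(1)\\ \langle\alpha,w\rangle+\arg\epsilon\notin2\pi\mathbb Z}}\mathfrak g_{\alpha,\epsilon}\Bigr),$$ $$T_a^\perp N=dl_a\Bigl(\mathfrak t+\sum_{\alpha\in\Delta^+}\ \sum_{\substack{\epsilon\in U(1)\\ \langle\alpha,w\rangle+\arg\epsilon\in2\pi\mathbb Z}}\mathfrak g_{\alpha,\epsilon}\Bigr),$$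 and both sums are direct. Moreover the decomposition of $T_aN$ is the eigenspace decomposition of the family of shape operators $A_\xi$ of $N$ at $a$ in the normal directions $dl_a(\xi)$, $\xi\in\mathfrak t$ (with $\langle A_\xi u,v\rangle=\langle\nabla_uV,dl_a(\xi)\rangle$ for $u,v\in T_aN$ and $V$ a tangent field of $N$ with $V_a=v$). That is, $A_\xi$ is linear in $\xi$, and for every $\xi\in\mathfrak t$: * $A_\xi$ is $0$ on each $dl_a(\mathfrak g_{0,\epsilon})$ in the sum for $T_aN$; * $A_\xi$ is multiplication by $-\dfrac{\langle\alpha,\xi\rangle}{2}\cot\dfrac{\langle\alpha,w\rangle+\arg\epsilon}{2}$ on each $dl_a(\mathfrak g_{\alpha,\epsilon})$ in the sum for $T_aN$. Each eigenspace of a single $A_\xi$, and each common eigenspace of the family $\{A_\xi\}_{\xi\in\mathfrak t}$, is the sum of those summands of $T_aN$ on which the stated eigenvalue, respectively the stated eigenvalue as a function of $\xi$, is the given one. -/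

import Mathlib

open scoped Manifold ContDiff TensorProduct

noncomputable section

namespace SigmaAction

instance instLEInftyMinSmoothness : ENat.LEInfty (minSmoothness ℝ 3) :=
  ⟨by rw [minSmoothness_of_isRCLikeNormedField]; exact ENat.LEInfty.out⟩

/-! ### Riemannian geometry of subsets of a manifold -/

section Riemannian

variable {E : Type*} [NormedAddCommGroup E] [NormedSpace ℝ E]
  {M : Type*} [TopologicalSpace M] [ChartedSpace E M]

/-- The velocities at `p` of the smooth curves of `M` that run inside the subset `N`.  For an
embedded submanifold `N` this is the tangent space of `N` at `p`. -/
def velocities (N : Set M) (p : M) : Set (TangentSpace 𝓘(ℝ, E) p) :=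
  {u | ∃ γ : ℝ → M, ContMDiff 𝓘(ℝ, ℝ) 𝓘(ℝ, E) ∞ γ ∧ (∀ t, γ t ∈ N) ∧
    (⟨γ 0, mfderiv 𝓘(ℝ, ℝ) 𝓘(ℝ, E) γ 0 (1 : ℝ)⟩ : TangentBundle 𝓘(ℝ, E) M) = ⟨p, u⟩}

/-- The tangent space of `N` at `p` as a linear subspace of the tangent space of `M`. -/
def tangentSubspace (N : Set M) (p : M) : Submodule ℝ (TangentSpace 𝓘(ℝ, E) p) :=
  Submodule.span ℝ (velocities N p)

/-- The normal space of `N` at `p` with respect to the metric `g`. -/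
def normalSubspace (g : Π p : M, LinearMap.BilinForm ℝ (TangentSpace 𝓘(ℝ, E) p))
    (N : Set M) (p : M) : Submodule ℝ (TangentSpace 𝓘(ℝ, E) p) where
  carrier := {v | ∀ u ∈ tangentSubspace N p, g p u v = 0}
  zero_mem' := by simp
  add_mem' := by
    intro v v' hv hv' u hu
    simp [hv u hu, hv' u hu]
  smul_mem' := by
    intro r v hv u hu
    simp [hv u hu]

/-- A smooth vector field. -/
def SmoothField [IsManifold 𝓘(ℝ, E) 1 M] (X : Π p : M, TangentSpace 𝓘(ℝ, E) p) : Prop :=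
  ContMDiff 𝓘(ℝ, E) 𝓘(ℝ, E).tangent ∞
    (fun p => (⟨p, X p⟩ : TangentBundle 𝓘(ℝ, E) M))

/-- The number `g (∇_X Y, Z)` at `p`, where `∇` is the Levi-Civita connection of the metric `g`,
given by the Koszul formula. -/
def leviCivita (g : Π p : M, LinearMap.BilinForm ℝ (TangentSpace 𝓘(ℝ, E) p))
    (X Y Z : Π p : M, TangentSpace 𝓘(ℝ, E) p) (p : M) : ℝ :=
  (1 / 2) *
    ((mvfderiv 𝓘(ℝ, E) (fun q => g q (Y q) (Z q)) p (X p))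
      + (mvfderiv 𝓘(ℝ, E) (fun q => g q (X q) (Z q)) p (Y p))
      - (mvfderiv 𝓘(ℝ, E) (fun q => g q (X q) (Y q)) p (Z p))
      + g p (VectorField.mlieBracket 𝓘(ℝ, E) X Y p) (Z p)
      - g p (VectorField.mlieBracket 𝓘(ℝ, E) X Z p) (Y p)
      - g p (VectorField.mlieBracket 𝓘(ℝ, E) Y Z p) (X p))

/-- The Koszul formula computes every torsion-free metric connection. -/
theorem leviCivita_eq [IsManifold 𝓘(ℝ, E) 2 M] [FiniteDimensional ℝ E] [CompleteSpace E]
    (g : Π p : M, LinearMap.BilinForm ℝ (TangentSpace 𝓘(ℝ, E) p)) (hg : ∀ p, (g p).IsSymm)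
    (cov : CovariantDerivative 𝓘(ℝ, E) E (TangentSpace 𝓘(ℝ, E) : M → Type _))
    (htor : cov.torsion = 0)
    (hmet : ∀ X Y Z : Π p : M, TangentSpace 𝓘(ℝ, E) p, SmoothField X → SmoothField Y →
      SmoothField Z → ∀ p,
        (mvfderiv 𝓘(ℝ, E) (fun q => g q (Y q) (Z q)) p (X p))
          = g p (cov Y p (X p)) (Z p) + g p (Y p) (cov Z p (X p)))
    (X Y Z : Π p : M, TangentSpace 𝓘(ℝ, E) p) (hX : SmoothField X) (hY : SmoothField Y)
    (hZ : SmoothField Z) (p : M) :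
    g p (cov Y p (X p)) (Z p) = leviCivita g X Y Z p := by
  have dX := hX.mdifferentiable (by simp) p
  have dY := hY.mdifferentiable (by simp) p
  have dZ := hZ.mdifferentiable (by simp) p
  have e1 := (CovariantDerivative.torsion_eq_zero_iff cov).1 htor dX dY
  have e2 := (CovariantDerivative.torsion_eq_zero_iff cov).1 htor dX dZ
  have e3 := (CovariantDerivative.torsion_eq_zero_iff cov).1 htor dY dZ
  unfold leviCivita
  rw [hmet X Y Z hX hY hZ, hmet Y X Z hY hX hZ, hmet Z X Y hZ hX hY, ← e1, ← e2, ← e3]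
  have s := fun u v => (hg p).eq u v
  simp only [map_sub, LinearMap.sub_apply]
  rw [s (cov Z p (Y p)) (X p), s (cov Y p (Z p)) (X p), s (cov Z p (X p)) (Y p)]
  ring

/-- `A` is the shape operator of `N` at `p` in the normal direction `ξ`:
`g (A X, Y) = g (∇_X Y, ξ)` at `p` for all vector fields `X`, `Y` that are tangent to `N`
along `N`; equivalently `A u` is minus the tangential part of the derivative in the direction
`u` of a normal field that extends `ξ`. -/
def IsShapeOperator [IsManifold 𝓘(ℝ, E) 1 M]
    (g : Π p : M, LinearMap.BilinForm ℝ (TangentSpace 𝓘(ℝ, E) p))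
    (N : Set M) (p : M) (ξ : TangentSpace 𝓘(ℝ, E) p)
    (A : Module.End ℝ (tangentSubspace (E := E) N p)) : Prop :=
  ∀ X Y Z : Π q : M, TangentSpace 𝓘(ℝ, E) q,
    SmoothField X → SmoothField Y → SmoothField Z →
    (∀ q ∈ N, X q ∈ tangentSubspace N q) → (∀ q ∈ N, Y q ∈ tangentSubspace N q) → Z p = ξ →
    ∀ u : tangentSubspace (E := E) N p, (u : TangentSpace 𝓘(ℝ, E) p) = X p →
      g p (A u : TangentSpace 𝓘(ℝ, E) p) (Y p) = leviCivita g X Y Z p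

end Riemannian

/-! ### Lie groups -/

section LieGroup

variable (E : Type*) [NormedAddCommGroup E] [NormedSpace ℝ E] [CompleteSpace E]
  (G : Type*) [TopologicalSpace G] [ChartedSpace E G] [Group G] [LieGroup 𝓘(ℝ, E) ∞ G]

/-- The Lie algebra of `G`. -/
abbrev LieAlg : Type _ := GroupLieAlgebra 𝓘(ℝ, E) G

variable {E G}

/-- The differential `dl_p : 𝔤 → T_p G` of the left translation by `p`. -/
def dl (p : G) : LieAlg E G →L[ℝ] TangentSpace 𝓘(ℝ, E) p :=
  mfderiv 𝓘(ℝ, E) 𝓘(ℝ, E) (fun x : G => p * x) 1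

theorem exists_integralCurve [T2Space G] (w : LieAlg E G) :
    ∃ γ : ℝ → G, γ 0 = 1 ∧
      IsMIntegralCurve γ (mulInvariantVectorField (I := 𝓘(ℝ, E)) (G := G) w) := by
  have hsm : ContMDiff 𝓘(ℝ, E) 𝓘(ℝ, E).tangent 1 (fun g : G =>
      (⟨g, mulInvariantVectorField (I := 𝓘(ℝ, E)) w g⟩ : TangentBundle 𝓘(ℝ, E) G)) := by
    refine (contMDiff_mulInvariantVectorField (I := 𝓘(ℝ, E)) (G := G) w).of_le ?_
    rw [minSmoothness_of_isRCLikeNormedField]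
    norm_num
  obtain ⟨γ, h0, hγ⟩ := exists_isMIntegralCurveAt_of_contMDiffAt_boundaryless
    (t₀ := 0) (hsm.contMDiffAt (x := (1 : G)))
  obtain ⟨ε, hε, hγ⟩ := isMIntegralCurveAt_iff'.1 hγ
  refine exists_isMIntegralCurve_of_isMIntegralCurveOn hsm hε (fun x => ?_) 1
  refine ⟨fun t => x * γ t, by simp [h0], ?_⟩
  have hIoo : Set.Ioo (-ε) ε = Metric.ball (0 : ℝ) ε := by simp [Real.ball_eq_Ioo]
  rw [hIoo]
  intro t ht
  have hmul : ∀ y z : G, MDifferentiableAt 𝓘(ℝ, E) 𝓘(ℝ, E) (fun b : G => y * b) z :=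
    fun y z => (contMDiff_mul_left (I := 𝓘(ℝ, E)) (n := ∞)).contMDiffAt.mdifferentiableAt
      (by simp)
  have key := (hmul x (γ t)).hasMFDerivAt.comp_hasMFDerivWithinAt t (hγ t ht)
  have hc : mfderiv 𝓘(ℝ, E) 𝓘(ℝ, E) (fun b : G => (x * γ t) * b) 1 =
      (mfderiv 𝓘(ℝ, E) 𝓘(ℝ, E) (fun b : G => x * b) (γ t * 1)).comp
        (mfderiv 𝓘(ℝ, E) 𝓘(ℝ, E) (fun b : G => γ t * b) 1) := by
    rw [← mfderiv_comp (I' := 𝓘(ℝ, E)) 1 (hmul _ _) (hmul _ _)]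
    congr 1
    ext b
    simp [mul_assoc]
  refine key.congr_mfderiv ?_
  ext
  have hγ1 : γ t * 1 = γ t := mul_one _
  rw [hγ1] at hc
  have hw := congrArg (fun L => L w) hc
  exact ((mfderiv 𝓘(ℝ, E) 𝓘(ℝ, E) (fun b : G => x * b) (γ t)).map_smul (1 : ℝ)
    (mulInvariantVectorField (I := 𝓘(ℝ, E)) w (γ t))).trans
      (congrArg (fun v : E => (1 : ℝ) • v) hw).symm

/-- The exponential map of `G`: the value at time `1` of the integral curve, starting at the
identity, of the left-invariant vector field with value `w` at the identity. -/
def lieExp [T2Space G] (w : LieAlg E G) : G :=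
  (exists_integralCurve w).choose 1

/-- The inner product on `𝔤` that is `-c` times the Killing form. -/
def innerForm (c : ℝ) : LinearMap.BilinForm ℝ (LieAlg E G) :=
  (-c) • killingForm ℝ (LieAlg E G)

/-- The left-invariant metric on `G` with value `innerForm c` at the identity.  It is
bi-invariant, because the Killing form is invariant under automorphisms of `𝔤`. -/
def biinvMetric (c : ℝ) (p : G) : LinearMap.BilinForm ℝ (TangentSpace 𝓘(ℝ, E) p) :=
  (innerForm (E := E) (G := G) c).compl₁₂
    ((dl (E := E) p).inverse : TangentSpace 𝓘(ℝ, E) p →L[ℝ] LieAlg E G).toLinearMap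
    ((dl (E := E) p).inverse : TangentSpace 𝓘(ℝ, E) p →L[ℝ] LieAlg E G).toLinearMap

/-- The orbit through `a` of the action `(b, c) · a = b a c⁻¹` of the subgroup
`G(σ) = {(b, σ b)}` of `G × G`. -/
def sigmaOrbit {G : Type*} [Group G] (σ : G ≃* G) (a : G) : Set G :=
  {x | ∃ p ∈ σ.toMonoidHom.graph, x = p.1 * a * p.2⁻¹}

/-- The differential at the identity of a homomorphism `G → G`, as a linear map `𝔤 → 𝔤`. -/
def dAut (σ : G ≃* G) : LieAlg E G →ₗ[ℝ] LieAlg E G :=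
  (mfderiv 𝓘(ℝ, E) 𝓘(ℝ, E) σ 1 : LieAlg E G →L[ℝ] LieAlg E G).toLinearMap

/-- The fixed point set `𝔤^σ` of the differential of `σ`. -/
def fixedPoints (σ : G ≃* G) : Submodule ℝ (LieAlg E G) :=
  LinearMap.eqLocus (dAut σ) LinearMap.id

/-- `𝔱` is a maximal abelian subspace of `𝔤^σ`. -/
def IsMaximalAbelian (σ : G ≃* G) (𝔱 : Submodule ℝ (LieAlg E G)) : Prop :=
  Maximal (fun s : Submodule ℝ (LieAlg E G) =>
    s ≤ fixedPoints σ ∧ ∀ x ∈ s, ∀ y ∈ s, ⁅x, y⁆ = 0) 𝔱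

variable (E G) in
/-- The complexification `𝔤^ℂ`. -/
abbrev LieAlgC : Type _ := ℂ ⊗[ℝ] LieAlg E G

/-- The space `𝔤(α)` of the `z` in `𝔤^ℂ` with `ad η z = i ⟨α, η⟩ z` for all `η` in `𝔱`. -/
def rootSpaceC (c : ℝ) (𝔱 : Submodule ℝ (LieAlg E G)) (α : LieAlg E G) :
    Submodule ℂ (LieAlgC E G) :=
  ⨅ η ∈ 𝔱, LinearMap.ker ((LieAlgebra.ad ℂ (LieAlgC E G) ((1 : ℂ) ⊗ₜ[ℝ] η)) -
    (Complex.I * (innerForm c α η : ℂ)) • LinearMap.id)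

/-- The eigenspace `𝔤(ε)` of `σ` on `𝔤^ℂ`. -/
def sigmaSpaceC (σ : G ≃* G) (ε : Circle) : Submodule ℂ (LieAlgC E G) :=
  Module.End.eigenspace ((dAut (E := E) σ).baseChange ℂ) (ε : ℂ)

/-- The space `𝔤(α, ε) = 𝔤(α) ∩ 𝔤(ε)`. -/
def jointSpaceC (c : ℝ) (σ : G ≃* G) (𝔱 : Submodule ℝ (LieAlg E G)) (α : LieAlg E G)
    (ε : Circle) : Submodule ℂ (LieAlgC E G) :=
  rootSpaceC c 𝔱 α ⊓ sigmaSpaceC σ ε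

/-- The set `Δ` of roots: the nonzero `α` in `𝔱` with `𝔤(α) ≠ 0`. -/
def roots (c : ℝ) (𝔱 : Submodule ℝ (LieAlg E G)) : Set (LieAlg E G) :=
  {α | α ∈ 𝔱 ∧ α ≠ 0 ∧ rootSpaceC c 𝔱 α ≠ ⊥}

/-- `P` is a choice of exactly one root from each pair `±α` of roots; every system of positive
roots is one. -/
def IsPositiveSystem (c : ℝ) (𝔱 : Submodule ℝ (LieAlg E G)) (P : Set (LieAlg E G)) : Prop :=
  P ⊆ roots c 𝔱 ∧ ∀ α ∈ roots c 𝔱, Xor (α ∈ P) (-α ∈ P)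

/-- The real space `𝔤_{α, ε} = (𝔤(α, ε) + 𝔤(-α, ε⁻¹)) ∩ 𝔤`; for `α = 0` this is
`𝔤_{0, ε}`. -/
def realSpace (c : ℝ) (σ : G ≃* G) (𝔱 : Submodule ℝ (LieAlg E G)) (α : LieAlg E G)
    (ε : Circle) : Submodule ℝ (LieAlg E G) :=
  ((jointSpaceC c σ 𝔱 α ε ⊔ jointSpaceC c σ 𝔱 (-α) ε⁻¹).restrictScalars ℝ).comap
    (TensorProduct.mk ℝ ℂ (LieAlg E G) 1)

/-- The condition `⟨α, w⟩ + arg ε ∈ 2πℤ`. -/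
def Resonant (c : ℝ) (w α : LieAlg E G) (ε : Circle) : Prop :=
  ∃ k : ℤ, innerForm c α w + Complex.arg (ε : ℂ) = 2 * Real.pi * k

/-- The pairs `(α, ε)` that label the summands of the tangent space: `(0, ε)` with `Im ε ≥ 0` and
`ε ≠ 1`, and `(α, ε)` with `α` a positive root and `⟨α, w⟩ + arg ε ∉ 2πℤ`. -/
def tangentIndex (c : ℝ) (P : Set (LieAlg E G)) (w : LieAlg E G) : Set (LieAlg E G × Circle) :=
  {i | (i.1 = 0 ∧ 0 ≤ (i.2 : ℂ).im ∧ i.2 ≠ 1) ∨ (i.1 ∈ P ∧ ¬ Resonant c w i.1 i.2)}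

/-- The pairs `(α, ε)` with `α` a positive root and `⟨α, w⟩ + arg ε ∈ 2πℤ`. -/
def normalIndex (c : ℝ) (P : Set (LieAlg E G)) (w : LieAlg E G) : Set (LieAlg E G × Circle) :=
  {i | i.1 ∈ P ∧ Resonant c w i.1 i.2}

/-- The number `-(⟨α, ξ⟩ / 2) cot ((⟨α, w⟩ + arg ε) / 2)`. It is `0` for `α = 0`. -/
def curvature (c : ℝ) (w ξ α : LieAlg E G) (ε : Circle) : ℝ :=
  -(innerForm c α ξ / 2) * Real.cot ((innerForm c α w + Complex.arg (ε : ℂ)) / 2)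

end LieGroup

end SigmaAction

end

open SigmaAction

/-!
Everything is transported to the Lie algebra by left translation.  Differentiating the orbit map
`b ↦ b a σ(b)⁻¹` shows that `dl_a⁻¹ (T_a N)` is the range of `R - σ`, where `R = Ad a⁻¹`
(`velocities_sigmaOrbit`).  Both `R` and `σ` are isometries of the inner product and they commute,
so `R - σ` is normal and the normal space corresponds to its kernel (`mem_ker_iff_orthogonal`).
The inner product is positive definite because the Killing form of a semisimple Lie algebra with an
`Ad`-invariant inner product is negative definite (`isTwistedCartan`).

Since `𝔱` is abelian and fixed by `σ`, the skew operators `ad η`, `η ∈ 𝔱`, and the isometry `σ` are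
simultaneously diagonalisable over `ℂ`, and the joint eigenspaces are the `𝔤(α, ε)`
(`iSup_jointC`).  On `𝔤(α, ε)` the operator `R` acts by `exp (-i⟨α, w⟩)`
(`AdL_inv_lieExp_baseChange`), hence `R - σ` acts by `exp (-i⟨α, w⟩) - ε`, which vanishes exactly
when `⟨α, w⟩ + arg ε ∈ 2πℤ`.  Taking real points gives range and kernel of `R - σ` as sums of the
`𝔤_{α, ε}` (`range_sub_eq`, `ker_sub_eq`); the contribution of `(0, 1)` is `𝔱` because `𝔱` is
maximal abelian (`jointR_zero_one`).

For the shape operators, the Koszul formula for left-trivialised fields together with the tangency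
of the field along the orbit gives `A_ξ ((R - σ) x) = ½ [ξ, (R + σ) x]` up to normal vectors
(`leviCivita_of_tangent`).  On `𝔤(α, ε)` the right-hand side is
`(i⟨α, ξ⟩ / 2) (exp (-i⟨α, w⟩) + ε) x`, which is the asserted multiple of `(R - σ) x` by
`cot_identity`.

The velocities in the statement are those of arbitrary smooth curves of `G` that stay in the orbit.
That they all lie in the image of the differential of the orbit map is proved without a submanifold
structure on the orbit, by a compactness argument (`exists_velocity_eq`).
-/

noncomputable section

namespace SigmaAction

/-! ### Skew and isometric endomorphisms for a positive definite form -/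

section PosDef

variable {V : Type*} [AddCommGroup V] [Module ℝ V] [FiniteDimensional ℝ V]
  {B : LinearMap.BilinForm ℝ V}

theorem isCompl_orthogonal_of_posDef (hB : ∀ x, x ≠ 0 → 0 < B x x) (hs : B.IsSymm)
    (p : Submodule ℝ V) : IsCompl p (B.orthogonal p) := by
  refine LinearMap.BilinForm.isCompl_orthogonal_of_restrict_nondegenerate hs.isRefl ?_
  have hnn : ∀ x : p, 0 ≤ B.restrict p x x := fun x => by
    by_cases h : (x : V) = 0
    · simp [h]
    · exact (hB x h).le
  exact (LinearMap.BilinForm.nondegenerate_iff' _ hnn ⟨fun x y => hs.eq x y⟩).2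
    fun x hx => hB x fun h => hx (Subtype.ext h)

theorem isSemisimple_of_skew (hB : ∀ x, x ≠ 0 → 0 < B x x) (hs : B.IsSymm) {f : Module.End ℝ V}
    (hf : ∀ x y, B (f x) y = -B x (f y)) : f.IsSemisimple := by
  refine Module.End.isSemisimple_iff.2 fun p hp =>
    ⟨B.orthogonal p, fun y hy x hx => ?_, isCompl_orthogonal_of_posDef hB hs p⟩
  have h : B (f x) y = 0 := hy (f x) (hp hx)
  rw [hf] at h
  exact neg_eq_zero.1 h

omit [FiniteDimensional ℝ V] in
theorem injective_of_isometry (hB : ∀ x, x ≠ 0 → 0 < B x x) {f : Module.End ℝ V}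
    (hf : ∀ x y, B (f x) (f y) = B x y) : Function.Injective f := by
  refine (injective_iff_map_eq_zero f).2 fun x hx => ?_
  by_contra h
  have := hB x h
  rw [← hf, hx] at this
  simp at this

theorem isSemisimple_of_isometry (hB : ∀ x, x ≠ 0 → 0 < B x x) (hs : B.IsSymm)
    {f : Module.End ℝ V} (hf : ∀ x y, B (f x) (f y) = B x y) : f.IsSemisimple := by
  have hinj := injective_of_isometry hB hf
  refine Module.End.isSemisimple_iff.2 fun p hp =>
    ⟨B.orthogonal p, fun y hy x hx => ?_, isCompl_orthogonal_of_posDef hB hs p⟩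
  have hmap : p.map f = p := by
    refine Submodule.eq_of_le_of_finrank_eq (Submodule.map_le_iff_le_comap.2 hp) ?_
    exact LinearEquiv.finrank_eq (Submodule.equivMapOfInjective f hinj p).symm
  obtain ⟨x', hx', rfl⟩ : x ∈ p.map f := hmap.symm ▸ hx
  exact (hf x' y).trans (hy x' hx')

/-- A nonzero skew endomorphism `f` has `tr f² = -∑ |f bᵢ|² < 0` in an orthonormal basis `b`. -/
theorem trace_mul_self_neg_of_skew (hB : ∀ x, x ≠ 0 → 0 < B x x) (hs : B.IsSymm)
    {f : Module.End ℝ V} (hf : ∀ x y, B (f x) y = -B x (f y)) (h0 : f ≠ 0) :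
    LinearMap.trace ℝ V (f ∘ₗ f) < 0 := by
  let core : InnerProductSpace.Core ℝ V :=
    { inner := fun x y => B x y
      conj_inner_symm := fun x y => hs.eq y x
      re_inner_nonneg := fun x => by
        by_cases h : x = 0
        · simp [h]
        · exact (hB x h).le
      add_left := fun x y z => by simp
      smul_left := fun x y r => by simp
      definite := fun x hx => by
        by_contra h
        exact (hB x h).ne' hx }
  let : NormedAddCommGroup V := core.toNormedAddCommGroup
  let : InnerProductSpace ℝ V := InnerProductSpace.ofCore core.toCore
  have hin : ∀ x y : V, inner ℝ x y = B x y := fun x y => rfl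
  let b := stdOrthonormalBasis ℝ V
  rw [LinearMap.trace_eq_sum_inner _ b]
  have hterm : ∀ i, inner ℝ (b i) ((f ∘ₗ f) (b i)) = -B (f (b i)) (f (b i)) := fun i => by
    rw [hin, LinearMap.comp_apply, hf, neg_neg]
  simp only [hterm, Finset.sum_neg_distrib, Left.neg_neg_iff]
  obtain ⟨i, hi⟩ : ∃ i, f (b i) ≠ 0 := by
    by_contra! h
    exact h0 (b.toBasis.ext fun i => by simpa using h i)
  refine Finset.sum_pos' (fun i _ => ?_) ⟨i, Finset.mem_univ _, hB _ hi⟩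
  by_cases h : f (b i) = 0
  · simp [h]
  · exact (hB _ h).le

end PosDef

/-! ### Joint eigenspaces -/

section Joint

variable {K V ι : Type*} [Field K] [AddCommGroup V] [Module K V]

theorem iSupIndep_iInf_eigenspace {f : ι → Module.End K V} (hf : ∀ i j, Commute (f i) (f j)) :
    iSupIndep fun χ : ι → K => ⨅ i, (f i).eigenspace (χ i) := by
  have h := Module.End.independent_iInf_maxGenEigenspace_of_forall_mapsTo f fun i j φ =>
    Module.End.mapsTo_maxGenEigenspace_of_comm (hf j i) φ
  refine h.mono fun χ => iInf_mono fun i => ?_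
  exact (f i).genEigenspace (χ i) |>.mono le_top

theorem iSup_iInf_eigenspace_eq_top [FiniteDimensional K V] [IsAlgClosed K]
    {f : ι → Module.End K V} (hf : ∀ i j, Commute (f i) (f j))
    (hs : ∀ i, (f i).IsSemisimple) :
    ⨆ χ : ι → K, ⨅ i, (f i).eigenspace (χ i) = ⊤ := by
  have h := Module.End.iSup_iInf_maxGenEigenspace_eq_top_of_iSup_maxGenEigenspace_eq_top_of_commute
    f (fun i j _ => hf i j) fun i => Module.End.iSup_maxGenEigenspace_eq_top (f i)
  simpa only [(hs _).isFinitelySemisimple.maxGenEigenspace_eq_eigenspace] using h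

/-- If a family of endomorphisms acts by scalars `κ j` on submodules `R j` that span, then its
common eigenspaces are the sums of the `R j` with the same scalars. -/
theorem iInf_eigenspace_eq_iSup {J : Type*} {f : ι → Module.End K V} {R : J → Submodule K V}
    {κ : J → ι → K} (hR : ⨆ j, R j = ⊤) (hf : ∀ j, ∀ x ∈ R j, ∀ i, f i x = κ j i • x)
    (χ : ι → K) :
    ⨅ i, (f i).eigenspace (χ i) = ⨆ j, ⨆ _ : κ j = χ, R j := by
  have hcomm : ∀ i i', Commute (f i) (f i') := fun i i' => by
    refine LinearMap.ext fun x => ?_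
    have hx : x ∈ ⨆ j, R j := hR ▸ Submodule.mem_top
    induction hx using Submodule.iSup_induction' with
    | mem j x hx => simp [hf j x hx, smul_smul, mul_comm]
    | zero => simp
    | add x y _ _ hx hy => simpa using congrArg₂ (· + ·) hx hy
  have hind := iSupIndep_iInf_eigenspace hcomm
  let F : (ι → K) → Submodule K V := fun χ => ⨆ j, ⨆ _ : κ j = χ, R j
  have hF : ∀ χ, F χ ≤ ⨅ i, (f i).eigenspace (χ i) := fun χ => by
    refine iSup₂_le fun j hj => le_iInf fun i x hx => ?_
    rw [Module.End.mem_eigenspace_iff, hf j x hx, hj]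
  have htop : F χ ⊔ ⨆ (χ') (_ : χ' ≠ χ), F χ' = ⊤ := by
    refine top_le_iff.1 (hR ▸ iSup_le fun j => ?_)
    by_cases h : κ j = χ
    · exact le_sup_of_le_left (le_iSup₂_of_le j h le_rfl)
    · exact le_sup_of_le_right (le_iSup₂_of_le (κ j) h (le_iSup₂_of_le j rfl le_rfl))
  refine le_antisymm ?_ (hF χ)
  have hdis : Disjoint (⨅ i, (f i).eigenspace (χ i)) (⨆ (χ') (_ : χ' ≠ χ), F χ') :=
    (hind χ).mono_right (iSup₂_mono fun χ' _ => hF χ')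
  calc ⨅ i, (f i).eigenspace (χ i)
      = (F χ ⊔ ⨆ (χ') (_ : χ' ≠ χ), F χ') ⊓ ⨅ i, (f i).eigenspace (χ i) := by
        rw [htop, top_inf_eq]
    _ = F χ ⊔ (⨆ (χ') (_ : χ' ≠ χ), F χ') ⊓ ⨅ i, (f i).eigenspace (χ i) :=
        sup_inf_assoc_of_le _ (hF χ)
    _ = F χ := by rw [inf_comm, hdis.eq_bot, sup_bot_eq]
    _ ≤ _ := le_rfl

end Joint

/-! ### Complexification -/

section Complexification

variable {V : Type*} [AddCommGroup V] [Module ℝ V]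

/-- The real part `ℂ ⊗ V → V`. -/
def rePart : ℂ ⊗[ℝ] V →ₗ[ℝ] V := (TensorProduct.lid ℝ V).toLinearMap ∘ₗ Complex.reLm.rTensor V

/-- The imaginary part `ℂ ⊗ V → V`. -/
def imPart : ℂ ⊗[ℝ] V →ₗ[ℝ] V := (TensorProduct.lid ℝ V).toLinearMap ∘ₗ Complex.imLm.rTensor V

/-- Complex conjugation of `ℂ ⊗ V`. -/
def conjC : ℂ ⊗[ℝ] V →ₗ[ℝ] ℂ ⊗[ℝ] V := Complex.conjAe.toLinearMap.rTensor V

@[simp] theorem rePart_tmul (z : ℂ) (x : V) : rePart (z ⊗ₜ[ℝ] x) = z.re • x := by simp [rePart]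

@[simp] theorem imPart_tmul (z : ℂ) (x : V) : imPart (z ⊗ₜ[ℝ] x) = z.im • x := by simp [imPart]

@[simp] theorem conjC_tmul (z : ℂ) (x : V) :
    conjC (z ⊗ₜ[ℝ] x) = (starRingEnd ℂ z) ⊗ₜ[ℝ] x := by simp [conjC]

theorem conjC_smul (r : ℂ) (z : ℂ ⊗[ℝ] V) : conjC (r • z) = (starRingEnd ℂ r) • conjC z := by
  induction z with
  | zero => simp
  | tmul s x => simp [TensorProduct.smul_tmul']
  | add x y hx hy => simp [hx, hy]

theorem conjC_baseChange (f : Module.End ℝ V) (z : ℂ ⊗[ℝ] V) :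
    conjC (f.baseChange ℂ z) = f.baseChange ℂ (conjC z) := by
  induction z with
  | zero => simp
  | tmul s x => simp
  | add x y hx hy => simp [hx, hy]

@[simp] theorem conjC_conjC (z : ℂ ⊗[ℝ] V) : conjC (conjC z) = z := by
  induction z with
  | zero => simp
  | tmul s x => simp
  | add x y hx hy => simp [hx, hy]

theorem eq_rePart_add_imPart (z : ℂ ⊗[ℝ] V) :
    z = (1 : ℂ) ⊗ₜ[ℝ] rePart z + Complex.I ⊗ₜ[ℝ] imPart z := by
  induction z with
  | zero => simp
  | tmul s x =>
    simp only [rePart_tmul, imPart_tmul, ← TensorProduct.smul_tmul, ← TensorProduct.add_tmul]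
    congr 1
    apply Complex.ext <;> simp
  | add x y hx hy =>
    nth_rewrite 1 [hx, hy]
    simp only [map_add, TensorProduct.tmul_add]
    abel

theorem one_tmul_rePart (z : ℂ ⊗[ℝ] V) :
    (1 : ℂ) ⊗ₜ[ℝ] rePart z = (2⁻¹ : ℂ) • (z + conjC z) := by
  induction z with
  | zero => simp
  | tmul s x =>
    simp only [rePart_tmul, conjC_tmul, ← TensorProduct.smul_tmul, ← TensorProduct.add_tmul,
      TensorProduct.smul_tmul']
    congr 1
    apply Complex.ext <;> simp
    ring
  | add x y hx hy =>
    simp only [map_add, TensorProduct.tmul_add, hx, hy, ← smul_add]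
    congr 1
    abel

theorem one_tmul_injective : Function.Injective fun x : V => (1 : ℂ) ⊗ₜ[ℝ] x := fun x y h => by
  simpa using congrArg rePart h

theorem rePart_baseChange (f : Module.End ℝ V) (z : ℂ ⊗[ℝ] V) :
    rePart (f.baseChange ℂ z) = f (rePart z) := by
  induction z with
  | zero => simp
  | tmul s x => simp
  | add x y hx hy => simp [hx, hy]

theorem imPart_baseChange (f : Module.End ℝ V) (z : ℂ ⊗[ℝ] V) :
    imPart (f.baseChange ℂ z) = f (imPart z) := by
  induction z with
  | zero => simp
  | tmul s x => simp
  | add x y hx hy => simp [hx, hy]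

theorem rePart_smul (r : ℂ) (z : ℂ ⊗[ℝ] V) :
    rePart (r • z) = r.re • rePart z - r.im • imPart z := by
  induction z with
  | zero => simp
  | tmul s x => simp [TensorProduct.smul_tmul', sub_smul, mul_smul]
  | add x y hx hy => simp only [smul_add, map_add, hx, hy]; abel

theorem imPart_smul (r : ℂ) (z : ℂ ⊗[ℝ] V) :
    imPart (r • z) = r.re • imPart z + r.im • rePart z := by
  induction z with
  | zero => simp
  | tmul s x => simp [TensorProduct.smul_tmul', add_smul, mul_smul]
  | add x y hx hy => simp only [smul_add, map_add, hx, hy]; abel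

/-- A semisimple real endomorphism has a squarefree, hence separable, minimal polynomial, so its
complexification is semisimple. -/
theorem isSemisimple_baseChange [FiniteDimensional ℝ V] {f : Module.End ℝ V}
    (hf : f.IsSemisimple) : Module.End.IsSemisimple (f.baseChange ℂ) := by
  have h1 : (minpoly ℝ f).Separable :=
    PerfectField.separable_iff_squarefree.2 hf.minpoly_squarefree
  refine Module.End.isSemisimple_of_squarefree_aeval_eq_zero
    (h1.map (f := algebraMap ℝ ℂ)).squarefree ?_
  rw [Polynomial.aeval_map_algebraMap]
  have h2 : Polynomial.aeval (f.baseChange ℂ) (minpoly ℝ f) =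
      (Polynomial.aeval f (minpoly ℝ f)).baseChange ℂ :=
    Polynomial.aeval_algHom_apply (Module.End.baseChangeHom ℝ ℂ V) f (minpoly ℝ f)
  rw [h2, minpoly.aeval, LinearMap.baseChange_zero]

/-- The real and imaginary parts of an eigenvector of a complexified endomorphism. -/
theorem rePart_imPart_of_eigenvector {f : Module.End ℝ V} {μ : ℂ} {z : ℂ ⊗[ℝ] V}
    (h : f.baseChange ℂ z = μ • z) :
    f (rePart z) = μ.re • rePart z - μ.im • imPart z ∧
      f (imPart z) = μ.re • imPart z + μ.im • rePart z := by
  rw [← rePart_baseChange, ← imPart_baseChange, h, rePart_smul, imPart_smul]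
  exact ⟨rfl, rfl⟩

variable {B : LinearMap.BilinForm ℝ V}

theorem rePart_imPart_pos (hB : ∀ x, x ≠ 0 → 0 < B x x) {z : ℂ ⊗[ℝ] V} (hz : z ≠ 0) :
    0 < B (rePart z) (rePart z) + B (imPart z) (imPart z) := by
  have h0 : ∀ x, 0 ≤ B x x := fun x => by
    by_cases h : x = 0
    · simp [h]
    · exact (hB x h).le
  by_cases h : rePart z = 0
  · by_cases h' : imPart z = 0
    · exact absurd (by rw [eq_rePart_add_imPart z, h, h']; simp) hz
    · exact add_pos_of_nonneg_of_pos (h0 _) (hB _ h')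
  · exact add_pos_of_pos_of_nonneg (hB _ h) (h0 _)

theorem re_eigenvalue_eq_zero_of_skew (hB : ∀ x, x ≠ 0 → 0 < B x x) (hs : B.IsSymm)
    {f : Module.End ℝ V} (hf : ∀ x y, B (f x) y = -B x (f y)) {μ : ℂ} {z : ℂ ⊗[ℝ] V}
    (hz : z ≠ 0) (h : f.baseChange ℂ z = μ • z) : μ.re = 0 := by
  obtain ⟨h1, h2⟩ := rePart_imPart_of_eigenvector h
  have hpos := rePart_imPart_pos hB hz
  have hself : ∀ x, B (f x) x = 0 := fun x => by
    have := hf x x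
    rw [hs.eq x (f x)] at this
    linarith
  have e1 := hself (rePart z)
  have e2 := hself (imPart z)
  rw [h1] at e1
  rw [h2] at e2
  have e3 := hs.eq (rePart z) (imPart z)
  simp only [map_sub, map_add, map_smul, LinearMap.sub_apply, LinearMap.add_apply,
    LinearMap.smul_apply, smul_eq_mul] at e1 e2 e3
  have : μ.re * (B (rePart z) (rePart z) + B (imPart z) (imPart z)) = 0 := by
    rw [e3] at e2
    linear_combination e1 + e2
  exact (mul_eq_zero.1 this).resolve_right hpos.ne'

theorem norm_eigenvalue_eq_one_of_isometry (hB : ∀ x, x ≠ 0 → 0 < B x x) (hs : B.IsSymm)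
    {f : Module.End ℝ V} (hf : ∀ x y, B (f x) (f y) = B x y) {μ : ℂ} {z : ℂ ⊗[ℝ] V}
    (hz : z ≠ 0) (h : f.baseChange ℂ z = μ • z) : ‖μ‖ = 1 := by
  obtain ⟨h1, h2⟩ := rePart_imPart_of_eigenvector h
  have hpos := rePart_imPart_pos hB hz
  have e1 := hf (rePart z) (rePart z)
  have e2 := hf (imPart z) (imPart z)
  rw [h1] at e1
  rw [h2] at e2
  have e3 := hs.eq (rePart z) (imPart z)
  simp only [map_sub, map_add, map_smul, LinearMap.sub_apply, LinearMap.add_apply,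
    LinearMap.smul_apply, smul_eq_mul] at e1 e2 e3
  have : (Complex.normSq μ - 1) * (B (rePart z) (rePart z) + B (imPart z) (imPart z)) = 0 := by
    rw [Complex.normSq_apply]
    linear_combination e1 + e2
  have h3 := (mul_eq_zero.1 this).resolve_right hpos.ne'
  rw [Complex.normSq_eq_norm_sq] at h3
  nlinarith [norm_nonneg μ]

end Complexification

/-! ### The joint root space decomposition -/

section Roots

/-!
For an arbitrary real Lie algebra `L`, a bilinear form `B` and an endomorphism `s`, the following
definitions mirror `rootSpaceC`, `jointSpaceC`, `realSpace` and `IsMaximalAbelian`, to which they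
specialise definitionally.  Working with a variable `L` keeps the manifold structure of the group
out of the linear algebra.
-/

variable {L : Type*} [LieRing L] [LieAlgebra ℝ L]

/-- The complexification of `ad η`. -/
def adC (η : L) : Module.End ℂ (ℂ ⊗[ℝ] L) :=
  (LieAlgebra.ad ℝ L η : Module.End ℝ L).baseChange ℂ

theorem ad_one_tmul (η : L) : LieAlgebra.ad ℂ (ℂ ⊗[ℝ] L) ((1 : ℂ) ⊗ₜ[ℝ] η) = adC η := by
  refine LinearMap.ext fun z => ?_
  induction z with
  | zero => simp
  | tmul s x => simp [adC, LieAlgebra.ExtendScalars.bracket_tmul]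
  | add x y hx hy => simp only [map_add, hx, hy]

/-- The root space `{z | ad η z = i B(α, η) z for all η ∈ 𝔱}` in `ℂ ⊗ L`. -/
def rootC (B : LinearMap.BilinForm ℝ L) (𝔱 : Submodule ℝ L) (α : L) : Submodule ℂ (ℂ ⊗[ℝ] L) :=
  ⨅ η ∈ 𝔱, LinearMap.ker ((LieAlgebra.ad ℂ (ℂ ⊗[ℝ] L) ((1 : ℂ) ⊗ₜ[ℝ] η)) -
    (Complex.I * (B α η : ℂ)) • LinearMap.id)

/-- The intersection of a root space with an eigenspace of the complexification of `s`. -/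
def jointC (B : LinearMap.BilinForm ℝ L) (s : L →ₗ[ℝ] L) (𝔱 : Submodule ℝ L) (α : L)
    (ε : Circle) : Submodule ℂ (ℂ ⊗[ℝ] L) :=
  rootC B 𝔱 α ⊓ Module.End.eigenspace (s.baseChange ℂ) (ε : ℂ)

/-- The real points of `jointC α ε + jointC (-α) ε⁻¹`. -/
def jointR (B : LinearMap.BilinForm ℝ L) (s : L →ₗ[ℝ] L) (𝔱 : Submodule ℝ L) (α : L)
    (ε : Circle) : Submodule ℝ L :=
  ((jointC B s 𝔱 α ε ⊔ jointC B s 𝔱 (-α) ε⁻¹).restrictScalars ℝ).comap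
    (TensorProduct.mk ℝ ℂ L 1)

/-- `𝔱` is maximal among the abelian subspaces of the fixed point space of `s`. -/
def IsMaxAbelian (s : L →ₗ[ℝ] L) (𝔱 : Submodule ℝ L) : Prop :=
  Maximal (fun p : Submodule ℝ L =>
    p ≤ LinearMap.eqLocus s LinearMap.id ∧ ∀ x ∈ p, ∀ y ∈ p, ⁅x, y⁆ = 0) 𝔱

variable {B : LinearMap.BilinForm ℝ L} {s : L →ₗ[ℝ] L} {𝔱 : Submodule ℝ L}

theorem mem_rootC {α : L} {z : ℂ ⊗[ℝ] L} :
    z ∈ rootC B 𝔱 α ↔ ∀ η ∈ 𝔱, adC η z = (Complex.I * (B α η : ℂ)) • z := by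
  simp [rootC, ad_one_tmul, sub_eq_zero]

theorem mem_jointC {α : L} {ε : Circle} {z : ℂ ⊗[ℝ] L} :
    z ∈ jointC B s 𝔱 α ε ↔
      (∀ η ∈ 𝔱, adC η z = (Complex.I * (B α η : ℂ)) • z) ∧
        s.baseChange ℂ z = (ε : ℂ) • z := by
  rw [jointC, Submodule.mem_inf, mem_rootC,
    Module.End.mem_eigenspace_iff]

theorem conjC_mem_rootC {α : L} {z : ℂ ⊗[ℝ] L}
    (hz : z ∈ rootC B 𝔱 α) : conjC z ∈ rootC B 𝔱 (-α) := by
  rw [mem_rootC] at hz ⊢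
  intro η hη
  rw [adC, ← conjC_baseChange, ← adC, hz η hη, conjC_smul]
  simp

theorem conjC_mem_jointC {α : L} {ε : Circle} {z : ℂ ⊗[ℝ] L}
    (hz : z ∈ jointC B s 𝔱 α ε) : conjC z ∈ jointC B s 𝔱 (-α) ε⁻¹ := by
  refine ⟨conjC_mem_rootC hz.1, ?_⟩
  rw [mem_jointC] at hz
  change conjC z ∈ Module.End.eigenspace _ _
  rw [Module.End.mem_eigenspace_iff, ← conjC_baseChange, hz.2, conjC_smul,
    Circle.coe_inv_eq_conj]

theorem jointR_neg_inv (α : L) (ε : Circle) :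
    jointR B s 𝔱 (-α) ε⁻¹ = jointR B s 𝔱 α ε := by
  simp only [jointR, neg_neg, inv_inv, sup_comm]

theorem mem_jointR {α : L} {ε : Circle} {x : L} :
    x ∈ jointR B s 𝔱 α ε ↔
      ∃ z ∈ jointC B s 𝔱 α ε, ∃ z' ∈ jointC B s 𝔱 (-α) ε⁻¹,
        z + z' = (1 : ℂ) ⊗ₜ[ℝ] x := by
  simp only [jointR, Submodule.mem_comap, Submodule.restrictScalars_mem, Submodule.mem_sup]
  rfl

theorem rePart_mem_jointR {α : L} {ε : Circle} {z : ℂ ⊗[ℝ] L}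
    (hz : z ∈ jointC B s 𝔱 α ε) : rePart z ∈ jointR B s 𝔱 α ε := by
  refine mem_jointR.2 ⟨(2⁻¹ : ℂ) • z, Submodule.smul_mem _ _ hz, (2⁻¹ : ℂ) • conjC z,
    Submodule.smul_mem _ _ (conjC_mem_jointC hz), ?_⟩
  rw [one_tmul_rePart, smul_add]

theorem jointR_eq_bot {α : L} {ε : Circle} (h : rootC B 𝔱 α = ⊥) :
    jointR B s 𝔱 α ε = ⊥ := by
  have h' : ∀ z ∈ rootC B 𝔱 (-α), z = 0 := fun z hz => by
    have h1 := conjC_mem_rootC hz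
    rw [neg_neg, h, Submodule.mem_bot] at h1
    rw [← conjC_conjC z, h1, map_zero]
  refine (Submodule.eq_bot_iff _).2 fun x hx => ?_
  obtain ⟨z, hz, z', hz', e⟩ := mem_jointR.1 hx
  have hz0 : z = 0 := by
    have := hz.1
    rw [h] at this; exact this
  rw [hz0, h' z' hz'.1, add_zero] at e
  exact one_tmul_injective (by simpa using e.symm)

/-- The commuting family formed by `s` and the `ad η`, `η ∈ 𝔱`, on the complexification. -/
def jointFamily (s : L →ₗ[ℝ] L) (𝔱 : Submodule ℝ L) :
    Option 𝔱 → Module.End ℂ (ℂ ⊗[ℝ] L)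
  | none => s.baseChange ℂ
  | some η => adC (η : L)

/-- The character of `jointFamily` belonging to the pair `(α, ε)`. -/
def jointCharacter (B : LinearMap.BilinForm ℝ L) (𝔱 : Submodule ℝ L) (α : L) (ε : Circle) :
    Option 𝔱 → ℂ
  | none => ε
  | some η => Complex.I * (B α η : ℂ)

theorem jointC_eq_iInf (α : L) (ε : Circle) :
    jointC B s 𝔱 α ε =
      ⨅ i, (jointFamily s 𝔱 i).eigenspace (jointCharacter B 𝔱 α ε i) := by
  ext z
  simp only [mem_jointC, iInf_option, Submodule.mem_inf, Submodule.mem_iInf,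
    Module.End.mem_eigenspace_iff, jointFamily, jointCharacter, Subtype.forall]
  tauto

variable (hB : ∀ x : L, x ≠ 0 → 0 < B x x)
include hB

/-- A pair `(α, ε)` with `α ∈ 𝔱` is determined by its character, because `B` is definite on `𝔱`. -/
theorem jointCharacter_injective :
    Function.Injective fun i : 𝔱 × Circle => jointCharacter B 𝔱 (i.1 : L) i.2 := by
  rintro ⟨α, ε⟩ ⟨β, δ⟩ h
  have h1 : ε = δ := Circle.ext (congrFun h none)
  have h2 : ∀ η : 𝔱, B (α : L) η = B (β : L) η := fun η => by
    have := congrFun h (some η)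
    simpa [jointCharacter] using this
  have h3 : α = β := by
    by_contra hne
    have hne' : (α : L) - β ≠ 0 := fun h => hne (Subtype.ext (sub_eq_zero.1 h))
    have := hB _ hne'
    have h4 := h2 (α - β)
    simp only [map_sub, LinearMap.sub_apply, Submodule.coe_sub] at this h4
    linarith
  rw [h1, h3]

omit hB in
theorem commute_jointFamily
    (hbr : ∀ x y : L, s ⁅x, y⁆ = ⁅s x, s y⁆)
    (h𝔱 : IsMaxAbelian s 𝔱) (i j : Option 𝔱) :
    Commute (jointFamily s 𝔱 i) (jointFamily s 𝔱 j) := by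
  have key : ∀ {f g : Module.End ℝ L}, Commute f g →
      Commute (f.baseChange ℂ) (g.baseChange ℂ) := fun h =>
    h.map (Module.End.baseChangeHom ℝ ℂ L)
  have hσad : ∀ η : 𝔱, Commute s
      (LieAlgebra.ad ℝ L (η : L)) := fun η => by
    refine LinearMap.ext fun x => ?_
    have hfix : s (η : L) = η := h𝔱.1.1 η.2
    simp [hbr, hfix]
  have hadad : ∀ η ζ : 𝔱, Commute (LieAlgebra.ad ℝ L (η : L))
      (LieAlgebra.ad ℝ L (ζ : L)) := fun η ζ => by
    refine LinearMap.ext fun x => ?_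
    have := leibniz_lie (η : L) (ζ : L) x
    rw [h𝔱.1.2 η η.2 ζ ζ.2, zero_lie, zero_add] at this
    simpa using this
  rcases i with _ | η <;> rcases j with _ | ζ
  · exact Commute.refl _
  · exact key (hσad ζ)
  · exact key (hσad η).symm
  · exact key (hadad η ζ)

theorem iSupIndep_jointC
    (hbr : ∀ x y : L, s ⁅x, y⁆ = ⁅s x, s y⁆)
    (h𝔱 : IsMaxAbelian s 𝔱) :
    iSupIndep fun i : 𝔱 × Circle => jointC B s 𝔱 (i.1 : L) i.2 := by
  simp only [jointC_eq_iInf]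
  exact (iSupIndep_iInf_eigenspace (commute_jointFamily hbr h𝔱)).comp
    (jointCharacter_injective hB)

/-- The joint eigenspaces exhaust `ℂ ⊗ L`: the `ad η` are skew, so their eigenvalues are imaginary
and are given by an element of `𝔱`, and `s` is an isometry, so its eigenvalues have norm one. -/
theorem iSup_jointC [FiniteDimensional ℝ L]
    (hbr : ∀ x y : L, s ⁅x, y⁆ = ⁅s x, s y⁆)
    (hs : B.IsSymm) (hsk : ∀ z x y : L, B ⁅z, x⁆ y = -B x ⁅z, y⁆)
    (hiso : ∀ x y : L, B (s x) (s y) = B x y)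
    (h𝔱 : IsMaxAbelian s 𝔱) :
    ⨆ i : 𝔱 × Circle, jointC B s 𝔱 (i.1 : L) i.2 = ⊤ := by
  have hskew : ∀ η x y : L, B (LieAlgebra.ad ℝ L η x) y =
      -B x (LieAlgebra.ad ℝ L η y) := hsk
  have hss : ∀ i, (jointFamily s 𝔱 i).IsSemisimple
    | none => isSemisimple_baseChange (isSemisimple_of_isometry hB hs hiso)
    | some η => isSemisimple_baseChange (isSemisimple_of_skew hB hs (hskew η))
  rw [eq_top_iff, ← iSup_iInf_eigenspace_eq_top (commute_jointFamily hbr h𝔱) hss]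
  refine iSup_le fun χ => ?_
  by_cases hbot : ⨅ i, (jointFamily s 𝔱 i).eigenspace (χ i) = ⊥
  · rw [hbot]; exact bot_le
  obtain ⟨z, hz, hz0⟩ := Submodule.exists_mem_ne_zero_of_ne_bot hbot
  simp only [Submodule.mem_iInf, Module.End.mem_eigenspace_iff] at hz
  have hnorm : ‖χ none‖ = 1 := norm_eigenvalue_eq_one_of_isometry hB hs hiso hz0 (hz none)
  have hre : ∀ η : 𝔱, (χ (some η)).re = 0 := fun η =>
    re_eigenvalue_eq_zero_of_skew hB hs (hskew η) hz0 (hz (some η))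
  have hadd : ∀ η ζ : 𝔱, χ (some (η + ζ)) = χ (some η) + χ (some ζ) := fun η ζ => by
    refine smul_left_injective ℂ hz0 ?_
    change χ (some (η + ζ)) • z = (χ (some η) + χ (some ζ)) • z
    rw [add_smul, ← hz, ← hz, ← hz]
    simp [jointFamily, adC, LinearMap.baseChange_add]
  have hsmul : ∀ (r : ℝ) (η : 𝔱), χ (some (r • η)) = r * χ (some η) := fun r η => by
    refine smul_left_injective ℂ hz0 ?_
    change χ (some (r • η)) • z = ((r : ℂ) * χ (some η)) • z
    rw [mul_smul, ← hz, ← hz]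
    simp [jointFamily, adC, LinearMap.baseChange_smul]
    rfl
  let ℓ : 𝔱 →ₗ[ℝ] ℝ :=
    { toFun := fun η => (χ (some η)).im
      map_add' := fun η ζ => by simp [hadd]
      map_smul' := fun r η => by simp [hsmul] }
  let Bt : 𝔱 →ₗ[ℝ] Module.Dual ℝ 𝔱 := (B).domRestrict₁₂ 𝔱 𝔱
  have hinj : Function.Injective Bt := (injective_iff_map_eq_zero Bt).2 fun x hx => by
    by_contra h
    have h1 := hB x fun h' => h (Subtype.ext h')
    have h2 : Bt x x = 0 := by rw [hx]; rfl
    exact h1.ne' h2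
  have hsurj : Function.Surjective Bt :=
    (LinearMap.injective_iff_surjective_of_finrank_eq_finrank
      (Subspace.dual_finrank_eq (K := ℝ) (V := 𝔱)).symm).1 hinj
  obtain ⟨α, hα⟩ := hsurj ℓ
  let ε : Circle := ⟨χ none, by simpa [Submonoid.unitSphere] using hnorm⟩
  have hχ : χ = jointCharacter B 𝔱 α ε := by
    funext i
    rcases i with _ | η
    · rfl
    · have h1 : B (α : L) η = (χ (some η)).im := LinearMap.congr_fun hα η
      rw [jointCharacter, h1]
      apply Complex.ext <;> simp [hre]
  rw [hχ, ← jointC_eq_iInf]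
  exact le_iSup (fun i : 𝔱 × Circle => jointC B s 𝔱 (i.1 : L) i.2) (α, ε)

/-- The real parts of the joint eigenvectors span `L`. -/
theorem iSup_jointR [FiniteDimensional ℝ L]
    (hbr : ∀ x y : L, s ⁅x, y⁆ = ⁅s x, s y⁆)
    (hs : B.IsSymm) (hsk : ∀ z x y : L, B ⁅z, x⁆ y = -B x ⁅z, y⁆)
    (hiso : ∀ x y : L, B (s x) (s y) = B x y)
    (h𝔱 : IsMaxAbelian s 𝔱) :
    ⨆ i : 𝔱 × Circle, jointR B s 𝔱 (i.1 : L) i.2 = ⊤ := by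
  refine eq_top_iff.2 fun x _ => ?_
  have key : ∀ z : ℂ ⊗[ℝ] L,
      rePart z ∈ ⨆ i : 𝔱 × Circle, jointR B s 𝔱 (i.1 : L) i.2 := fun z => by
    have hz : z ∈ ⨆ i : 𝔱 × Circle, jointC B s 𝔱 (i.1 : L) i.2 :=
      iSup_jointC hB hbr hs hsk hiso h𝔱 ▸ Submodule.mem_top
    induction hz using Submodule.iSup_induction' with
    | mem i z hz => exact Submodule.mem_iSup_of_mem i (rePart_mem_jointR hz)
    | zero => rw [map_zero]; exact zero_mem _
    | add z z' _ _ h h' => rw [map_add]; exact add_mem h h'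
  simpa using key ((1 : ℂ) ⊗ₜ[ℝ] x)

omit hB in
/-- A fixed vector that commutes with `𝔱` lies in `𝔱`, by maximality. -/
theorem jointR_zero_one (h𝔱 : IsMaxAbelian s 𝔱) : jointR B s 𝔱 0 1 = 𝔱 := by
  refine le_antisymm (fun x hx => ?_) fun x hx => ?_
  · obtain ⟨z, hz, z', hz', e⟩ := mem_jointR.1 hx
    rw [neg_zero, inv_one] at hz'
    have hx1 := mem_jointC.1 (e ▸ add_mem hz hz')
    have hcomm : ∀ η ∈ 𝔱, ⁅η, x⁆ = 0 := fun η hη => by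
      have := hx1.1 η hη
      refine one_tmul_injective ?_
      simpa [adC] using this
    have hfix : s x = x := by
      have := hx1.2
      refine one_tmul_injective ?_
      simpa using this
    have hle : 𝔱 ≤ 𝔱 ⊔ Submodule.span ℝ {x} := le_sup_left
    refine h𝔱.2 ⟨sup_le h𝔱.1.1 ?_, ?_⟩ hle (Submodule.mem_sup_right
      (Submodule.mem_span_singleton_self x))
    · rw [Submodule.span_singleton_le_iff_mem]
      exact hfix
    · intro u hu v hv
      obtain ⟨p, hp, q, hq, rfl⟩ := Submodule.mem_sup.1 hu
      obtain ⟨p', hp', q', hq', rfl⟩ := Submodule.mem_sup.1 hv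
      obtain ⟨r, rfl⟩ := Submodule.mem_span_singleton.1 hq
      obtain ⟨r', rfl⟩ := Submodule.mem_span_singleton.1 hq'
      have h2 : ⁅x, p'⁆ = 0 := by rw [← lie_skew, hcomm p' hp', neg_zero]
      simp [hcomm p hp, h2, h𝔱.1.2 p hp p' hp']
  · refine mem_jointR.2 ⟨(1 : ℂ) ⊗ₜ[ℝ] x, mem_jointC.2 ⟨fun η hη => ?_, ?_⟩, 0,
      zero_mem _, add_zero _⟩
    · simp [adC, h𝔱.1.2 η hη x hx]
    · have : s x = x := h𝔱.1.1 hx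
      simp [this]

end Roots

/-! ### The linear model of the shape operators -/

section Model

variable {L : Type*} [LieRing L] [LieAlgebra ℝ L]

/-- The standing assumptions on the real Lie algebra: `B` is an invariant inner product, `s` is
an isometric automorphism and `𝔱` is maximal abelian in the fixed points of `s`. -/
structure IsTwistedCartan (B : LinearMap.BilinForm ℝ L) (s : L →ₗ[ℝ] L) (𝔱 : Submodule ℝ L) :
    Prop where
  pos : ∀ x, x ≠ 0 → 0 < B x x
  symm : B.IsSymm
  skew : ∀ z x y : L, B ⁅z, x⁆ y = -B x ⁅z, y⁆
  lie : ∀ x y : L, s ⁅x, y⁆ = ⁅s x, s y⁆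
  iso : ∀ x y : L, B (s x) (s y) = B x y
  maxAbelian : IsMaxAbelian s 𝔱

/-- `P` contains exactly one of each pair `±α` of roots. -/
def IsHalfSystem (B : LinearMap.BilinForm ℝ L) (𝔱 : Submodule ℝ L) (P : Set L) : Prop :=
  P ⊆ {α | α ∈ 𝔱 ∧ α ≠ 0 ∧ rootC B 𝔱 α ≠ ⊥} ∧
    ∀ α ∈ {α | α ∈ 𝔱 ∧ α ≠ 0 ∧ rootC B 𝔱 α ≠ ⊥}, Xor (α ∈ P) (-α ∈ P)

/-- The condition `B(α, w) + arg ε ∈ 2πℤ`. -/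
def IsResonant (B : LinearMap.BilinForm ℝ L) (w α : L) (ε : Circle) : Prop :=
  ∃ k : ℤ, B α w + Complex.arg (ε : ℂ) = 2 * Real.pi * k

/-- Labels of the eigenspaces on which `R - s` is invertible. -/
def movingIndex (B : LinearMap.BilinForm ℝ L) (P : Set L) (w : L) : Set (L × Circle) :=
  {i | (i.1 = 0 ∧ 0 ≤ (i.2 : ℂ).im ∧ i.2 ≠ 1) ∨ (i.1 ∈ P ∧ ¬ IsResonant B w i.1 i.2)}

/-- Labels of the eigenspaces outside `𝔱` on which `R - s` vanishes. -/
def stableIndex (B : LinearMap.BilinForm ℝ L) (P : Set L) (w : L) : Set (L × Circle) :=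
  {i | i.1 ∈ P ∧ IsResonant B w i.1 i.2}

/-- One label from each pair `(α, ε)`, `(-α, ε⁻¹)`. -/
def halfIndex (P : Set L) : Set (L × Circle) :=
  {i | (i.1 = 0 ∧ 0 ≤ (i.2 : ℂ).im) ∨ i.1 ∈ P}

/-- The eigenvalue `-(B(α, ξ) / 2) cot ((B(α, w) + arg ε) / 2)`. -/
def cotValue (B : LinearMap.BilinForm ℝ L) (w ξ α : L) (ε : Circle) : ℝ :=
  -(B α ξ / 2) * Real.cot ((B α w + Complex.arg (ε : ℂ)) / 2)

variable {B : LinearMap.BilinForm ℝ L} {s : L →ₗ[ℝ] L} {𝔱 : Submodule ℝ L} {P : Set L} {w : L}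

theorem movingIndex_subset : movingIndex B P w ⊆ halfIndex P := by
  rintro i (h | h)
  · exact Or.inl ⟨h.1, h.2.1⟩
  · exact Or.inr h.1

theorem stableIndex_subset : stableIndex B P w ⊆ halfIndex P := fun _ h => Or.inr h.1

theorem IsHalfSystem.mem_of_mem_halfIndex (hP : IsHalfSystem B 𝔱 P) {i : L × Circle}
    (hi : i ∈ halfIndex P) : i.1 ∈ 𝔱 := by
  rcases hi with h | h
  · rw [h.1]; exact zero_mem _
  · exact (hP.1 h).1

/-- A half index meets each orbit of `(α, ε) ↦ (-α, ε⁻¹)` at most once. -/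
theorem IsHalfSystem.eq_of_neg_inv_mem (hP : IsHalfSystem B 𝔱 P) {i : L × Circle}
    (hi : i ∈ halfIndex P) (hi' : ((-i.1, i.2⁻¹) : L × Circle) ∈ halfIndex P) :
    ((-i.1, i.2⁻¹) : L × Circle) = i := by
  obtain ⟨α, ε⟩ := i
  have h0 : (0 : L) ∉ P := fun h => (hP.1 h).2.1 rfl
  rcases hi with ⟨h, h1⟩ | h <;> rcases hi' with ⟨h', h1'⟩ | h'
  · dsimp only at h h1 h1'
    rw [Circle.coe_inv_eq_conj, Complex.conj_im] at h1'
    have h2 : (ε : ℂ).im = 0 := by linarith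
    refine Prod.ext (by simp [h]) (Circle.ext ?_)
    rw [Circle.coe_inv_eq_conj]
    exact Complex.conj_eq_iff_im.2 h2
  · dsimp only at h h'
    rw [h, neg_zero] at h'
    exact absurd h' h0
  · dsimp only at h h'
    rw [neg_eq_zero.1 h'] at h
    exact absurd h h0
  · rcases hP.2 α (hP.1 h) with h2 | h2
    · exact absurd h' h2.2
    · exact absurd h h2.2

/-- Real subspaces cut out by sums over disjoint sets of independent complex subspaces are
independent. -/
theorem iSupIndep_comap_biSup {V I J : Type*} [AddCommGroup V] [Module ℝ V]
    {W : I → Submodule ℂ (ℂ ⊗[ℝ] V)} (hW : iSupIndep W) {S : J → Set I}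
    (hS : Pairwise fun j j' => Disjoint (S j) (S j')) :
    iSupIndep fun j => ((⨆ k ∈ S j, W k).restrictScalars ℝ).comap (TensorProduct.mk ℝ ℂ V 1) := by
  refine iSupIndep_def.2 fun j => Submodule.disjoint_def.2 fun x hx hx' => ?_
  have h1 : (1 : ℂ) ⊗ₜ[ℝ] x ∈ ⨆ k ∈ S j, W k := hx
  have h2 : (1 : ℂ) ⊗ₜ[ℝ] x ∈ ⨆ k ∈ (S j)ᶜ, W k := by
    have hle : (⨆ (j') (_ : j' ≠ j), ((⨆ k ∈ S j', W k).restrictScalars ℝ).comap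
        (TensorProduct.mk ℝ ℂ V 1)) ≤
        ((⨆ k ∈ (S j)ᶜ, W k).restrictScalars ℝ).comap (TensorProduct.mk ℝ ℂ V 1) := by
      refine iSup₂_le fun j' hj' => Submodule.comap_mono ?_
      have h3 : ⨆ k ∈ S j', W k ≤ ⨆ k ∈ (S j)ᶜ, W k :=
        biSup_mono fun k hk hk' => Set.disjoint_left.1 (hS hj') hk hk'
      exact h3
    exact hle hx'
  have h3 := Submodule.disjoint_def.1 (hW.disjoint_biSup_biSup disjoint_compl_right) _ h1 h2
  exact one_tmul_injective (by simpa using h3)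

/-- Distinct half indices use disjoint sets of complex joint eigenspaces. -/
theorem iSupIndep_jointR (h : IsTwistedCartan B s 𝔱) (hP : IsHalfSystem B 𝔱 P) :
    iSupIndep fun i : halfIndex P => jointR B s 𝔱 i.1.1 i.1.2 := by
  let S : halfIndex P → Set (𝔱 × Circle) := fun i =>
    {k | ((k.1 : L), k.2) = i.1 ∨ (-(k.1 : L), k.2⁻¹) = i.1}
  have hS : Pairwise fun i j => Disjoint (S i) (S j) := fun i j hij => by
    refine Set.disjoint_left.2 fun k hk hk' => hij (Subtype.ext ?_)
    rcases hk with hk | hk <;> rcases hk' with hk' | hk'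
    · rw [← hk, ← hk']
    · rw [← hk, ← hk', hP.eq_of_neg_inv_mem (i := ((k.1 : L), k.2)) (hk ▸ i.2) (hk' ▸ j.2)]
    · rw [← hk, ← hk', hP.eq_of_neg_inv_mem (i := ((k.1 : L), k.2)) (hk' ▸ j.2) (hk ▸ i.2)]
    · rw [← hk, ← hk']
  refine (iSupIndep_comap_biSup (iSupIndep_jointC h.pos h.lie h.maxAbelian) hS).mono fun i => ?_
  refine Submodule.comap_mono ?_
  have hi := hP.mem_of_mem_halfIndex i.2
  have h1 : jointC B s 𝔱 i.1.1 i.1.2 ⊔ jointC B s 𝔱 (-i.1.1) i.1.2⁻¹ ≤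
      ⨆ k ∈ S i, jointC B s 𝔱 (k.1 : L) k.2 := by
    refine sup_le ?_ ?_
    · exact le_iSup₂_of_le (f := fun (k : 𝔱 × Circle) (_ : k ∈ S i) => jointC B s 𝔱 (k.1 : L) k.2)
        (⟨i.1.1, hi⟩, i.1.2) (Or.inl rfl) le_rfl
    · exact le_iSup₂_of_le (f := fun (k : 𝔱 × Circle) (_ : k ∈ S i) => jointC B s 𝔱 (k.1 : L) k.2)
        (⟨-i.1.1, neg_mem hi⟩, i.1.2⁻¹) (Or.inr (by simp)) le_rfl
  exact h1

theorem iSup_jointR_halfIndex [FiniteDimensional ℝ L] (h : IsTwistedCartan B s 𝔱)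
    (hP : IsHalfSystem B 𝔱 P) : ⨆ i ∈ halfIndex P, jointR B s 𝔱 i.1 i.2 = ⊤ := by
  rw [eq_top_iff, ← iSup_jointR h.pos h.lie h.symm h.skew h.iso h.maxAbelian]
  refine iSup_le fun ⟨⟨α, hα⟩, ε⟩ => ?_
  dsimp only
  have key : ∀ i : L × Circle, i ∈ halfIndex P → jointR B s 𝔱 i.1 i.2 = jointR B s 𝔱 α ε →
      jointR B s 𝔱 α ε ≤ ⨆ i ∈ halfIndex P, jointR B s 𝔱 i.1 i.2 := fun i hi e => by
    rw [← e]
    exact le_iSup₂_of_le (f := fun (i : L × Circle) (_ : i ∈ halfIndex P) =>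
      jointR B s 𝔱 i.1 i.2) i hi le_rfl
  by_cases h0 : α = 0
  · subst h0
    rcases le_total 0 (ε : ℂ).im with h1 | h1
    · exact key (0, ε) (Or.inl ⟨rfl, h1⟩) rfl
    · refine key (-0, ε⁻¹) (Or.inl ⟨neg_zero, ?_⟩) (jointR_neg_inv 0 ε)
      rw [Circle.coe_inv_eq_conj, Complex.conj_im]
      linarith
  · by_cases hr : rootC B 𝔱 α = ⊥
    · rw [jointR_eq_bot hr]
      exact bot_le
    · rcases hP.2 α ⟨hα, h0, hr⟩ with h2 | h2
      · exact key (α, ε) (Or.inr h2.1) rfl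
      · exact key (-α, ε⁻¹) (Or.inr h2.1) (jointR_neg_inv α ε)

/-- Real endomorphisms whose complexifications agree on `jointC α ε` agree on `jointR α ε`. -/
theorem eq_on_jointR {f g : Module.End ℝ L} {α : L} {ε : Circle}
    (hfg : ∀ z ∈ jointC B s 𝔱 α ε, f.baseChange ℂ z = g.baseChange ℂ z) {x : L}
    (hx : x ∈ jointR B s 𝔱 α ε) : f x = g x := by
  obtain ⟨z, hz, z', hz', e⟩ := mem_jointR.1 hx
  have h1 := conjC_mem_jointC hz'
  rw [neg_neg, inv_inv] at h1
  have h2 : f.baseChange ℂ z' = g.baseChange ℂ z' := by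
    have := congrArg conjC (hfg _ h1)
    rwa [conjC_baseChange, conjC_baseChange, conjC_conjC] at this
  refine one_tmul_injective ?_
  have h3 : f.baseChange ℂ ((1 : ℂ) ⊗ₜ[ℝ] x) = g.baseChange ℂ ((1 : ℂ) ⊗ₜ[ℝ] x) := by
    rw [← e, map_add, map_add, hfg z hz, h2]
  simpa using h3

/-- A real endomorphism whose complexification preserves `jointC α ε` preserves
`jointR α ε`. -/
theorem apply_mem_jointR {f : Module.End ℝ L} {α : L} {ε : Circle}
    (hf : ∀ z ∈ jointC B s 𝔱 α ε, f.baseChange ℂ z ∈ jointC B s 𝔱 α ε) {x : L}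
    (hx : x ∈ jointR B s 𝔱 α ε) : f x ∈ jointR B s 𝔱 α ε := by
  obtain ⟨z, hz, z', hz', e⟩ := mem_jointR.1 hx
  refine mem_jointR.2 ⟨_, hf z hz, f.baseChange ℂ z', ?_, ?_⟩
  · have h1 := conjC_mem_jointC hz'
    rw [neg_neg, inv_inv] at h1
    have h2 := conjC_mem_jointC (hf _ h1)
    rwa [conjC_baseChange, conjC_conjC] at h2
  · rw [← map_add, e, LinearMap.baseChange_tmul]

-- In the application `R` is `Ad (exp w)⁻¹`.

variable {R : Module.End ℝ L}

/-- The scalar by which `R - s` acts on `jointC α ε`. -/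
def moveScalar (B : LinearMap.BilinForm ℝ L) (w α : L) (ε : Circle) : ℂ :=
  Complex.exp (-(Complex.I * (B α w : ℂ))) - ε

theorem exp_arg_mul_I (ε : Circle) : Complex.exp (Complex.arg (ε : ℂ) * Complex.I) = ε := by
  have := Complex.norm_mul_exp_arg_mul_I (ε : ℂ)
  rwa [Circle.norm_coe, Complex.ofReal_one, one_mul] at this

/-- The circle element `ε` equals `exp (-i B(α, w))` exactly in the resonant case. -/
theorem moveScalar_eq_zero_iff {α : L} {ε : Circle} :
    moveScalar B w α ε = 0 ↔ IsResonant B w α ε := by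
  rw [moveScalar, ← exp_arg_mul_I, sub_eq_zero, Complex.exp_eq_exp_iff_exists_int, IsResonant]
  constructor
  · rintro ⟨n, hn⟩
    refine ⟨-n, ?_⟩
    have := congrArg Complex.im hn
    simp at this
    push_cast
    linarith
  · rintro ⟨k, hk⟩
    refine ⟨-k, ?_⟩
    have hk' := congrArg (fun r : ℝ => (r : ℂ)) hk
    push_cast at hk' ⊢
    linear_combination (-Complex.I) * hk'

theorem moveScalar_zero {ε : Circle} : moveScalar B w 0 ε = 0 ↔ ε = 1 := by
  rw [moveScalar, sub_eq_zero, Circle.ext_iff]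
  simp [eq_comm]

variable (hRiso : ∀ x y : L, B (R x) (R y) = B x y)
  (hR : ∀ α ∈ 𝔱, ∀ z ∈ rootC B 𝔱 α,
    R.baseChange ℂ z = Complex.exp (-(Complex.I * (B α w : ℂ))) • z)

include hR in
theorem baseChange_sub_apply {α : L} (hα : α ∈ 𝔱) {ε : Circle} {z : ℂ ⊗[ℝ] L}
    (hz : z ∈ jointC B s 𝔱 α ε) :
    LinearMap.baseChange ℂ (R - s) z = moveScalar B w α ε • z := by
  rw [LinearMap.baseChange_sub, LinearMap.sub_apply, hR α hα z hz.1, (mem_jointC.1 hz).2,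
    moveScalar, sub_smul]

include hR in
theorem sub_apply_eq_zero {α : L} (hα : α ∈ 𝔱) {ε : Circle} (h0 : moveScalar B w α ε = 0) {x : L}
    (hx : x ∈ jointR B s 𝔱 α ε) : (R - s) x = 0 := by
  refine eq_on_jointR (f := R - s) (g := 0) (fun z hz => ?_) hx
  rw [baseChange_sub_apply hR hα hz, h0]
  simp

include hR in
/-- `R - s` is invertible on `jointR α ε` when its scalar there is nonzero. -/
theorem exists_sub_apply_eq {α : L} (hα : α ∈ 𝔱) {ε : Circle} (h0 : moveScalar B w α ε ≠ 0) {x : L}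
    (hx : x ∈ jointR B s 𝔱 α ε) : ∃ y ∈ jointR B s 𝔱 α ε, (R - s) y = x := by
  set τ := moveScalar B w α ε with hτ
  -- on `jointR α ε` the operator `R - s` is a root of `X² - 2 (re τ) X + |τ|²`
  have hmem : ∀ y ∈ jointR B s 𝔱 α ε, (R - s) y ∈ jointR B s 𝔱 α ε := fun y hy =>
    apply_mem_jointR (fun z hz => by
      rw [baseChange_sub_apply hR hα hz]
      exact Submodule.smul_mem _ _ hz) hy
  have hq : (R - s) ((2 * τ.re) • x - (R - s) x) = Complex.normSq τ • x := by
    have := eq_on_jointR (f := (2 * τ.re) • (R - s) - (R - s) * (R - s))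
      (g := Complex.normSq τ • (1 : Module.End ℝ L)) (fun z hz => ?_) hx
    · simpa only [LinearMap.sub_apply, LinearMap.smul_apply, Module.End.mul_apply,
        Module.End.one_apply, map_sub, map_smul] using this
    · have e1 := baseChange_sub_apply hR hα hz
      have e2 : LinearMap.baseChange ℂ ((R - s) * (R - s)) z = (τ * τ) • z := by
        rw [LinearMap.baseChange_mul, Module.End.mul_apply, e1, map_smul, e1, smul_smul]
      have e3 : LinearMap.baseChange ℂ (1 : Module.End ℝ L) z = z := by
        rw [LinearMap.baseChange_one]; rfl
      have e4 : ∀ (r : ℝ) (v : ℂ ⊗[ℝ] L), r • v = (r : ℂ) • v := fun r v =>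
        (Complex.coe_smul r v).symm
      rw [LinearMap.baseChange_sub, LinearMap.baseChange_smul, LinearMap.baseChange_smul]
      simp only [LinearMap.sub_apply, LinearMap.smul_apply]
      rw [e1, e2, e3, e4, e4, smul_smul, ← sub_smul]
      congr 1
      rw [Complex.normSq_eq_conj_mul_self, Complex.ofReal_mul, Complex.re_eq_add_conj]
      push_cast
      ring
  have hn : Complex.normSq τ ≠ 0 := fun h => h0 (Complex.normSq_eq_zero.1 h)
  refine ⟨(Complex.normSq τ)⁻¹ • ((2 * τ.re) • x - (R - s) x), Submodule.smul_mem _ _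
    (sub_mem (Submodule.smul_mem _ _ hx) (hmem x hx)), ?_⟩
  rw [map_smul, hq, smul_smul, inv_mul_cancel₀ hn, one_smul]

/-- The scalar identity behind the principal curvatures: `(i φ / 2)(e^{-iθ} + ε) =
κ (e^{-iθ} - ε)` with `κ = -(φ / 2) cot ((θ + arg ε) / 2)`. -/
theorem cot_identity {θ φ : ℝ} {ε : Circle}
    (h : Complex.exp (-(Complex.I * (θ : ℂ))) - ε ≠ 0) :
    (2⁻¹ : ℂ) * (Complex.I * (φ : ℂ)) * (Complex.exp (-(Complex.I * (θ : ℂ))) + ε) =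
      ((-(φ / 2) * Real.cot ((θ + Complex.arg (ε : ℂ)) / 2) : ℝ) : ℂ) *
        (Complex.exp (-(Complex.I * (θ : ℂ))) - ε) := by
  set ψ : ℝ := (θ + Complex.arg (ε : ℂ)) / 2 with hψ
  set δ : ℝ := (Complex.arg (ε : ℂ) - θ) / 2 with hδ
  have e1 : Complex.exp (-(Complex.I * (θ : ℂ))) =
      Complex.exp (δ * Complex.I) * (Complex.cos ψ - Complex.sin ψ * Complex.I) := by
    have : Complex.cos ψ - Complex.sin ψ * Complex.I = Complex.exp ((-ψ : ℂ) * Complex.I) := by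
      rw [Complex.exp_mul_I, Complex.cos_neg, Complex.sin_neg]; ring
    rw [this, ← Complex.exp_add]
    congr 1
    rw [hψ, hδ]
    push_cast
    ring
  have e2 : (ε : ℂ) =
      Complex.exp (δ * Complex.I) * (Complex.cos ψ + Complex.sin ψ * Complex.I) := by
    rw [← exp_arg_mul_I ε, ← Complex.exp_mul_I, ← Complex.exp_add]
    congr 1
    rw [hψ, hδ]
    push_cast
    ring
  have hsin : Complex.sin ψ ≠ 0 := fun h0 => h (by rw [e1, e2, h0]; ring)
  rw [Real.cot_eq_cos_div_sin]
  push_cast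
  have e3 : Complex.exp (-(Complex.I * (θ : ℂ))) + ε =
      2 * Complex.exp (δ * Complex.I) * Complex.cos ψ := by
    linear_combination e1 + e2
  have e4 : Complex.exp (-(Complex.I * (θ : ℂ))) - ε =
      -(2 * Complex.exp (δ * Complex.I) * Complex.sin ψ * Complex.I) := by
    linear_combination e1 - e2
  rw [e3, e4]
  field_simp

include hR in
/-- On `jointR α ε` the operator `½ ad ξ (R + s)` is `cotValue` times `R - s`. -/
theorem half_lie_add_apply {α : L} (hα : α ∈ 𝔱) {ε : Circle} (h0 : moveScalar B w α ε ≠ 0)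
    {ξ : L} (hξ : ξ ∈ 𝔱) {x : L} (hx : x ∈ jointR B s 𝔱 α ε) :
    (2⁻¹ : ℝ) • ⁅ξ, (R + s) x⁆ = cotValue B w ξ α ε • (R - s) x := by
  have := eq_on_jointR (f := (2⁻¹ : ℝ) • ((LieAlgebra.ad ℝ L ξ : Module.End ℝ L) * (R + s)))
    (g := cotValue B w ξ α ε • (R - s)) (fun z hz => ?_) hx
  · simpa using this
  have e1 : LinearMap.baseChange ℂ (R + s) z =
      (Complex.exp (-(Complex.I * (B α w : ℂ))) + ε) • z := by
    rw [LinearMap.baseChange_add, LinearMap.add_apply, hR α hα z hz.1, (mem_jointC.1 hz).2,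
      add_smul]
  have e2 := (mem_jointC.1 hz).1 ξ hξ
  have e4 : ∀ (r : ℝ) (v : ℂ ⊗[ℝ] L), r • v = (r : ℂ) • v := fun r v =>
    (Complex.coe_smul r v).symm
  rw [LinearMap.baseChange_smul, LinearMap.baseChange_smul, LinearMap.smul_apply,
    LinearMap.smul_apply, LinearMap.baseChange_mul, Module.End.mul_apply, e1, map_smul, ← adC,
    e2, baseChange_sub_apply hR hα hz, e4, e4, smul_smul, smul_smul, smul_smul]
  congr 1
  have := cot_identity (θ := B α w) (φ := B α ξ) (ε := ε) h0
  rw [moveScalar, cotValue, ← this]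
  push_cast
  ring

theorem moveScalar_ne_zero_of_mem (hP : IsHalfSystem B 𝔱 P) {i : L × Circle}
    (hi : i ∈ movingIndex B P w) : i.1 ∈ 𝔱 ∧ moveScalar B w i.1 i.2 ≠ 0 := by
  refine ⟨hP.mem_of_mem_halfIndex (movingIndex_subset hi), ?_⟩
  rcases hi with h | h
  · rw [h.1, Ne, moveScalar_zero]
    exact h.2.2
  · rw [Ne, moveScalar_eq_zero_iff]
    exact h.2

theorem iSup_jointR_split [FiniteDimensional ℝ L] (h : IsTwistedCartan B s 𝔱)
    (hP : IsHalfSystem B 𝔱 P) (w : L) :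
    (𝔱 ⊔ ⨆ i ∈ stableIndex B P w, jointR B s 𝔱 i.1 i.2) ⊔
      ⨆ i ∈ movingIndex B P w, jointR B s 𝔱 i.1 i.2 = ⊤ := by
  rw [eq_top_iff, ← iSup_jointR_halfIndex h hP]
  refine iSup₂_le fun i hi => ?_
  have hmove : i ∈ movingIndex B P w → jointR B s 𝔱 i.1 i.2 ≤
      (𝔱 ⊔ ⨆ i ∈ stableIndex B P w, jointR B s 𝔱 i.1 i.2) ⊔
      ⨆ i ∈ movingIndex B P w, jointR B s 𝔱 i.1 i.2 := fun hm =>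
    le_sup_of_le_right (le_iSup₂_of_le (f := fun (i : L × Circle) (_ : i ∈ movingIndex B P w) =>
      jointR B s 𝔱 i.1 i.2) i hm le_rfl)
  rcases hi with hi | hi
  · by_cases h1 : i.2 = 1
    · rw [hi.1, h1, jointR_zero_one h.maxAbelian]
      exact le_sup_of_le_left le_sup_left
    · exact hmove (Or.inl ⟨hi.1, hi.2, h1⟩)
  · by_cases h1 : IsResonant B w i.1 i.2
    · exact le_sup_of_le_left (le_sup_of_le_right (le_iSup₂_of_le
        (f := fun (i : L × Circle) (_ : i ∈ stableIndex B P w) =>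
          jointR B s 𝔱 i.1 i.2) i ⟨hi, h1⟩ le_rfl))
    · exact hmove (Or.inr ⟨hi, h1⟩)

include hR in
theorem sup_stable_le_ker (h : IsTwistedCartan B s 𝔱) (hP : IsHalfSystem B 𝔱 P) :
    𝔱 ⊔ ⨆ i ∈ stableIndex B P w, jointR B s 𝔱 i.1 i.2 ≤ LinearMap.ker (R - s) := by
  refine sup_le ?_ (iSup₂_le fun i hi x hx => ?_)
  · nth_rewrite 1 [← jointR_zero_one h.maxAbelian]
    exact fun x hx => sub_apply_eq_zero hR (zero_mem _) (moveScalar_zero.2 rfl) hx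
  · exact sub_apply_eq_zero hR (hP.1 hi.1).1 (moveScalar_eq_zero_iff.2 hi.2) hx

include hR in
/-- `R - s` vanishes on `𝔱` and on the stable summands and maps each moving summand onto itself. -/
theorem range_sub_eq [FiniteDimensional ℝ L] (h : IsTwistedCartan B s 𝔱)
    (hP : IsHalfSystem B 𝔱 P) :
    LinearMap.range (R - s) = ⨆ i ∈ movingIndex B P w, jointR B s 𝔱 i.1 i.2 := by
  refine le_antisymm ?_ (iSup₂_le fun i hi x hx => ?_)
  · rw [LinearMap.range_eq_map, ← iSup_jointR_split h hP w, Submodule.map_sup,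
      (LinearMap.le_ker_iff_map).1 (sup_stable_le_ker hR h hP), bot_sup_eq]
    simp only [Submodule.map_iSup]
    refine iSup₂_mono fun i hi => Submodule.map_le_iff_le_comap.2 fun x hx => ?_
    have hi' := moveScalar_ne_zero_of_mem hP hi
    exact apply_mem_jointR (fun z hz => by
      rw [baseChange_sub_apply hR hi'.1 hz]
      exact Submodule.smul_mem _ _ hz) hx
  · have hi' := moveScalar_ne_zero_of_mem hP hi
    obtain ⟨y, -, hy⟩ := exists_sub_apply_eq hR hi'.1 hi'.2 hx
    exact ⟨y, hy⟩

include hR in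
/-- `R` commutes with every endomorphism that commutes with `s` and the `ad η`, because such an
endomorphism preserves the joint eigenspaces and `R` acts on them by scalars. -/
theorem commute_of_scalar [FiniteDimensional ℝ L] (h : IsTwistedCartan B s 𝔱) {f : Module.End ℝ L}
    (hf : ∀ i, Commute (jointFamily s 𝔱 i) (f.baseChange ℂ)) : Commute R f := by
  refine LinearMap.ext fun x => one_tmul_injective ?_
  have key : ∀ z : ℂ ⊗[ℝ] L, R.baseChange ℂ (f.baseChange ℂ z) =
      f.baseChange ℂ (R.baseChange ℂ z) := fun z => by
    have hz : z ∈ ⨆ i : 𝔱 × Circle, jointC B s 𝔱 (i.1 : L) i.2 :=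
      iSup_jointC h.pos h.lie h.symm h.skew h.iso h.maxAbelian ▸ Submodule.mem_top
    induction hz using Submodule.iSup_induction' with
    | mem i z hz =>
      have h1 : f.baseChange ℂ z ∈ jointC B s 𝔱 (i.1 : L) i.2 := by
        rw [jointC_eq_iInf] at hz ⊢
        simp only [Submodule.mem_iInf, Module.End.mem_eigenspace_iff] at hz ⊢
        intro j
        have := LinearMap.congr_fun (hf j) z
        simp only [Module.End.mul_apply] at this
        rw [this, hz j, map_smul]
      rw [hR i.1 i.1.2 z hz.1, hR i.1 i.1.2 _ h1.1, map_smul]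
    | zero => simp
    | add z z' _ _ h h' => simp only [map_add, h, h']
  simpa using key ((1 : ℂ) ⊗ₜ[ℝ] x)

include hR in
theorem commute_automorphism [FiniteDimensional ℝ L] (h : IsTwistedCartan B s 𝔱) : Commute R s :=
  commute_of_scalar hR h fun i => commute_jointFamily h.lie h.maxAbelian i none

include hR in
theorem commute_ad [FiniteDimensional ℝ L] (h : IsTwistedCartan B s 𝔱) {ξ : L} (hξ : ξ ∈ 𝔱) :
    Commute R (LieAlgebra.ad ℝ L ξ) :=
  commute_of_scalar hR h fun i => commute_jointFamily h.lie h.maxAbelian i (some ⟨ξ, hξ⟩)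

theorem map_lie_of_mem (h : IsTwistedCartan B s 𝔱) {ξ : L} (hξ : ξ ∈ 𝔱) (x : L) :
    s ⁅ξ, x⁆ = ⁅ξ, s x⁆ := by
  have : s ξ = ξ := h.maxAbelian.1.1 hξ
  rw [h.lie, this]

include hR hRiso in
/-- `R - s` is normal, so its kernel is orthogonal to its range. -/
theorem orthogonal_range_ker [FiniteDimensional ℝ L] (h : IsTwistedCartan B s 𝔱) (x : L) {y : L}
    (hy : (R - s) y = 0) : B ((R - s) x) y = 0 := by
  have hinj := injective_of_isometry h.pos hRiso
  obtain ⟨y', rfl⟩ := (LinearMap.injective_iff_surjective.1 hinj) y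
  have hcomm : ∀ u, R (s u) = s (R u) := LinearMap.congr_fun (commute_automorphism hR h)
  have hy' : R y' = s y' := by
    refine hinj ?_
    rw [hcomm]
    rwa [LinearMap.sub_apply, sub_eq_zero] at hy
  rw [LinearMap.sub_apply, map_sub, LinearMap.sub_apply, hRiso]
  rw [hy', h.iso, sub_self]

include hR hRiso in
theorem disjoint_ker_range [FiniteDimensional ℝ L] (h : IsTwistedCartan B s 𝔱) :
    Disjoint (LinearMap.ker (R - s)) (LinearMap.range (R - s)) := by
  refine Submodule.disjoint_def.2 fun y hy hy' => ?_
  obtain ⟨x, rfl⟩ := hy'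
  by_contra h0
  exact (h.pos _ h0).ne' (orthogonal_range_ker hRiso hR h x hy)

include hR hRiso in
/-- The complementary summands lie in the range, which meets the kernel trivially. -/
theorem ker_sub_eq [FiniteDimensional ℝ L] (h : IsTwistedCartan B s 𝔱)
    (hP : IsHalfSystem B 𝔱 P) :
    LinearMap.ker (R - s) = 𝔱 ⊔ ⨆ i ∈ stableIndex B P w, jointR B s 𝔱 i.1 i.2 := by
  refine le_antisymm (fun x hx => ?_) (sup_stable_le_ker hR h hP)
  have hx' : x ∈ (𝔱 ⊔ ⨆ i ∈ stableIndex B P w, jointR B s 𝔱 i.1 i.2) ⊔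
      ⨆ i ∈ movingIndex B P w, jointR B s 𝔱 i.1 i.2 := iSup_jointR_split h hP w ▸ Submodule.mem_top
  obtain ⟨u, hu, v, hv, rfl⟩ := Submodule.mem_sup.1 hx'
  rw [← range_sub_eq hR h hP] at hv
  have hv' : v ∈ LinearMap.ker (R - s) :=
    (Submodule.add_mem_iff_right _ (sup_stable_le_ker hR h hP hu)).1 hx
  rw [Submodule.disjoint_def.1 (disjoint_ker_range hRiso hR h) v hv' hv, add_zero]
  exact hu

include hR hRiso in
/-- The kernel of the normal operator `R - s` is the orthogonal complement of its range. -/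
theorem mem_ker_iff_orthogonal [FiniteDimensional ℝ L] (h : IsTwistedCartan B s 𝔱)
    (y : L) : y ∈ LinearMap.ker (R - s) ↔ ∀ x, B ((R - s) x) y = 0 := by
  refine ⟨fun hy x => orthogonal_range_ker hRiso hR h x hy, fun hy => ?_⟩
  have hc : LinearMap.ker (R - s) ⊔ LinearMap.range (R - s) = ⊤ :=
    Submodule.eq_top_of_disjoint _ _ (by
      rw [add_comm, LinearMap.finrank_range_add_finrank_ker]) (disjoint_ker_range hRiso hR h)
  have hy' : y ∈ LinearMap.ker (R - s) ⊔ LinearMap.range (R - s) := hc ▸ Submodule.mem_top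
  obtain ⟨u, hu, v, ⟨x, rfl⟩, rfl⟩ := Submodule.mem_sup.1 hy'
  have h1 := hy x
  rw [map_add, orthogonal_range_ker hRiso hR h x hu, zero_add] at h1
  have h2 : (R - s) x = 0 := by
    by_contra h0
    exact (h.pos _ h0).ne' h1
  rw [h2, add_zero]
  exact hu

/-- The linear model of the shape operators: a linear family of endomorphisms of the range of
`R - s` that maps `(R - s) x` to `½ [ξ, (R + s) x]`, with its eigenspaces. -/
theorem exists_modelShape [FiniteDimensional ℝ L] (h : IsTwistedCartan B s 𝔱)
    (hP : IsHalfSystem B 𝔱 P)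
    (hRiso : ∀ x y : L, B (R x) (R y) = B x y)
    (hR : ∀ α ∈ 𝔱, ∀ z ∈ rootC B 𝔱 α,
      R.baseChange ℂ z = Complex.exp (-(Complex.I * (B α w : ℂ))) • z) :
    ∃ A : 𝔱 →ₗ[ℝ] Module.End ℝ (LinearMap.range (R - s)),
      (∀ (ξ : 𝔱) (x : L) (u v : LinearMap.range (R - s)), (u : L) = (R - s) x →
        B (A ξ u : L) v = B ((2⁻¹ : ℝ) • ⁅(ξ : L), (R + s) x⁆) v) ∧
      (∀ i ∈ movingIndex B P w, ∀ u : LinearMap.range (R - s),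
        (u : L) ∈ jointR B s 𝔱 i.1 i.2 → ∀ ξ : 𝔱, A ξ u = cotValue B w ξ i.1 i.2 • u) ∧
      (∀ (ξ : 𝔱) (μ : ℝ), ((A ξ).eigenspace μ).map (Submodule.subtype _) =
        ⨆ i ∈ movingIndex B P w, ⨆ _ : cotValue B w (ξ : L) i.1 i.2 = μ,
          jointR B s 𝔱 i.1 i.2) ∧
      (∀ μ : 𝔱 → ℝ, (⨅ ξ : 𝔱, (A ξ).eigenspace (μ ξ)).map (Submodule.subtype _) =
        ⨆ i ∈ movingIndex B P w, ⨆ _ : ∀ ξ : 𝔱, cotValue B w (ξ : L) i.1 i.2 = μ ξ,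
          jointR B s 𝔱 i.1 i.2) := by
  have hcs : ∀ u, R (s u) = s (R u) := LinearMap.congr_fun (commute_automorphism hR h)
  have hca : ∀ ξ ∈ 𝔱, ∀ u, R ⁅ξ, u⁆ = ⁅ξ, R u⁆ := fun ξ hξ =>
    LinearMap.congr_fun (commute_ad hR h hξ)
  have hTl : ∀ ξ ∈ 𝔱, ∀ u, ⁅ξ, (R + s) ((R - s) u)⁆ = (R - s) ⁅ξ, (R + s) u⁆ := fun ξ hξ u => by
    simp only [LinearMap.add_apply, LinearMap.sub_apply, map_sub, map_add, lie_add, lie_sub,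
      hca ξ hξ, map_lie_of_mem h hξ, hcs]
    abel
  -- `R - s` restricts to an automorphism of its range
  let T₀ : Module.End ℝ (LinearMap.range (R - s)) :=
    (R - s).restrict fun x _ => LinearMap.mem_range_self (R - s) x
  have hT₀ : Function.Injective T₀ := (injective_iff_map_eq_zero T₀).2 fun u hu => by
    have h1 : (R - s) (u : L) = 0 := congrArg Subtype.val hu
    exact Subtype.ext (Submodule.disjoint_def.1 (disjoint_ker_range hRiso hR h) u h1 u.2)
  let e : LinearMap.range (R - s) ≃ₗ[ℝ] LinearMap.range (R - s) :=
    LinearEquiv.ofInjectiveEndo T₀ hT₀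
  have he : ∀ u, (R - s) (e.symm u : L) = u := fun u =>
    congrArg Subtype.val (e.apply_symm_apply u)
  have hmem : ∀ (ξ : 𝔱) (u : LinearMap.range (R - s)),
      (2⁻¹ : ℝ) • ⁅(ξ : L), (R + s) (u : L)⁆ ∈ LinearMap.range (R - s) := by
    rintro ξ ⟨_, x, rfl⟩
    exact Submodule.smul_mem _ _ ⟨_, (hTl ξ ξ.2 x).symm⟩
  let A : 𝔱 →ₗ[ℝ] Module.End ℝ (LinearMap.range (R - s)) :=
    LinearMap.mk₂ ℝ (fun ξ u => ⟨(2⁻¹ : ℝ) • ⁅(ξ : L), (R + s) (e.symm u : L)⁆, hmem ξ _⟩)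
      (fun ξ η u => Subtype.ext (by
        simp only [Submodule.coe_add, add_lie, smul_add])) (fun r ξ u => Subtype.ext (by
        simp only [Submodule.coe_smul, smul_lie]; rw [smul_comm]))
      (fun ξ u v => Subtype.ext (by
        simp only [map_add, Submodule.coe_add, lie_add, smul_add]))
      (fun r ξ u => Subtype.ext (by
        simp only [map_smul, Submodule.coe_smul, lie_smul]; rw [smul_comm]))
  have hA : ∀ (ξ : 𝔱) (u : LinearMap.range (R - s)),
      (A ξ u : L) = (2⁻¹ : ℝ) • ⁅(ξ : L), (R + s) (e.symm u : L)⁆ := fun ξ u => rfl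
  -- a preimage of `u` under `R - s` inside the summand must be `e.symm u`
  have hAR : ∀ i ∈ movingIndex B P w, ∀ u : LinearMap.range (R - s),
      (u : L) ∈ jointR B s 𝔱 i.1 i.2 → ∀ ξ : 𝔱, A ξ u = cotValue B w ξ i.1 i.2 • u := by
    intro i hi u hu ξ
    obtain ⟨hi1, hi2⟩ := moveScalar_ne_zero_of_mem hP hi
    obtain ⟨y, hy, hyu⟩ := exists_sub_apply_eq hR hi1 hi2 hu
    obtain ⟨y', hy', hyy⟩ := exists_sub_apply_eq hR hi1 hi2 hy
    have heq : (e.symm u : L) = y := by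
      have : e.symm u = ⟨y, y', hyy⟩ := e.symm_apply_eq.2 (Subtype.ext hyu.symm)
      rw [this]
    refine Subtype.ext ?_
    rw [hA, heq, half_lie_add_apply hR hi1 hi2 ξ.2 hy, hyu]
    rfl
  -- the summands as subspaces of the range
  have hle : ∀ i : movingIndex B P w, jointR B s 𝔱 i.1.1 i.1.2 ≤ LinearMap.range (R - s) :=
    fun i => by
      rw [range_sub_eq hR h hP]
      exact le_iSup₂_of_le (f := fun (i : L × Circle) (_ : i ∈ movingIndex B P w) =>
        jointR B s 𝔱 i.1 i.2) i.1 i.2 le_rfl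
  let Q : movingIndex B P w → Submodule ℝ (LinearMap.range (R - s)) := fun i =>
    (jointR B s 𝔱 i.1.1 i.1.2).comap (Submodule.subtype _)
  have hQ : ∀ i, (Q i).map (Submodule.subtype _) = jointR B s 𝔱 i.1.1 i.1.2 := fun i => by
    rw [Submodule.map_comap_eq, Submodule.range_subtype, inf_eq_right]
    exact hle i
  have hQtop : ⨆ i, Q i = ⊤ := by
    refine Submodule.map_injective_of_injective (Submodule.subtype_injective _) ?_
    rw [Submodule.map_iSup, Submodule.map_subtype_top, iSup_congr hQ]
    exact (range_sub_eq hR h hP).trans iSup_subtype' |>.symm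
  refine ⟨A, fun ξ x u v hx => ?_, hAR, fun ξ μ => ?_, fun μ => ?_⟩
  · -- `e.symm u - x` lies in the kernel, and its image under `ad ξ (R + s)` is normal
    have hk : (R - s) ((e.symm u : L) - x) = 0 := by rw [map_sub, he, hx, sub_self]
    have hk' : (R - s) ((2⁻¹ : ℝ) • ⁅(ξ : L), (R + s) ((e.symm u : L) - x)⁆) = 0 := by
      rw [map_smul, ← hTl ξ ξ.2, hk, map_zero, lie_zero, smul_zero]
    obtain ⟨v, x', rfl⟩ := v
    have h1 := orthogonal_range_ker hRiso hR h x' hk'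
    rw [map_sub, lie_sub, smul_sub, map_sub, sub_eq_zero] at h1
    have h2 := fun a b => h.symm.eq a b
    rw [hA]
    exact (h2 _ _).trans (h1.trans (h2 _ _))
  · have h1 := iInf_eigenspace_eq_iSup (f := fun _ : Unit => A ξ) (R := Q)
      (κ := fun i _ => cotValue B w (ξ : L) i.1.1 i.1.2) hQtop
      (fun i u hu _ => hAR i.1 i.2 u hu ξ) fun _ => μ
    rw [iInf_const] at h1
    rw [h1]
    simp only [Submodule.map_iSup, hQ, funext_iff, forall_const]
    rw [iSup_subtype]
  · have h1 := iInf_eigenspace_eq_iSup (f := fun ξ : 𝔱 => A ξ) (R := Q)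
      (κ := fun i ξ => cotValue B w (ξ : L) i.1.1 i.1.2) hQtop
      (fun i u hu ξ => hAR i.1 i.2 u hu ξ) μ
    rw [h1]
    simp only [Submodule.map_iSup, hQ, funext_iff]
    rw [iSup_subtype]

end Model

/-! ### Derivatives as maps between model spaces -/

section VDeriv

variable {E₁ E₂ E₃ : Type*} [NormedAddCommGroup E₁] [NormedSpace ℝ E₁]
  [NormedAddCommGroup E₂] [NormedSpace ℝ E₂] [NormedAddCommGroup E₃] [NormedSpace ℝ E₃]
  {M₁ : Type*} [TopologicalSpace M₁] [ChartedSpace E₁ M₁]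
  {M₂ : Type*} [TopologicalSpace M₂] [ChartedSpace E₂ M₂]
  {M₃ : Type*} [TopologicalSpace M₃] [ChartedSpace E₃ M₃]

/-- `HasMFDerivAt` with the derivative typed as a map between the model spaces, so that base points
can be rewritten freely. -/
def HasVDeriv (f : M₁ → M₂) (x : M₁) (f' : E₁ →L[ℝ] E₂) : Prop :=
  HasMFDerivAt 𝓘(ℝ, E₁) 𝓘(ℝ, E₂) f x f'

/-- `mfderiv` typed as a map between the model spaces. -/
def vderiv (f : M₁ → M₂) (x : M₁) : E₁ →L[ℝ] E₂ := mfderiv 𝓘(ℝ, E₁) 𝓘(ℝ, E₂) f x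

theorem HasVDeriv.vderiv_eq {f : M₁ → M₂} {x : M₁} {f' : E₁ →L[ℝ] E₂} (h : HasVDeriv f x f') :
    vderiv f x = f' := HasMFDerivAt.mfderiv h

theorem HasVDeriv.unique {f : M₁ → M₂} {x : M₁} {f' f'' : E₁ →L[ℝ] E₂} (h : HasVDeriv f x f')
    (h' : HasVDeriv f x f'') : f' = f'' := hasMFDerivAt_unique h h'

theorem HasVDeriv.comp {g : M₂ → M₃} {f : M₁ → M₂} {x : M₁} {y : M₂} {g' : E₂ →L[ℝ] E₃}
    {f' : E₁ →L[ℝ] E₂} (hg : HasVDeriv g y g') (hf : HasVDeriv f x f') (h : f x = y) :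
    HasVDeriv (fun z => g (f z)) x (g'.comp f') := by
  subst h
  exact HasMFDerivAt.comp x hg hf

theorem hasVDeriv_id (x : M₁) : HasVDeriv (fun z : M₁ => z) x (ContinuousLinearMap.id ℝ E₁) :=
  hasMFDerivAt_id x

theorem hasVDeriv_const (c : M₂) (x : M₁) : HasVDeriv (fun _ : M₁ => c) x (0 : E₁ →L[ℝ] E₂) :=
  hasMFDerivAt_const c x

theorem hasVDeriv_of_contMDiff {f : M₁ → M₂} (hf : ContMDiff 𝓘(ℝ, E₁) 𝓘(ℝ, E₂) ∞ f) (x : M₁) :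
    HasVDeriv f x (vderiv f x : E₁ →L[ℝ] E₂) := (hf.mdifferentiableAt (by simp)).hasMFDerivAt

theorem hasVDeriv_iff_hasFDerivAt {f : E₁ → E₂} {x : E₁} {f' : E₁ →L[ℝ] E₂} :
    HasVDeriv f x f' ↔ HasFDerivAt f f' x := hasMFDerivAt_iff_hasFDerivAt

end VDeriv

/-! ### Left trivialised derivatives on a Lie group -/

section LeftDeriv

variable {E : Type*} [NormedAddCommGroup E] [NormedSpace ℝ E]
  {G : Type*} [TopologicalSpace G] [ChartedSpace E G] [Group G] [LieGroup 𝓘(ℝ, E) ∞ G]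
  {E₁ : Type*} [NormedAddCommGroup E₁] [NormedSpace ℝ E₁]
  {M : Type*} [TopologicalSpace M] [ChartedSpace E₁ M]

theorem contMDiff_left (p : G) : ContMDiff 𝓘(ℝ, E) 𝓘(ℝ, E) ∞ (fun x : G => p * x) :=
  contMDiff_mul_left

theorem contMDiff_right (p : G) : ContMDiff 𝓘(ℝ, E) 𝓘(ℝ, E) ∞ (fun x : G => x * p) :=
  contMDiff_mul_right

theorem contMDiff_conj (p : G) : ContMDiff 𝓘(ℝ, E) 𝓘(ℝ, E) ∞ (fun x : G => p * x * p⁻¹) :=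
  (contMDiff_right p⁻¹).comp (contMDiff_left p)

/-- The differential at `1` of the left translation by `p`; it is `dl p`, typed as an
endomorphism of the model space. -/
def dlE (p : G) : E →L[ℝ] E := vderiv (fun x : G => p * x) 1

/-- The differential at `p` of the left translation by `p⁻¹`. -/
def dlInv (p : G) : E →L[ℝ] E := vderiv (fun x : G => p⁻¹ * x) p

/-- The adjoint representation, typed on the model space. -/
def Ad (p : G) : E →L[ℝ] E := vderiv (fun x : G => p * x * p⁻¹) 1

omit [LieGroup 𝓘(ℝ, E) ∞ G] in
theorem dlE_one : dlE (1 : G) = ContinuousLinearMap.id ℝ E := by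
  have h := hasVDeriv_id (E₁ := E) (1 : G)
  refine HasVDeriv.vderiv_eq ?_
  simpa using h

theorem vderiv_left_comp_dlE (p q : G) :
    (vderiv (fun x : G => p * x) q : E →L[ℝ] E).comp (dlE q) = dlE (E := E) (p * q) := by
  have h := (hasVDeriv_of_contMDiff (contMDiff_left (E := E) p) q).comp
    (hasVDeriv_of_contMDiff (contMDiff_left (E := E) q) 1) (mul_one q)
  simp only [← mul_assoc] at h
  exact (HasVDeriv.vderiv_eq h).symm

theorem dlInv_comp_dlE (p : G) : (dlInv p).comp (dlE p) = ContinuousLinearMap.id ℝ E := by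
  rw [dlInv, vderiv_left_comp_dlE, inv_mul_cancel, dlE_one]

theorem dlE_comp_dlInv (p : G) : (dlE p).comp (dlInv p) = ContinuousLinearMap.id ℝ E := by
  have h := (hasVDeriv_of_contMDiff (contMDiff_left (E := E) p) 1).comp
    (hasVDeriv_of_contMDiff (contMDiff_left (E := E) p⁻¹) p) (inv_mul_cancel p)
  refine HasVDeriv.unique h ?_
  simpa using hasVDeriv_id (E₁ := E) p

@[simp] theorem dlInv_dlE (p : G) (x : E) : dlInv p (dlE p x) = x :=
  congrArg (fun L : E →L[ℝ] E => L x) (dlInv_comp_dlE p)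

@[simp] theorem dlE_dlInv (p : G) (x : E) : dlE p (dlInv p x) = x :=
  congrArg (fun L : E →L[ℝ] E => L x) (dlE_comp_dlInv p)

/-- `f` has at `x` the derivative `dl_{f x} ∘ ℓ`; that is, `ℓ` is the pull-back at `x` of the
left-invariant Maurer–Cartan form by `f`. -/
def HasLeftDeriv (f : M → G) (x : M) (ℓ : E₁ →L[ℝ] E) : Prop :=
  HasVDeriv f x ((dlE (f x)).comp ℓ)

theorem HasVDeriv.hasLeftDeriv {f : M → G} {x : M} {f' : E₁ →L[ℝ] E} (h : HasVDeriv f x f') :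
    HasLeftDeriv f x ((dlInv (f x)).comp f') := by
  rw [HasLeftDeriv, ← ContinuousLinearMap.comp_assoc, dlE_comp_dlInv,
    ContinuousLinearMap.id_comp]
  exact h

theorem HasLeftDeriv.unique {f : M → G} {x : M} {ℓ ℓ' : E₁ →L[ℝ] E} (h : HasLeftDeriv f x ℓ)
    (h' : HasLeftDeriv f x ℓ') : ℓ = ℓ' := by
  have := congrArg (fun L => (dlInv (f x)).comp L) (HasVDeriv.unique h h')
  simpa only [← ContinuousLinearMap.comp_assoc, dlInv_comp_dlE,
    ContinuousLinearMap.id_comp] using this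

theorem hasLeftDeriv_id (p : G) : HasLeftDeriv (fun x : G => x) p (dlInv (E := E) p) := by
  rw [HasLeftDeriv, dlE_comp_dlInv]
  exact hasVDeriv_id p

omit [LieGroup 𝓘(ℝ, E) ∞ G] in
theorem hasLeftDeriv_const (p : G) (x : M) :
    HasLeftDeriv (fun _ : M => p) x (0 : E₁ →L[ℝ] E) := by
  rw [HasLeftDeriv, ContinuousLinearMap.comp_zero]
  exact hasVDeriv_const p x

/-- The product rule before trivialisation: the differential of the multiplication is the sum of
its partial differentials. -/
theorem HasVDeriv.mul {f g : M → G} {x : M} {f' g' : E₁ →L[ℝ] E} (hf : HasVDeriv f x f')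
    (hg : HasVDeriv g x g') : HasVDeriv (fun z => f z * g z) x
      ((vderiv (fun y : G => y * g x) (f x) : E →L[ℝ] E).comp f' +
        (vderiv (fun y : G => f x * y) (g x) : E →L[ℝ] E).comp g') := by
  have hm : MDifferentiableAt (𝓘(ℝ, E).prod 𝓘(ℝ, E)) 𝓘(ℝ, E)
      (fun q : G × G => q.1 * q.2) (f x, g x) :=
    (contMDiff_mul 𝓘(ℝ, E) ∞).mdifferentiableAt (by simp)
  have h := HasMFDerivAt.comp x hm.hasMFDerivAt (HasMFDerivAt.prodMk hf hg)
  refine HasMFDerivAt.congr_mfderiv h ?_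
  refine ContinuousLinearMap.ext fun v => ?_
  exact mfderiv_prod_eq_add_apply hm

/-- Right translation by `q` acts as `Ad q⁻¹` in left trivialisations. -/
theorem hasLeftDeriv_right (p q : G) :
    HasLeftDeriv (fun x : G => x * q) p ((Ad q⁻¹).comp (dlInv (E := E) p)) := by
  -- `x q = (p q) (q⁻¹ (p⁻¹ x) q)`
  have h1 : HasVDeriv (fun x : G => q⁻¹ * (p⁻¹ * x) * q⁻¹⁻¹) p ((Ad (E := E) q⁻¹).comp (dlInv p)) :=
    (hasVDeriv_of_contMDiff (contMDiff_conj (E := E) q⁻¹) 1).comp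
      (hasVDeriv_of_contMDiff (contMDiff_left (E := E) p⁻¹) p) (inv_mul_cancel p)
  have h2 := (hasVDeriv_of_contMDiff (contMDiff_left (E := E) (p * q)) 1).comp h1 (by simp)
  have h3 : (fun x : G => p * q * (q⁻¹ * (p⁻¹ * x) * q⁻¹⁻¹)) = fun x => x * q := by
    funext x; simp [mul_assoc]
  rwa [h3] at h2

theorem vderiv_right_comp_dlE (p q : G) :
    (vderiv (fun x : G => x * q) p : E →L[ℝ] E).comp (dlE (E := E) p) =
      (dlE (p * q)).comp (Ad q⁻¹) := by
  rw [HasVDeriv.vderiv_eq (hasLeftDeriv_right p q), ContinuousLinearMap.comp_assoc,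
    ContinuousLinearMap.comp_assoc, dlInv_comp_dlE, ContinuousLinearMap.comp_id]

theorem HasLeftDeriv.mul {f g : M → G} {x : M} {ℓ ℓ' : E₁ →L[ℝ] E} (hf : HasLeftDeriv f x ℓ)
    (hg : HasLeftDeriv g x ℓ') :
    HasLeftDeriv (fun z => f z * g z) x ((Ad (g x)⁻¹).comp ℓ + ℓ') := by
  have h := HasVDeriv.mul hf hg
  rwa [← ContinuousLinearMap.comp_assoc, ← ContinuousLinearMap.comp_assoc,
    vderiv_left_comp_dlE, vderiv_right_comp_dlE, ContinuousLinearMap.comp_assoc,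
    ← ContinuousLinearMap.comp_add] at h

theorem HasLeftDeriv.mul_const {f : M → G} {x : M} {ℓ : E₁ →L[ℝ] E} (hf : HasLeftDeriv f x ℓ)
    (p : G) : HasLeftDeriv (fun z => f z * p) x ((Ad p⁻¹).comp ℓ) := by
  simpa using hf.mul (hasLeftDeriv_const p x)

theorem HasLeftDeriv.const_mul {f : M → G} {x : M} {ℓ : E₁ →L[ℝ] E} (hf : HasLeftDeriv f x ℓ)
    (p : G) : HasLeftDeriv (fun z => p * f z) x ℓ := by
  simpa using (hasLeftDeriv_const p x).mul hf

omit [LieGroup 𝓘(ℝ, E) ∞ G] in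
theorem HasLeftDeriv.of_vderiv_one {f : M → G} {x : M} {f' : E₁ →L[ℝ] E} (h : HasVDeriv f x f')
    (hx : f x = 1) : HasLeftDeriv f x f' := by
  rw [HasLeftDeriv, hx, dlE_one, ContinuousLinearMap.id_comp]
  exact h

omit [LieGroup 𝓘(ℝ, E) ∞ G] in
theorem HasLeftDeriv.vderiv_one {f : M → G} {x : M} {f' : E₁ →L[ℝ] E} (h : HasLeftDeriv f x f')
    (hx : f x = 1) : HasVDeriv f x f' := by
  rwa [HasLeftDeriv, hx, dlE_one, ContinuousLinearMap.id_comp] at h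

omit [LieGroup 𝓘(ℝ, E) ∞ G] in
theorem Ad_one : Ad (1 : G) = ContinuousLinearMap.id ℝ E := by
  refine HasVDeriv.vderiv_eq ?_
  simpa using hasVDeriv_id (E₁ := E) (1 : G)

theorem Ad_mul (p q : G) : Ad (E := E) (p * q) = (Ad p).comp (Ad q) := by
  have h := (hasVDeriv_of_contMDiff (contMDiff_conj (E := E) p) 1).comp
    (hasVDeriv_of_contMDiff (contMDiff_conj (E := E) q) 1) (by simp)
  have h3 : (fun x : G => p * (q * x * q⁻¹) * p⁻¹) = fun x => p * q * x * (p * q)⁻¹ := by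
    funext x; simp [mul_assoc]
  rw [h3] at h
  exact HasVDeriv.vderiv_eq h

theorem Ad_mul_apply (p q : G) (x : E) : Ad (p * q) x = Ad p (Ad q x) := by
  rw [Ad_mul]; rfl

@[simp] theorem Ad_inv_Ad (p : G) (x : E) : Ad p⁻¹ (Ad p x) = x := by
  rw [← Ad_mul_apply, inv_mul_cancel, Ad_one]; rfl

@[simp] theorem Ad_Ad_inv (p : G) (x : E) : Ad p (Ad p⁻¹ x) = x := by
  rw [← Ad_mul_apply, mul_inv_cancel, Ad_one]; rfl

theorem HasLeftDeriv.inv {f : M → G} {x : M} {ℓ : E₁ →L[ℝ] E} (hf : HasLeftDeriv f x ℓ) :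
    HasLeftDeriv (fun z => (f z)⁻¹) x (-(Ad (f x)).comp ℓ) := by
  have hi : ContMDiff 𝓘(ℝ, E) 𝓘(ℝ, E) ∞ (fun y : G => y⁻¹) := contMDiff_inv _ _
  obtain ⟨ℓ', h⟩ : ∃ ℓ', HasLeftDeriv (fun z => (f z)⁻¹) x ℓ' :=
    ⟨_, HasVDeriv.hasLeftDeriv ((hasVDeriv_of_contMDiff hi (f x)).comp hf rfl)⟩
  have h1 := hf.mul h
  simp only [mul_inv_cancel, inv_inv] at h1
  have h2 := h1.unique (hasLeftDeriv_const 1 x)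
  rwa [← eq_neg_of_add_eq_zero_right h2]

/-- A smooth homomorphism composes with left derivatives through its differential at `1`. -/
theorem HasLeftDeriv.map {f : M → G} {x : M} {ℓ : E₁ →L[ℝ] E} (hf : HasLeftDeriv f x ℓ)
    {τ : G →* G} (hτ : ContMDiff 𝓘(ℝ, E) 𝓘(ℝ, E) ∞ τ) :
    HasLeftDeriv (fun z => τ (f z)) x ((vderiv τ 1 : E →L[ℝ] E).comp ℓ) := by
  -- `τ y = τ (f x) τ ((f x)⁻¹ y)`
  have h1 : HasVDeriv (fun z => τ ((f x)⁻¹ * f z)) x ((vderiv τ 1 : E →L[ℝ] E).comp ℓ) :=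
    (hasVDeriv_of_contMDiff hτ 1).comp ((hf.const_mul (f x)⁻¹).vderiv_one (inv_mul_cancel _))
      (inv_mul_cancel _)
  have h2 := (HasLeftDeriv.of_vderiv_one h1 (by simp)).const_mul (τ (f x))
  simpa using h2

/-- A smooth homomorphism intertwines the adjoint representations. -/
theorem vderiv_Ad {τ : G →* G} (hτ : ContMDiff 𝓘(ℝ, E) 𝓘(ℝ, E) ∞ τ) (p : G) (x : E) :
    (vderiv τ 1 : E →L[ℝ] E) (Ad p x) = Ad (τ p) ((vderiv τ 1 : E →L[ℝ] E) x) := by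
  have h1 := (hasVDeriv_of_contMDiff hτ 1).comp
    (hasVDeriv_of_contMDiff (contMDiff_conj (E := E) p) 1) (by simp)
  have h2 := (hasVDeriv_of_contMDiff (contMDiff_conj (E := E) (τ p)) 1).comp
    (hasVDeriv_of_contMDiff hτ 1) (map_one τ)
  have h3 : (fun y : G => τ (p * y * p⁻¹)) = fun y => τ p * τ y * (τ p)⁻¹ := by
    funext y; simp
  rw [h3] at h1
  exact congrArg (fun L : E →L[ℝ] E => L x) (h1.unique h2)

/-- The orbit map `b ↦ b a τ(b)⁻¹` in left trivialisations. -/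
theorem HasLeftDeriv.orbit {f : M → G} {x : M} {ℓ : E₁ →L[ℝ] E} (hf : HasLeftDeriv f x ℓ)
    {τ : G →* G} (hτ : ContMDiff 𝓘(ℝ, E) 𝓘(ℝ, E) ∞ τ) (a : G) :
    HasLeftDeriv (fun z => f z * a * (τ (f z))⁻¹) x
      ((Ad (τ (f x))).comp ((Ad a⁻¹ - vderiv τ 1 : E →L[ℝ] E).comp ℓ)) := by
  have h := (hf.mul_const a).mul (hf.map hτ).inv
  rw [inv_inv, ← sub_eq_add_neg, ← ContinuousLinearMap.comp_sub] at h
  rwa [ContinuousLinearMap.sub_comp]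

end LeftDeriv

/-! ### Smooth fields in left trivialisations -/

section Smooth

open Bundle

variable {E : Type*} [NormedAddCommGroup E] [NormedSpace ℝ E]
  {G : Type*} [TopologicalSpace G] [ChartedSpace E G]
  {E₁ : Type*} [NormedAddCommGroup E₁] [NormedSpace ℝ E₁]
  {M : Type*} [TopologicalSpace M] [ChartedSpace E₁ M]

/-- The tangent vector `v` at `p`, with `v` typed in the model space, which is the fibre of the
tangent bundle. -/
def tvec (p : G) (v : E) : TangentBundle 𝓘(ℝ, E) G := ⟨p, v⟩

/-- A family of tangent vectors at a fixed point is smooth exactly when its coordinates are. -/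
theorem contMDiff_tvec_const_iff [IsManifold 𝓘(ℝ, E) ∞ G] (p : G) {v : M → E} :
    ContMDiff 𝓘(ℝ, E₁) 𝓘(ℝ, E).tangent ∞ (fun q => tvec p (v q)) ↔
      ContMDiff 𝓘(ℝ, E₁) 𝓘(ℝ, E) ∞ v := by
  refine forall_congr' fun q => ?_
  rw [contMDiffAt_totalSpace]
  have h : ∀ u : E, (trivializationAt E (TangentSpace 𝓘(ℝ, E)) p (tvec p u)).2 = u :=
    fun u => tangentCoordChange_self (I := 𝓘(ℝ, E)) (mem_extChartAt_source p)
  change (ContMDiffAt _ _ _ (fun _ => p) q ∧ ContMDiffAt _ _ _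
    (fun x => (trivializationAt E (TangentSpace 𝓘(ℝ, E)) p (tvec p (v x))).2) q) ↔ _
  simp only [h]
  exact ⟨fun h => h.2, fun h => ⟨contMDiffAt_const, h⟩⟩

variable [Group G] [LieGroup 𝓘(ℝ, E) ∞ G]

/-- The differential of the multiplication, applied to two smooth families of tangent vectors. -/
theorem contMDiff_tvec_mul {f g : M → G} {u v : M → E}
    (hu : ContMDiff 𝓘(ℝ, E₁) 𝓘(ℝ, E).tangent ∞ (fun q => tvec (f q) (u q)))
    (hv : ContMDiff 𝓘(ℝ, E₁) 𝓘(ℝ, E).tangent ∞ (fun q => tvec (g q) (v q))) :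
    ContMDiff 𝓘(ℝ, E₁) 𝓘(ℝ, E).tangent ∞ (fun q => tvec (f q * g q)
      ((vderiv (fun y : G => y * g q) (f q) : E →L[ℝ] E) (u q) +
        (vderiv (fun y : G => f q * y) (g q) : E →L[ℝ] E) (v q))) := by
  have hm : ContMDiff (𝓘(ℝ, E).prod 𝓘(ℝ, E)) 𝓘(ℝ, E) ∞ (fun q : G × G => q.1 * q.2) :=
    contMDiff_mul 𝓘(ℝ, E) ∞
  have h3 : ContMDiff (𝓘(ℝ, E).prod 𝓘(ℝ, E)).tangent 𝓘(ℝ, E).tangent ∞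
      (tangentMap (𝓘(ℝ, E).prod 𝓘(ℝ, E)) 𝓘(ℝ, E) (fun q : G × G => q.1 * q.2)) :=
    hm.contMDiff_tangentMap (m := ∞) (by simp)
  have h2 : ContMDiff (𝓘(ℝ, E).tangent.prod 𝓘(ℝ, E).tangent)
      (𝓘(ℝ, E).prod 𝓘(ℝ, E)).tangent ∞
      (equivTangentBundleProd 𝓘(ℝ, E) G 𝓘(ℝ, E) G).symm :=
    contMDiff_equivTangentBundleProd_symm
  refine ((h3.comp h2).comp (hu.prodMk hv)).congr fun q => ?_
  refine congrArg (tvec (f q * g q)) ?_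
  exact (mfderiv_prod_eq_add_apply (v := (u q, v q))
    (hm.mdifferentiableAt (by simp) (x := (f q, g q)))).symm

/-- A field with smooth left trivialisation is smooth. -/
theorem contMDiff_tvec_dlE {g : M → G} {f : M → E} (hg : ContMDiff 𝓘(ℝ, E₁) 𝓘(ℝ, E) ∞ g)
    (hf : ContMDiff 𝓘(ℝ, E₁) 𝓘(ℝ, E) ∞ f) :
    ContMDiff 𝓘(ℝ, E₁) 𝓘(ℝ, E).tangent ∞ (fun q => tvec (g q) (dlE (g q) (f q))) := by
  have h0 : ContMDiff 𝓘(ℝ, E) 𝓘(ℝ, E).tangent ∞ (fun q : G => tvec q (0 : E)) :=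
    contMDiff_zeroSection ℝ _
  -- the vector `dl_p v` is the product of the zero vector at `p` and `v` at `1`
  refine (contMDiff_tvec_mul (h0.comp hg) ((contMDiff_tvec_const_iff (1 : G)).2 hf)).congr
    fun q => ?_
  simp [dlE]

/-- The left trivialisation of a smooth vector field is smooth. -/
theorem contMDiff_dlInv {X : G → E}
    (hX : ContMDiff 𝓘(ℝ, E) 𝓘(ℝ, E).tangent ∞ (fun q => tvec q (X q))) :
    ContMDiff 𝓘(ℝ, E) 𝓘(ℝ, E) ∞ (fun q => dlInv q (X q)) := by
  have h0 : ContMDiff 𝓘(ℝ, E) 𝓘(ℝ, E).tangent ∞ (fun q : G => tvec q (0 : E)) :=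
    contMDiff_zeroSection ℝ _
  have hi : ContMDiff 𝓘(ℝ, E) 𝓘(ℝ, E) ∞ (fun y : G => y⁻¹) := contMDiff_inv _ _
  refine (contMDiff_tvec_const_iff (1 : G)).1
    ((contMDiff_tvec_mul (h0.comp hi) hX).congr fun q => ?_)
  simp [dlInv]

theorem vderiv_right_one (p : G) (y : E) :
    (vderiv (fun x : G => x * p) 1 : E →L[ℝ] E) y = dlE p (Ad p⁻¹ y) := by
  have h := vderiv_right_comp_dlE (E := E) (1 : G) p
  rw [dlE_one, ContinuousLinearMap.comp_id, one_mul] at h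
  rw [h]; rfl

/-- The left trivialisation of the right-invariant field with value `y` at `1` is `p ↦ Ad p⁻¹ y`.
-/
theorem contMDiff_Ad_inv_apply (y : E) :
    ContMDiff 𝓘(ℝ, E) 𝓘(ℝ, E) ∞ (fun p : G => Ad p⁻¹ y) := by
  have h0 : ContMDiff 𝓘(ℝ, E) 𝓘(ℝ, E).tangent ∞ (fun q : G => tvec q (0 : E)) :=
    contMDiff_zeroSection ℝ _
  have h1 := contMDiff_tvec_mul (M := G) ((contMDiff_tvec_const_iff (1 : G)).2
    (contMDiff_const (c := y))) h0
  have h2 : ContMDiff 𝓘(ℝ, E) 𝓘(ℝ, E).tangent ∞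
      (fun q : G => tvec q (dlE q (Ad q⁻¹ y) : E)) := by
    refine h1.congr fun q => ?_
    simp [vderiv_right_one]
  simpa using contMDiff_dlInv h2

theorem contMDiff_Ad_apply (y : E) : ContMDiff 𝓘(ℝ, E) 𝓘(ℝ, E) ∞ (fun p : G => Ad p y) := by
  have hi : ContMDiff 𝓘(ℝ, E) 𝓘(ℝ, E) ∞ (fun y : G => y⁻¹) := contMDiff_inv _ _
  simpa [Function.comp_def] using (contMDiff_Ad_inv_apply (G := G) y).comp hi

end Smooth

/-! ### One-parameter subgroups -/

section OneParameter

variable {E : Type*} [NormedAddCommGroup E] [NormedSpace ℝ E] [CompleteSpace E]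
  {G : Type*} [TopologicalSpace G] [ChartedSpace E G] [Group G] [LieGroup 𝓘(ℝ, E) ∞ G]

/-- `γ` is an integral curve through `1` of the left-invariant field with value `x` at `1`. -/
structure IsOneParam (γ : ℝ → G) (x : E) : Prop where
  zero : γ 0 = 1
  deriv : ∀ t, HasLeftDeriv γ t ((1 : ℝ →L[ℝ] ℝ).smulRight x)

omit [CompleteSpace E] [LieGroup 𝓘(ℝ, E) ∞ G] in
theorem isMIntegralCurve_iff_hasLeftDeriv {γ : ℝ → G} {x : E} :
    IsMIntegralCurve γ (mulInvariantVectorField (I := 𝓘(ℝ, E)) (G := G) x) ↔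
      ∀ t, HasLeftDeriv γ t ((1 : ℝ →L[ℝ] ℝ).smulRight x) := by
  refine forall_congr' fun t => ?_
  have h : (dlE (γ t)).comp ((1 : ℝ →L[ℝ] ℝ).smulRight x) =
      (1 : ℝ →L[ℝ] ℝ).smulRight (dlE (γ t) x) := by
    ext; simp
  rw [HasLeftDeriv, h]
  rfl

variable [T2Space G]

theorem exists_isOneParam (x : E) : ∃ γ : ℝ → G, IsOneParam γ x := by
  obtain ⟨γ, h0, h⟩ := exists_integralCurve (G := G) (x : LieAlg E G)
  exact ⟨γ, h0, isMIntegralCurve_iff_hasLeftDeriv.1 h⟩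

theorem exists_isOneParam_lieExp (x : LieAlg E G) :
    ∃ γ : ℝ → G, IsOneParam (E := E) γ x ∧ γ 1 = lieExp x :=
  ⟨(exists_integralCurve x).choose, ⟨(exists_integralCurve x).choose_spec.1,
    isMIntegralCurve_iff_hasLeftDeriv.1 (exists_integralCurve x).choose_spec.2⟩, rfl⟩

omit [CompleteSpace E] in
/-- Uniqueness of integral curves of left-invariant fields. -/
theorem eq_of_hasLeftDeriv_const {γ γ' : ℝ → G} {x : E}
    (h : ∀ t, HasLeftDeriv γ t ((1 : ℝ →L[ℝ] ℝ).smulRight x))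
    (h' : ∀ t, HasLeftDeriv γ' t ((1 : ℝ →L[ℝ] ℝ).smulRight x)) {t₀ : ℝ}
    (h0 : γ t₀ = γ' t₀) : γ = γ' := by
  refine isMIntegralCurve_Ioo_eq_of_contMDiff_boundaryless ?_
    (isMIntegralCurve_iff_hasLeftDeriv.2 h) (isMIntegralCurve_iff_hasLeftDeriv.2 h') h0
  refine (contMDiff_mulInvariantVectorField (I := 𝓘(ℝ, E)) (G := G) x).of_le ?_
  rw [minSmoothness_of_isRCLikeNormedField]
  norm_num

omit [CompleteSpace E] in
theorem IsOneParam.add {γ : ℝ → G} {x : E} (h : IsOneParam γ x) (s t : ℝ) :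
    γ (s + t) = γ s * γ t := by
  refine congrFun (eq_of_hasLeftDeriv_const (γ := fun t => γ (s + t))
    (γ' := fun t => γ s * γ t) (x := x) (t₀ := 0) ?_ ?_ (by simp [h.zero])) t
  · intro t
    have h1 : HasVDeriv (fun t : ℝ => s + t) t (ContinuousLinearMap.id ℝ ℝ) :=
      hasVDeriv_iff_hasFDerivAt.2 ((hasFDerivAt_id t).const_add s)
    have h2 := HasVDeriv.comp (h.deriv (s + t)) h1 rfl
    rwa [ContinuousLinearMap.comp_id] at h2
  · exact fun t => (h.deriv t).const_mul (γ s)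

omit [CompleteSpace E] in
theorem IsOneParam.neg {γ : ℝ → G} {x : E} (h : IsOneParam γ x) (t : ℝ) :
    γ (-t) = (γ t)⁻¹ := by
  rw [eq_inv_iff_mul_eq_one, ← h.add, neg_add_cancel, h.zero]

omit [CompleteSpace E] [T2Space G] [LieGroup 𝓘(ℝ, E) ∞ G] in
theorem IsOneParam.vderiv_zero {γ : ℝ → G} {x : E} (h : IsOneParam γ x) :
    HasVDeriv γ 0 ((1 : ℝ →L[ℝ] ℝ).smulRight x) := (h.deriv 0).vderiv_one h.zero

omit [CompleteSpace E] in
/-- Elements of a one-parameter group commute, so the group fixes its own generator. -/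
theorem IsOneParam.Ad_eq {γ : ℝ → G} {x : E} (h : IsOneParam γ x) (t : ℝ) :
    Ad (γ t) x = x := by
  have h1 := HasVDeriv.comp (hasVDeriv_of_contMDiff (contMDiff_conj (E := E) (γ t)) 1)
    h.vderiv_zero h.zero
  have h2 : (fun s => γ t * γ s * (γ t)⁻¹) = γ := by
    funext s
    rw [← h.add, add_comm, h.add, mul_inv_cancel_right]
  rw [h2] at h1
  have h3 : Ad (γ t) ((1 : ℝ) • x) = (1 : ℝ) • x :=
    congrArg (fun L : ℝ →L[ℝ] E => L 1) (h1.unique h.vderiv_zero)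
  rwa [one_smul] at h3

end OneParameter

/-! ### Brackets of fields in left trivialisations -/

section Bracket

section

variable {E₁ E₂ : Type*} [NormedAddCommGroup E₁] [NormedSpace ℝ E₁]
  [NormedAddCommGroup E₂] [NormedSpace ℝ E₂] {M : Type*} [TopologicalSpace M] [ChartedSpace E₁ M]

theorem HasVDeriv.add {f g : M → E₂} {x : M} {f' g' : E₁ →L[ℝ] E₂} (hf : HasVDeriv f x f')
    (hg : HasVDeriv g x g') : HasVDeriv (fun z => f z + g z) x (f' + g') :=
  HasMFDerivAt.add hf hg

theorem HasVDeriv.smul {φ : M → ℝ} {f : M → E₂} {x : M} {φ' : E₁ →L[ℝ] ℝ} {f' : E₁ →L[ℝ] E₂}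
    (hφ : HasVDeriv φ x φ') (hf : HasVDeriv f x f') :
    HasVDeriv (fun z => φ z • f z) x (φ x • f' + φ'.smulRight (f x)) := by
  have h1 : HasMFDerivAt 𝓘(ℝ, E₁) 𝓘(ℝ, ℝ × E₂) (fun z => (φ z, f z)) x (φ'.prod f') :=
    ⟨hφ.1.prodMk hf.1, hφ.2.prodMk hf.2⟩
  have h2 : HasVDeriv (fun z : ℝ × E₂ => z.1 • z.2) (φ x, f x)
      (φ x • ContinuousLinearMap.snd ℝ ℝ E₂ + (ContinuousLinearMap.fst ℝ ℝ E₂).smulRight (f x)) :=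
    hasVDeriv_iff_hasFDerivAt.2 ((hasFDerivAt_fst (𝕜 := ℝ) (p := (φ x, f x))).smul
      (hasFDerivAt_snd (𝕜 := ℝ) (p := (φ x, f x))))
  have h3 := HasVDeriv.comp h2 h1 rfl
  convert h3 using 1
  ext v
  simp

end

open VectorField

variable {E : Type*} [NormedAddCommGroup E] [NormedSpace ℝ E] [CompleteSpace E]
  {G : Type*} [TopologicalSpace G] [ChartedSpace E G] [Group G] [LieGroup 𝓘(ℝ, E) ∞ G]

variable (G) in
/-- The bracket of the Lie algebra, with plain arguments in the model space. -/
def brk (x y : E) : E := @Bracket.bracket (LieAlg E G) (LieAlg E G) _ x y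

theorem brk_add_left (x x' y : E) : brk G (x + x') y = brk G x y + brk G x' y :=
  add_lie (L := LieAlg E G) (M := LieAlg E G) x x' y

theorem brk_smul_left (r : ℝ) (x y : E) : brk G (r • x) y = r • brk G x y :=
  smul_lie (L := LieAlg E G) (M := LieAlg E G) r x y

theorem brk_skew (x y : E) : -brk G y x = brk G x y :=
  lie_skew (L := LieAlg E G) x y

/-- The vector field with left trivialisation `f`. -/
def leftField (f : G → E) (p : G) : TangentSpace 𝓘(ℝ, E) p :=
  (dlE (E := E) p : E →L[ℝ] E) (f p)

omit [CompleteSpace E] in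
theorem smoothField_leftField {f : G → E} (hf : ContMDiff 𝓘(ℝ, E) 𝓘(ℝ, E) ∞ f) :
    SmoothField (leftField f) := contMDiff_tvec_dlE contMDiff_id hf

omit [CompleteSpace E] in
theorem mdifferentiableAt_leftField {f : G → E} (hf : ContMDiff 𝓘(ℝ, E) 𝓘(ℝ, E) ∞ f) (p : G) :
    MDifferentiableAt 𝓘(ℝ, E) 𝓘(ℝ, E).tangent
      (fun q => (⟨q, leftField f q⟩ : TangentBundle 𝓘(ℝ, E) G)) p :=
  (smoothField_leftField hf).mdifferentiableAt (by simp)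

/-- The formula for the bracket of the fields with left trivialisations `f` and `h`. -/
def BracketFormula (f h : G → E) (p : G) : Prop :=
  mlieBracket 𝓘(ℝ, E) (leftField f) (leftField h) p =
    (dlE p ((vderiv h p : E →L[ℝ] E) (dlE p (f p)) - (vderiv f p : E →L[ℝ] E) (dlE p (h p)) +
      brk G (f p) (h p)) : E)

theorem BracketFormula.symm {f h : G → E} {p : G} (H : BracketFormula f h p) :
    BracketFormula h f p := by
  rw [BracketFormula, mlieBracket_swap_apply, H, ← brk_skew (f p) (h p)]
  change -(dlE p _ : E) = _
  rw [← map_neg]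
  congr 1
  abel_nf

theorem bracketFormula_const (x y : E) (p : G) :
    BracketFormula (fun _ : G => x) (fun _ => y) p := by
  have h := congrFun (mulInvariantVector_mlieBracket (I := 𝓘(ℝ, E)) (G := G) x y) p
  rw [BracketFormula, (hasVDeriv_const x p).vderiv_eq, (hasVDeriv_const y p).vderiv_eq]
  simp only [zero_apply, sub_zero, zero_add]
  exact h.symm

theorem BracketFormula.smul_left {f h : G → E} {p : G} (H : BracketFormula f h p) {φ : G → ℝ}
    (hφ : ContMDiff 𝓘(ℝ, E) 𝓘(ℝ, ℝ) ∞ φ) (hf : ContMDiff 𝓘(ℝ, E) 𝓘(ℝ, E) ∞ f) :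
    BracketFormula (fun q => φ q • f q) h p := by
  have h1 : leftField (fun q => φ q • f q) = φ • leftField f := by
    funext q
    exact (dlE q).map_smul (φ q) (f q)
  have h2 := (hasVDeriv_of_contMDiff hφ p).smul (hasVDeriv_of_contMDiff hf p)
  rw [BracketFormula, h1, mlieBracket_smul_left (hφ.mdifferentiableAt (by simp))
    (mdifferentiableAt_leftField hf p), H, h2.vderiv_eq, brk_smul_left]
  change -((vderiv φ p : E →L[ℝ] ℝ) (dlE p (h p))) • (dlE p (f p) : E) + φ p • (dlE p _ : E) = _
  rw [← map_smul, ← map_smul, ← map_add]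
  congr 1
  simp only [add_apply, smul_apply, map_smul,
    ContinuousLinearMap.smulRight_apply, smul_add, smul_sub]
  module

theorem BracketFormula.add_left {f f' h : G → E} {p : G} (H : BracketFormula f h p)
    (H' : BracketFormula f' h p) (hf : ContMDiff 𝓘(ℝ, E) 𝓘(ℝ, E) ∞ f)
    (hf' : ContMDiff 𝓘(ℝ, E) 𝓘(ℝ, E) ∞ f') :
    BracketFormula (fun q => f q + f' q) h p := by
  have h1 : leftField (fun q => f q + f' q) = leftField f + leftField f' := by
    funext q
    exact (dlE q).map_add (f q) (f' q)
  have h2 := (hasVDeriv_of_contMDiff hf p).add (hasVDeriv_of_contMDiff hf' p)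
  rw [BracketFormula, h1, mlieBracket_add_left (mdifferentiableAt_leftField hf p)
    (mdifferentiableAt_leftField hf' p), H, H', h2.vderiv_eq, brk_add_left]
  change (dlE p _ : E) + (dlE p _ : E) = _
  rw [← map_add]
  congr 1
  simp only [add_apply, map_add]
  abel

/-- Both sides of the bracket formula are derivations in `f`, and `f` is a combination of constants
with smooth coefficients, so constant `f` suffice. -/
theorem bracketFormula_of_const [FiniteDimensional ℝ E] {h : G → E} {p : G}
    (H : ∀ x, BracketFormula (fun _ => x) h p) {f : G → E}
    (hf : ContMDiff 𝓘(ℝ, E) 𝓘(ℝ, E) ∞ f) : BracketFormula f h p := by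
  classical
  let b := Module.finBasis ℝ E
  have key : ∀ s : Finset (Fin (Module.finrank ℝ E)),
      BracketFormula (fun q => ∑ i ∈ s, b.repr (f q) i • b i) h p ∧
        ContMDiff 𝓘(ℝ, E) 𝓘(ℝ, E) ∞ (fun q => ∑ i ∈ s, b.repr (f q) i • b i) := by
    have hi : ∀ i, ContMDiff 𝓘(ℝ, E) 𝓘(ℝ, ℝ) ∞ (fun q => b.repr (f q) i) := fun i =>
      have hb : ContMDiff 𝓘(ℝ, E) 𝓘(ℝ, ℝ) ∞ (b.coord i) :=
        (LinearMap.toContinuousLinearMap (b.coord i)).contMDiff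
      hb.comp hf
    intro s
    induction s using Finset.induction_on with
    | empty =>
      simp only [Finset.sum_empty]
      exact ⟨H 0, contMDiff_const⟩
    | insert i s his IH =>
      simp only [Finset.sum_insert his]
      have hs : ContMDiff 𝓘(ℝ, E) 𝓘(ℝ, E) ∞ (fun q => b.repr (f q) i • b i) :=
        (hi i).smul contMDiff_const
      exact ⟨((H (b i)).smul_left (hi i) contMDiff_const).add_left IH.1 hs IH.2, hs.add IH.2⟩
  simpa [b.sum_repr] using (key Finset.univ).1

theorem bracketFormula [FiniteDimensional ℝ E] {f h : G → E}
    (hf : ContMDiff 𝓘(ℝ, E) 𝓘(ℝ, E) ∞ f) (hh : ContMDiff 𝓘(ℝ, E) 𝓘(ℝ, E) ∞ h) (p : G) :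
    BracketFormula f h p :=
  bracketFormula_of_const (fun x => (bracketFormula_of_const
    (fun y => bracketFormula_const y x p) hh).symm) hf

theorem brk_neg_left (x y : E) : brk G (-x) y = -brk G x y :=
  neg_lie (L := LieAlg E G) (M := LieAlg E G) x y

theorem brk_neg_right (x y : E) : brk G x (-y) = -brk G x y :=
  lie_neg (L := LieAlg E G) (M := LieAlg E G) x y

omit [CompleteSpace E] in
theorem inverse_vderiv_inv (p : G) :
    ((vderiv (fun q : G => q⁻¹) p : E →L[ℝ] E)).inverse =
      ((dlE p).comp (-Ad p⁻¹)).comp (dlInv p⁻¹) := by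
  have h : (vderiv (fun q : G => q⁻¹) p : E →L[ℝ] E) =
      (dlE p⁻¹).comp ((-Ad p).comp (dlInv p)) := by
    have := HasVDeriv.vderiv_eq (hasLeftDeriv_id (E := E) p).inv
    simpa using this
  rw [h]
  refine ContinuousLinearMap.inverse_eq ?_ ?_ <;> ext v <;> simp

omit [CompleteSpace E] in
/-- The inversion maps left-invariant fields to right-invariant ones. -/
theorem mpullback_inv_leftField (x : E) :
    mpullback 𝓘(ℝ, E) 𝓘(ℝ, E) (fun q : G => q⁻¹) (leftField (fun _ : G => x)) =
      leftField (fun q => -Ad q⁻¹ x) := by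
  funext p
  change ((vderiv (fun q : G => q⁻¹) p : E →L[ℝ] E)).inverse (dlE p⁻¹ x) = _
  rw [inverse_vderiv_inv]
  simp [leftField]

omit [CompleteSpace E] in
theorem vderiv_neg_Ad_inv (x : E) :
    (vderiv (fun q : G => -Ad q⁻¹ x) 1 : E →L[ℝ] E) = vderiv (fun q : G => Ad q x) 1 := by
  have hi : HasVDeriv (fun q : G => q⁻¹) 1 (-ContinuousLinearMap.id ℝ E) := by
    have h := ((hasLeftDeriv_id (E := E) (1 : G)).inv).vderiv_one inv_one
    have h1 : dlInv (1 : G) = ContinuousLinearMap.id ℝ E := by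
      have := dlInv_comp_dlE (E := E) (1 : G)
      rwa [dlE_one, ContinuousLinearMap.comp_id] at this
    simpa [Ad_one, h1] using h
  have h1 := HasVDeriv.comp (hasVDeriv_of_contMDiff (contMDiff_Ad_apply (G := G) x) 1) hi inv_one
  have h2 := HasVDeriv.comp (hasVDeriv_iff_hasFDerivAt.2
    ((-ContinuousLinearMap.id ℝ E).hasFDerivAt (x := Ad (1 : G)⁻¹ x))) h1 rfl
  refine (HasVDeriv.vderiv_eq h2).trans ?_
  ext v
  simp

variable [FiniteDimensional ℝ E] [T2Space G]

omit [FiniteDimensional ℝ E] in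
theorem vderiv_Ad_self (x : E) : (vderiv (fun q : G => Ad q x) 1 : E →L[ℝ] E) x = 0 := by
  obtain ⟨γ, h⟩ := exists_isOneParam (G := G) x
  have h1 := HasVDeriv.comp (hasVDeriv_of_contMDiff (contMDiff_Ad_apply (G := G) x) 1)
    h.vderiv_zero h.zero
  simp only [h.Ad_eq] at h1
  have h2 := congrArg (fun L : ℝ →L[ℝ] E => L 1) (h1.unique (hasVDeriv_const x (0 : ℝ)))
  simpa using h2

omit [CompleteSpace E] [FiniteDimensional ℝ E] [T2Space G] in
theorem vderiv_Ad_add (x y : E) : (vderiv (fun q : G => Ad q (x + y)) 1 : E →L[ℝ] E) =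
    vderiv (fun q : G => Ad q x) 1 + vderiv (fun q : G => Ad q y) 1 := by
  simp only [map_add]
  exact ((hasVDeriv_of_contMDiff (contMDiff_Ad_apply (G := G) x) 1).add
    (hasVDeriv_of_contMDiff (contMDiff_Ad_apply (G := G) y) 1)).vderiv_eq

/-- The derivative of the adjoint representation is the bracket.  The inversion of the group maps
left-invariant fields to right-invariant ones, whose bracket is computed by `bracketFormula`; this
gives the antisymmetric part, and the symmetric part vanishes because one-parameter groups
commute. -/
theorem vderiv_Ad_one_apply (x y : E) :
    (vderiv (fun q : G => Ad q y) 1 : E →L[ℝ] E) x = brk G x y := by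
  have hsm : ∀ z : E, ContMDiff 𝓘(ℝ, E) 𝓘(ℝ, E) ∞ (fun q : G => -Ad q⁻¹ z) := fun z =>
    (contMDiff_Ad_inv_apply z).neg
  have hi : ContMDiff 𝓘(ℝ, E) 𝓘(ℝ, E) ∞ (fun y : G => y⁻¹) := contMDiff_inv _ _
  have h1 : mlieBracket 𝓘(ℝ, E) (leftField fun _ : G => x) (leftField fun _ => y) =
      leftField (fun _ => brk G x y) :=
    (mulInvariantVector_mlieBracket (I := 𝓘(ℝ, E)) (G := G) x y).symm
  have h2 := mpullback_mlieBracket (n := ∞) (x₀ := (1 : G))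
    (mdifferentiableAt_leftField (contMDiff_const (c := x)) (1 : G)⁻¹)
    (mdifferentiableAt_leftField (contMDiff_const (c := y)) (1 : G)⁻¹) hi.contMDiffAt
    (by rw [minSmoothness_of_isRCLikeNormedField]; exact ENat.LEInfty.out)
  rw [h1, mpullback_inv_leftField, mpullback_inv_leftField, mpullback_inv_leftField,
    bracketFormula (hsm x) (hsm y) 1, vderiv_neg_Ad_inv, vderiv_neg_Ad_inv] at h2
  change (dlE (1 : G) (-Ad (1 : G)⁻¹ (brk G x y)) : E) = _ at h2
  simp only [dlE_one, inv_one, Ad_one, ContinuousLinearMap.id_apply, map_neg, brk_neg_left,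
    brk_neg_right, neg_neg] at h2
  -- polarisation of `vderiv_Ad_self` gives the vanishing of the symmetric part
  have h3 := vderiv_Ad_self (G := G) (x + y)
  rw [vderiv_Ad_add] at h3
  simp only [add_apply, map_add, vderiv_Ad_self, zero_add, add_zero] at h3
  have h4 : (2 : ℝ) • (vderiv (fun q : G => Ad q y) 1 : E →L[ℝ] E) x = (2 : ℝ) • brk G x y := by
    linear_combination (norm := module) h2 + h3
  exact smul_right_injective E (two_ne_zero) h4

/-- The differential of an automorphism is a homomorphism of Lie algebras. -/
theorem vderiv_brk {τ : G →* G} (hτ : ContMDiff 𝓘(ℝ, E) 𝓘(ℝ, E) ∞ τ) (x y : E) :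
    (vderiv τ 1 : E →L[ℝ] E) (brk G x y) =
      brk G ((vderiv τ 1 : E →L[ℝ] E) x) ((vderiv τ 1 : E →L[ℝ] E) y) := by
  rw [← vderiv_Ad_one_apply, ← vderiv_Ad_one_apply]
  have h1 := HasVDeriv.comp (hasVDeriv_iff_hasFDerivAt.2
    ((vderiv τ 1 : E →L[ℝ] E).hasFDerivAt (x := Ad (1 : G) y)))
    (hasVDeriv_of_contMDiff (contMDiff_Ad_apply (G := G) y) 1) rfl
  have h2 := HasVDeriv.comp (hasVDeriv_of_contMDiff
    (contMDiff_Ad_apply (G := G) ((vderiv τ 1 : E →L[ℝ] E) y)) 1)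
    (hasVDeriv_of_contMDiff hτ 1) (map_one τ)
  simp only [vderiv_Ad hτ] at h1
  exact congrArg (fun L : E →L[ℝ] E => L x) (h1.unique h2)

/-- The adjoint representation acts by Lie algebra automorphisms: `Ad p` is the differential of
conjugation by `p`. -/
theorem Ad_brk (p : G) (x y : E) : Ad p (brk G x y) = brk G (Ad p x) (Ad p y) := by
  have h : ⇑((MulAut.conj p).toMonoidHom : G →* G) = fun x => p * x * p⁻¹ := rfl
  have h' : ContMDiff 𝓘(ℝ, E) 𝓘(ℝ, E) ∞ ((MulAut.conj p).toMonoidHom : G →* G) := by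
    rw [h]; exact contMDiff_conj p
  have := vderiv_brk h' x y
  rw [h] at this
  exact this

/-- The derivative of the adjoint representation along a curve. -/
theorem HasLeftDeriv.Ad_apply {E₁ : Type*} [NormedAddCommGroup E₁] [NormedSpace ℝ E₁]
    {M : Type*} [TopologicalSpace M] [ChartedSpace E₁ M] {f : M → G} {x : M} {ℓ : E₁ →L[ℝ] E}
    (hf : HasLeftDeriv f x ℓ) (y : E) :
    ∃ D : E₁ →L[ℝ] E, HasVDeriv (fun z => Ad (f z) y) x D ∧
      ∀ v, D v = Ad (f x) (brk G (ℓ v) y) := by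
  have h1 := (hf.const_mul (f x)⁻¹).vderiv_one (inv_mul_cancel _)
  have h2 := HasVDeriv.comp (hasVDeriv_of_contMDiff (contMDiff_Ad_apply (G := G) y) 1) h1
    (inv_mul_cancel _)
  have h3 := HasVDeriv.comp (hasVDeriv_iff_hasFDerivAt.2
    ((Ad (f x) : E →L[ℝ] E).hasFDerivAt (x := Ad ((f x)⁻¹ * f x) y))) h2 rfl
  simp only [← Ad_mul_apply, mul_inv_cancel_left] at h3
  refine ⟨_, h3, fun v => ?_⟩
  simp only [ContinuousLinearMap.comp_apply, vderiv_Ad_one_apply]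

end Bracket

/-! ### The invariant inner product -/

/-- The Killing form is `κ(x, x) = tr (ad x)²`, which is negative when `ad x` is skew and nonzero;
`ad` is injective because a semisimple Lie algebra has trivial center. -/
theorem killingForm_neg_of_skew {L : Type*} [LieRing L] [LieAlgebra ℝ L] [FiniteDimensional ℝ L]
    [LieAlgebra.IsSemisimple ℝ L] {B : LinearMap.BilinForm ℝ L} (hB : ∀ x, x ≠ 0 → 0 < B x x)
    (hs : B.IsSymm) {x : L} (hx : ∀ y z, B ⁅x, y⁆ z = -B y ⁅x, z⁆) (h0 : x ≠ 0) :
    killingForm ℝ L x x < 0 := by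
  rw [killingForm_apply_apply]
  have key : (LieAlgebra.ad ℝ L x : Module.End ℝ L) = 0 → x = 0 := fun h => by
    have h5 : x ∈ LieAlgebra.center ℝ L := (LieModule.mem_maxTrivSubmodule ℝ L L x).2 fun y => by
      rw [← lie_skew, neg_eq_zero]
      exact congrArg (fun f : Module.End ℝ L => f y) h
    rwa [LieAlgebra.center_eq_bot, LieSubmodule.mem_bot] at h5
  exact trace_mul_self_neg_of_skew hB hs hx fun h => h0 (key h)

theorem smul_killingForm_comm {L : Type*} [LieRing L] [LieAlgebra ℝ L] (c : ℝ) (x y : L) :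
    (c • killingForm ℝ L) x y = (c • killingForm ℝ L) y x :=
  congrArg (fun r : ℝ => c * r) (LieModule.traceForm_comm ℝ L L x y)

theorem smul_killingForm_skew {L : Type*} [LieRing L] [LieAlgebra ℝ L] (c : ℝ) (x y z : L) :
    (c • killingForm ℝ L) ⁅x, y⁆ z = -(c • killingForm ℝ L) y ⁅x, z⁆ := by
  change c * killingForm ℝ L ⁅x, y⁆ z = -(c * killingForm ℝ L y ⁅x, z⁆)
  rw [← mul_neg]
  exact congrArg (fun r : ℝ => c * r) (LieModule.traceForm_apply_lie_apply' ℝ L L x y z)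

theorem smul_killingForm_of_lie {L : Type*} [LieRing L] [LieAlgebra ℝ L] (c : ℝ)
    {s s' : L →ₗ[ℝ] L} (hs : ∀ x y, s ⁅x, y⁆ = ⁅s x, s y⁆) (h : ∀ x, s' (s x) = x)
    (h' : ∀ x, s (s' x) = x) (x y : L) :
    (c • killingForm ℝ L) (s x) (s y) = (c • killingForm ℝ L) x y :=
  congrArg (fun r : ℝ => c * r) (LieAlgebra.killingForm_of_equiv_apply
    { s with
      map_lie' := fun {x y} => hs x y
      invFun := s'
      left_inv := h
      right_inv := h' } x y)

theorem isTwistedCartan_killingForm {L : Type*} [LieRing L] [LieAlgebra ℝ L]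
    [FiniteDimensional ℝ L] [LieAlgebra.IsSemisimple ℝ L] {B : LinearMap.BilinForm ℝ L}
    (hB : ∀ x, x ≠ 0 → 0 < B x x) (hB' : B.IsSymm)
    (hskew : ∀ x y z : L, B ⁅x, y⁆ z = -B y ⁅x, z⁆) {c : ℝ} (hc : 0 < c)
    {s s' : L →ₗ[ℝ] L} (hs : ∀ x y, s ⁅x, y⁆ = ⁅s x, s y⁆) (h : ∀ x, s' (s x) = x)
    (h' : ∀ x, s (s' x) = x) {𝔱 : Submodule ℝ L} (h𝔱 : IsMaxAbelian s 𝔱) :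
    IsTwistedCartan ((-c) • killingForm ℝ L) s 𝔱 where
  pos x hx := by
    have h := killingForm_neg_of_skew hB hB' (hskew x) hx
    change 0 < (-c) * killingForm ℝ L x x
    nlinarith
  symm := ⟨smul_killingForm_comm (-c)⟩
  skew := smul_killingForm_skew (-c)
  lie := hs
  iso := smul_killingForm_of_lie _ hs h h'
  maxAbelian := h𝔱

section Invariant

open MeasureTheory

variable {E : Type*} [NormedAddCommGroup E] [NormedSpace ℝ E] [FiniteDimensional ℝ E]
  {G : Type*} [TopologicalSpace G] [ChartedSpace E G] [Group G] [LieGroup 𝓘(ℝ, E) ∞ G]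

variable (G) in
/-- An inner product that is invariant under the adjoint representation: the average of an
arbitrary one over the Haar measure. -/
theorem exists_Ad_invariant_form [CompactSpace G] :
    ∃ β : LinearMap.BilinForm ℝ E, (∀ x, x ≠ 0 → 0 < β x x) ∧ β.IsSymm ∧
      ∀ (p : G) (x y : E), β (Ad p x) (Ad p y) = β x y := by
  let _ : MeasurableSpace G := borel G
  have _ : BorelSpace G := ⟨rfl⟩
  have _ : IsTopologicalGroup G := topologicalGroup_of_lieGroup 𝓘(ℝ, E) ∞
  let Φ := toEuclidean (E := E)
  let F : E → E → G → ℝ := fun x y p => inner ℝ (Φ (Ad p⁻¹ x)) (Φ (Ad p⁻¹ y))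
  have hc : ∀ x y, Continuous (F x y) := fun x y =>
    (Φ.continuous.comp (contMDiff_Ad_inv_apply x).continuous).inner
      (Φ.continuous.comp (contMDiff_Ad_inv_apply y).continuous)
  let μ : Measure G := Measure.haar
  have hi : ∀ x y, Integrable (F x y) μ := fun x y =>
    (hc x y).integrable_of_hasCompactSupport (HasCompactSupport.of_compactSpace _)
  let β : LinearMap.BilinForm ℝ E := LinearMap.mk₂ ℝ (fun x y => ∫ p, F x y p ∂μ)
    (fun x x' y => by
      rw [← integral_add (hi _ _) (hi _ _)]
      simp only [F, map_add, inner_add_left])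
    (fun r x y => by
      rw [smul_eq_mul, ← integral_const_mul]
      simp only [F, map_smul, real_inner_smul_left])
    (fun x y y' => by
      rw [← integral_add (hi _ _) (hi _ _)]
      simp only [F, map_add, inner_add_right])
    (fun r x y => by
      rw [smul_eq_mul, ← integral_const_mul]
      simp only [F, map_smul, real_inner_smul_right])
  refine ⟨β, fun x hx => ?_, ⟨fun x y => ?_⟩, fun q x y => ?_⟩
  · refine (hc x x).integral_pos_of_hasCompactSupport_nonneg_nonzero
      (HasCompactSupport.of_compactSpace _) (fun p => real_inner_self_nonneg) (x := 1) ?_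
    simpa [F, Ad_one] using hx
  · simp only [β, LinearMap.mk₂_apply, F, real_inner_comm]
  · have h := integral_mul_left_eq_self (μ := μ) (F x y) q⁻¹
    simp only [β, LinearMap.mk₂_apply, ← h]
    simp only [F, mul_inv_rev, inv_inv, Ad_mul_apply]

variable [CompleteSpace E] [T2Space G]

/-- Differentiate the invariance of `β` along the one-parameter group of `z`. -/
theorem skew_brk_of_invariant {β : LinearMap.BilinForm ℝ E}
    (hβ : ∀ (p : G) (x y : E), β (Ad p x) (Ad p y) = β x y) (z x y : E) :
    β (brk G z x) y = -β x (brk G z y) := by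
  obtain ⟨γ, hγ⟩ := exists_isOneParam (G := G) z
  obtain ⟨D, hD, hD'⟩ := (hγ.deriv 0).Ad_apply x
  obtain ⟨D', hE, hE'⟩ := (hγ.deriv 0).inv.Ad_apply y
  have e : (fun t => LinearMap.flip β y (Ad (γ t) x)) = fun t => β x (Ad (γ t)⁻¹ y) := by
    funext t
    rw [← hβ (γ t) x (Ad (γ t)⁻¹ y), Ad_Ad_inv, LinearMap.flip_apply]
  have h1 := HasVDeriv.comp (hasVDeriv_iff_hasFDerivAt.2
    ((LinearMap.toContinuousLinearMap (LinearMap.flip β y)).hasFDerivAt (x := Ad (γ 0) x))) hD rfl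
  have h2 := HasVDeriv.comp (hasVDeriv_iff_hasFDerivAt.2
    ((LinearMap.toContinuousLinearMap (β x)).hasFDerivAt (x := Ad (γ 0)⁻¹ y))) hE rfl
  simp only [LinearMap.coe_toContinuousLinearMap'] at h1 h2
  rw [e] at h1
  have h3 := congrArg (fun L : ℝ →L[ℝ] ℝ => L 1) (h1.unique h2)
  simp [hD', hE', hγ.zero, Ad_one, brk_neg_left] at h3
  exact h3

/-- The adjoint representation as a map of the Lie algebra. -/
def AdL (p : G) : LieAlg E G →ₗ[ℝ] LieAlg E G := (Ad p : E →L[ℝ] E).toLinearMap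

omit [FiniteDimensional ℝ E] [LieGroup 𝓘(ℝ, E) ∞ G] [CompleteSpace E] [T2Space G] in
theorem dAut_symm_dAut {σ : G ≃* G} (hσ : ContMDiff 𝓘(ℝ, E) 𝓘(ℝ, E) ∞ σ)
    (hσ' : ContMDiff 𝓘(ℝ, E) 𝓘(ℝ, E) ∞ σ.symm) (x : LieAlg E G) :
    dAut σ.symm (dAut σ x) = x := by
  have h := HasVDeriv.comp (hasVDeriv_of_contMDiff hσ' 1) (hasVDeriv_of_contMDiff hσ 1) (map_one σ)
  simp only [MulEquiv.symm_apply_apply] at h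
  exact congrArg (fun L : E →L[ℝ] E => L x) (h.unique (hasVDeriv_id 1))

theorem innerForm_AdL (c : ℝ) (p : G) (x y : LieAlg E G) :
    innerForm c (AdL p x) (AdL p y) = innerForm c x y :=
  smul_killingForm_of_lie (L := LieAlg E G) (-c) (s := AdL p) (s' := AdL p⁻¹)
    (Ad_brk (E := E) p) (Ad_inv_Ad (E := E) p) (Ad_Ad_inv (E := E) p) x y

variable (G) in
/-- The inner product `-c κ`, with plain arguments in the model space. -/
def innerE (c : ℝ) : LinearMap.BilinForm ℝ E := innerForm (E := E) (G := G) c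

omit [FiniteDimensional ℝ E] [T2Space G] in
theorem innerE_comm (c : ℝ) (x y : E) : innerE G c x y = innerE G c y x :=
  smul_killingForm_comm (L := LieAlg E G) (-c) x y

omit [FiniteDimensional ℝ E] [T2Space G] in
theorem innerE_skew (c : ℝ) (x y z : E) :
    innerE G c (brk G x y) z = -innerE G c y (brk G x z) :=
  smul_killingForm_skew (L := LieAlg E G) (-c) x y z

theorem innerE_Ad (c : ℝ) (p : G) (x y : E) : innerE G c (Ad p x) (Ad p y) = innerE G c x y :=
  innerForm_AdL c p x y

/-- The averaged form makes every `ad x` skew, so `-c κ` is positive definite. -/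
theorem isTwistedCartan [CompactSpace G] [LieAlgebra.IsSemisimple ℝ (LieAlg E G)]
    {σ : G ≃* G} (hσ : ContMDiff 𝓘(ℝ, E) 𝓘(ℝ, E) ∞ σ)
    (hσ' : ContMDiff 𝓘(ℝ, E) 𝓘(ℝ, E) ∞ σ.symm) {c : ℝ} (hc : 0 < c)
    {𝔱 : Submodule ℝ (LieAlg E G)} (h𝔱 : IsMaximalAbelian σ 𝔱) :
    IsTwistedCartan (L := LieAlg E G) (innerForm c) (dAut σ) 𝔱 := by
  have _ : @FiniteDimensional ℝ (LieAlg E G) _ LieRing.toAddCommGroup LieAlgebra.toModule :=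
    inferInstanceAs (FiniteDimensional ℝ E)
  obtain ⟨β, h1, h2, h3⟩ := exists_Ad_invariant_form (E := E) G
  exact isTwistedCartan_killingForm (L := LieAlg E G) (B := β) h1 h2
    (skew_brk_of_invariant (E := E) h3) hc
    (s := dAut σ) (s' := dAut σ.symm) (vderiv_brk (E := E) (τ := σ.toMonoidHom) hσ)
    (dAut_symm_dAut hσ hσ') (dAut_symm_dAut (σ := σ.symm) hσ' hσ) h𝔱

/-! ### The exponential acts on root spaces by rotations -/

/-- On a plane where `ad w` acts as an infinitesimal rotation, `Ad (γ t)` acts as a rotation: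
rotating back by the angle `θ t` gives constant curves. -/
theorem IsOneParam.Ad_rotation {γ : ℝ → G} {w x y : E} (h : IsOneParam γ w) {θ : ℝ}
    (hx : brk G w x = -(θ • y)) (hy : brk G w y = θ • x) (t : ℝ) :
    Ad (γ t) x = Real.cos (θ * t) • x - Real.sin (θ * t) • y ∧
      Ad (γ t) y = Real.sin (θ * t) • x + Real.cos (θ * t) • y := by
  have hd : ∀ z t, HasDerivAt (fun t => Ad (γ t) z) (Ad (γ t) (brk G w z)) t := fun z t => by
    obtain ⟨D, hD, hD'⟩ := (h.deriv t).Ad_apply z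
    have := (hasVDeriv_iff_hasFDerivAt.1 hD).hasDerivAt
    simpa [hD'] using this
  have hcos : ∀ t, HasDerivAt (fun t => Real.cos (θ * t)) (-(θ * Real.sin (θ * t))) t := fun t => by
    have := ((hasDerivAt_id t).const_mul θ).cos
    simpa [mul_comm] using this
  have hsin : ∀ t, HasDerivAt (fun t => Real.sin (θ * t)) (θ * Real.cos (θ * t)) t := fun t => by
    have := ((hasDerivAt_id t).const_mul θ).sin
    simpa [mul_comm] using this
  have c1 : ∀ t, Real.cos (θ * t) • Ad (γ t) x + Real.sin (θ * t) • Ad (γ t) y = x := fun t => by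
    have := is_const_of_deriv_eq_zero
      (f := fun t => Real.cos (θ * t) • Ad (γ t) x + Real.sin (θ * t) • Ad (γ t) y)
      (fun t => (((hcos t).smul (hd x t)).add ((hsin t).smul (hd y t))).differentiableAt)
      (fun t => by
        refine (((hcos t).smul (hd x t)).add ((hsin t).smul (hd y t))).deriv.trans ?_
        simp only [hx, hy, map_neg, map_smul]
        module) t 0
    simpa [h.zero, Ad_one] using this
  have c2 : ∀ t, -(Real.sin (θ * t) • Ad (γ t) x) + Real.cos (θ * t) • Ad (γ t) y = y := fun t => by
    have := is_const_of_deriv_eq_zero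
      (f := fun t => -(Real.sin (θ * t) • Ad (γ t) x) + Real.cos (θ * t) • Ad (γ t) y)
      (fun t => (((hsin t).smul (hd x t)).neg.add ((hcos t).smul (hd y t))).differentiableAt)
      (fun t => by
        refine (((hsin t).smul (hd x t)).neg.add ((hcos t).smul (hd y t))).deriv.trans ?_
        simp only [hx, hy, map_neg, map_smul]
        module) t 0
    simpa [h.zero, Ad_one] using this
  have hsq := Real.cos_sq_add_sin_sq (θ * t)
  constructor
  · calc Ad (γ t) x = (1 : ℝ) • Ad (γ t) x := (one_smul _ _).symm
      _ = Real.cos (θ * t) • (Real.cos (θ * t) • Ad (γ t) x + Real.sin (θ * t) • Ad (γ t) y) -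
          Real.sin (θ * t) • (-(Real.sin (θ * t) • Ad (γ t) x) +
            Real.cos (θ * t) • Ad (γ t) y) := by
        rw [← hsq]; module
      _ = _ := by rw [c1, c2]
  · calc Ad (γ t) y = (1 : ℝ) • Ad (γ t) y := (one_smul _ _).symm
      _ = Real.sin (θ * t) • (Real.cos (θ * t) • Ad (γ t) x + Real.sin (θ * t) • Ad (γ t) y) +
          Real.cos (θ * t) • (-(Real.sin (θ * t) • Ad (γ t) x) +
            Real.cos (θ * t) • Ad (γ t) y) := by
        rw [← hsq]; module
      _ = _ := by rw [c1, c2]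

/-- `Ad (exp w)⁻¹` acts by `exp (-iθ)` on the eigenvectors of `ad w` with eigenvalue `iθ`. -/
theorem AdL_inv_lieExp_baseChange {w : LieAlg E G} {θ : ℝ} {z : ℂ ⊗[ℝ] LieAlg E G}
    (hz : adC w z = (Complex.I * (θ : ℂ)) • z) :
    (AdL (lieExp w)⁻¹).baseChange ℂ z = Complex.exp (-(Complex.I * (θ : ℂ))) • z := by
  obtain ⟨γ, hγ, h1⟩ := exists_isOneParam_lieExp w
  obtain ⟨e1, e2⟩ := rePart_imPart_of_eigenvector hz
  obtain ⟨r1, r2⟩ := IsOneParam.Ad_rotation (E := E) hγ (x := rePart z) (y := imPart z)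
    (θ := θ) (Eq.trans e1 (by simp; rfl)) (Eq.trans e2 (by simp; rfl)) (-1)
  have hγ1 : γ (-1) = (lieExp w)⁻¹ := by rw [hγ.neg, h1]
  have hexp : Complex.exp (-(Complex.I * (θ : ℂ))) =
      (Real.cos θ : ℂ) - Complex.I * (Real.sin θ : ℂ) := by
    rw [← mul_neg, mul_comm, ← Complex.ofReal_neg, Complex.exp_mul_I, Complex.ofReal_neg,
      Complex.cos_neg, Complex.sin_neg, Complex.ofReal_cos, Complex.ofReal_sin]
    ring
  rw [hγ1] at r1 r2
  rw [eq_rePart_add_imPart ((AdL (lieExp w)⁻¹).baseChange ℂ z),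
    eq_rePart_add_imPart (Complex.exp (-(Complex.I * (θ : ℂ))) • z), rePart_baseChange,
    imPart_baseChange, rePart_smul, imPart_smul, hexp]
  congr 2
  · refine Eq.trans r1 ?_
    simp
    rfl
  · refine Eq.trans r2 ?_
    simp [add_comm]
    rfl

end Invariant

/-! ### Charts -/

section Chart

variable {E : Type*} [NormedAddCommGroup E] [NormedSpace ℝ E]
  {M : Type*} [TopologicalSpace M] [ChartedSpace E M]

/-- The chart at `p` has the identity as its derivative at `p`, because the tangent space at `p` is
read in that chart. -/
theorem hasVDeriv_extChartAt (p : M) :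
    HasVDeriv (extChartAt 𝓘(ℝ, E) p) p (ContinuousLinearMap.id ℝ E) := by
  have h : HasFDerivAt (writtenInExtChartAt 𝓘(ℝ, E) 𝓘(ℝ, E) p (extChartAt 𝓘(ℝ, E) p))
      (ContinuousLinearMap.id ℝ E) (extChartAt 𝓘(ℝ, E) p p) := by
    refine (hasFDerivAt_id _).congr_of_eventuallyEq ?_
    filter_upwards [extChartAt_target_mem_nhds (I := 𝓘(ℝ, E)) p] with y hy
    exact (extChartAt 𝓘(ℝ, E) p).right_inv hy
  exact ⟨continuousAt_extChartAt p, h.hasFDerivWithinAt⟩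

theorem hasVDeriv_extChartAt_symm (p : M) :
    HasVDeriv (extChartAt 𝓘(ℝ, E) p).symm (extChartAt 𝓘(ℝ, E) p p)
      (ContinuousLinearMap.id ℝ E) := by
  have h : HasFDerivAt (writtenInExtChartAt 𝓘(ℝ, E) 𝓘(ℝ, E) (extChartAt 𝓘(ℝ, E) p p)
      (extChartAt 𝓘(ℝ, E) p).symm) (ContinuousLinearMap.id ℝ E) (extChartAt 𝓘(ℝ, E) p p) := by
    refine (hasFDerivAt_id _).congr_of_eventuallyEq ?_
    filter_upwards [extChartAt_target_mem_nhds (I := 𝓘(ℝ, E)) p] with y hy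
    rw [writtenInExtChartAt, extChartAt_to_inv]
    exact (extChartAt 𝓘(ℝ, E) p).right_inv hy
  exact ⟨continuousAt_extChartAt_symm p, h.hasFDerivWithinAt⟩

/-- Every tangent vector is the velocity of a smooth curve defined on the whole line. -/
theorem exists_smooth_curve [IsManifold 𝓘(ℝ, E) ∞ M] (p : M) (x : E) :
    ∃ b : ℝ → M, ContMDiff 𝓘(ℝ, ℝ) 𝓘(ℝ, E) ∞ b ∧ b 0 = p ∧
      HasVDeriv b 0 ((1 : ℝ →L[ℝ] ℝ).smulRight x) := by
  set e := extChartAt 𝓘(ℝ, E) p with he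
  obtain ⟨r, hr, hball⟩ := Metric.mem_nhds_iff.1 (extChartAt_target_mem_nhds (I := 𝓘(ℝ, E)) p)
  set δ : ℝ := r / (‖x‖ + 1) with hδ
  have hx : 0 < ‖x‖ + 1 := by positivity
  have hδ0 : 0 < δ := by positivity
  -- a curve in the chart that oscillates on a segment inside the target, so that it is defined for
  -- all times
  let f : ℝ → E := fun t => e p + (δ * Real.sin (t / δ)) • x
  have hf : ContDiff ℝ ∞ f := by fun_prop
  have hf' : HasFDerivAt f ((1 : ℝ →L[ℝ] ℝ).smulRight x) 0 := by
    have h1 : HasDerivAt (fun t : ℝ => δ * Real.sin (t / δ)) 1 0 := by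
      have := (((hasDerivAt_id (0 : ℝ)).div_const δ).sin).const_mul δ
      simpa [hδ0.ne'] using this
    exact ((h1.smul_const x).const_add (e p)).hasFDerivAt.congr_fderiv (by ext; simp)
  have hft : ∀ t, f t ∈ e.target := fun t => by
    refine hball ?_
    rw [mem_ball_iff_norm, add_sub_cancel_left, norm_smul, norm_mul, Real.norm_eq_abs δ,
      abs_of_pos hδ0]
    calc δ * ‖Real.sin (t / δ)‖ * ‖x‖ ≤ δ * 1 * ‖x‖ := by
          gcongr
          exact Real.abs_sin_le_one _
      _ < δ * (‖x‖ + 1) := by nlinarith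
      _ = r := by rw [hδ]; field_simp
  have hf0 : f 0 = e p := by simp [f]
  refine ⟨fun t => e.symm (f t), ?_, ?_, ?_⟩
  · exact (contMDiffOn_extChartAt_symm p).comp_contMDiff hf.contMDiff hft
  · simp [hf0, e]
  · have := HasVDeriv.comp (hasVDeriv_extChartAt_symm (E := E) p)
      (hasVDeriv_iff_hasFDerivAt.2 hf') hf0
    rwa [ContinuousLinearMap.id_comp] at this

end Chart

/-! ### The tangent space of an orbit -/

section Orbit

open Filter Topology

variable {E : Type*} [NormedAddCommGroup E] [NormedSpace ℝ E] [FiniteDimensional ℝ E]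
  [CompleteSpace E]
  {G : Type*} [TopologicalSpace G] [ChartedSpace E G] [Group G] [LieGroup 𝓘(ℝ, E) ∞ G]
  [T2Space G]

omit [FiniteDimensional ℝ E] [CompleteSpace E] in
/-- Kernel vectors of the differential of the orbit map generate one-parameter groups in the
stabiliser, for the orbit map `b ↦ b a τ(b)⁻¹`. -/
theorem orbit_const_of_mem_ker {τ : G →* G} (hτ : ContMDiff 𝓘(ℝ, E) 𝓘(ℝ, E) ∞ τ) {a : G} {x : E}
    (hx : (Ad a⁻¹ - vderiv τ 1 : E →L[ℝ] E) x = 0) {γ : ℝ → G} (hγ : IsOneParam γ x) (t : ℝ) :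
    γ t * a * (τ (γ t))⁻¹ = a := by
  refine congrFun (eq_of_hasLeftDeriv_const (E := E) (x := (0 : E)) (t₀ := 0)
    (γ := fun t => γ t * a * (τ (γ t))⁻¹) (γ' := fun _ => a) (fun t => ?_) (fun t => ?_)
    (by simp [hγ.zero])) t
  · have h := (hγ.deriv t).orbit hτ a
    have h0 : (Ad (τ (γ t))).comp ((Ad a⁻¹ - vderiv τ 1 : E →L[ℝ] E).comp
        ((1 : ℝ →L[ℝ] ℝ).smulRight x)) = (1 : ℝ →L[ℝ] ℝ).smulRight (0 : E) := by
      ext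
      simp only [ContinuousLinearMap.comp_apply, ContinuousLinearMap.smulRight_apply, map_smul, hx]
      simp
    rwa [h0] at h
  · have h := hasLeftDeriv_const (E := E) (E₁ := ℝ) a t
    have h0 : (1 : ℝ →L[ℝ] ℝ).smulRight (0 : E) = 0 := by ext; simp
    rwa [h0]

/-- A curve inside the orbit of `a` under `b ↦ b a τ(b)⁻¹` has its velocity in the image of the
differential of the orbit map. No submanifold structure on the orbit is used: the curve is lifted to
group elements `q t` near `1` that minimise the distance to `1` in a chart, and the limit direction
of `(t, q t)`, taken along an ultrafilter, cannot be vertical, because then moving `q t` along a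
one-parameter group of the stabiliser would bring it closer to `1`. -/
theorem exists_velocity_eq [CompactSpace G] {τ : G →* G}
    (hτ : ContMDiff 𝓘(ℝ, E) 𝓘(ℝ, E) ∞ τ) {a : G} {γ : ℝ → G} {u : E} (h0 : γ 0 = a)
    (hγ : HasLeftDeriv γ 0 ((1 : ℝ →L[ℝ] ℝ).smulRight u))
    (hN : ∀ t, ∃ b, b * a * (τ b)⁻¹ = γ t) :
    ∃ x, (Ad a⁻¹ - vderiv τ 1 : E →L[ℝ] E) x = u := by
  have _ : IsTopologicalGroup G := topologicalGroup_of_lieGroup 𝓘(ℝ, E) ∞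
  have hγc : ContinuousAt γ 0 := HasMFDerivAt.continuousAt hγ
  set φ : G → G := fun b => b * a * (τ b)⁻¹ with hφ
  have hφc : Continuous φ := (continuous_id.mul continuous_const).mul hτ.continuous.inv
  choose d hd using hN
  let 𝒰 : Ultrafilter ℝ := Ultrafilter.of (𝓝[≠] (0 : ℝ))
  have h𝒰 : (𝒰 : Filter ℝ) ≤ 𝓝[≠] (0 : ℝ) := Ultrafilter.of_le _
  have h𝒰0 : Tendsto (fun t : ℝ => t) 𝒰 (𝓝 0) := h𝒰.trans nhdsWithin_le_nhds
  have h𝒰ne : ∀ᶠ t in (𝒰 : Filter ℝ), t ≠ 0 := h𝒰 self_mem_nhdsWithin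
  obtain ⟨d0, -, hd0⟩ := isCompact_univ.ultrafilter_le_nhds (𝒰.map d) (by simp)
  replace hd0 : Tendsto d 𝒰 (𝓝 d0) := hd0
  have hφd0 : φ d0 = a := by
    refine tendsto_nhds_unique ((hφc.tendsto d0).comp hd0) ?_
    have h1 : Tendsto γ 𝒰 (𝓝 (γ 0)) := hγc.tendsto.comp h𝒰0
    rw [h0] at h1
    exact h1.congr fun t => (hd t).symm
  have hφstab : ∀ {k : G}, φ k = a → ∀ q, φ (q * k) = φ q := fun {k} hk q => by
    have : k * a * (τ k)⁻¹ = a := hk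
    calc φ (q * k) = q * (k * a * (τ k)⁻¹) * (τ q)⁻¹ := by simp [φ, mul_assoc]
      _ = φ q := by rw [this]
  have hφstab' : ∀ {k : G}, φ k = a → φ k⁻¹ = a := fun {k} hk => by
    have := hφstab hk k⁻¹
    rw [inv_mul_cancel] at this
    rw [← this]
    simp [φ]
  have hc : Tendsto (fun t => d t * d0⁻¹) 𝒰 (𝓝 1) := by
    simpa using hd0.mul_const d0⁻¹
  have hφc' : ∀ t, φ (d t * d0⁻¹) = γ t := fun t => by rw [hφstab (hφstab' hφd0), ← hd t]
  -- minimisers near `1`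
  set e := extChartAt 𝓘(ℝ, E) (1 : G) with he
  obtain ⟨K, hK1, hKs, hKc⟩ := local_compact_nhds
    (extChartAt_source_mem_nhds (I := 𝓘(ℝ, E)) (1 : G))
  have hecont : ContinuousOn (fun q => ‖e q - e 1‖) K :=
    (((continuousOn_extChartAt (I := 𝓘(ℝ, E)) (1 : G)).mono hKs).sub continuousOn_const).norm
  have hmin : ∀ t, d t * d0⁻¹ ∈ K → ∃ q ∈ K, φ q = γ t ∧
      ∀ q' ∈ K, φ q' = γ t → ‖e q - e 1‖ ≤ ‖e q' - e 1‖ := fun t ht => by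
    have hcl : IsCompact (K ∩ φ ⁻¹' {γ t}) := hKc.inter_right (isClosed_singleton.preimage hφc)
    obtain ⟨q, hq, hq'⟩ := hcl.exists_isMinOn ⟨_, ht, hφc' t⟩ (hecont.mono Set.inter_subset_left)
    exact ⟨q, hq.1, hq.2, fun q' h1 h2 => hq' ⟨h1, h2⟩⟩
  choose! q hqK hqφ hqmin using hmin
  have hev : ∀ᶠ t in (𝒰 : Filter ℝ), d t * d0⁻¹ ∈ K := hc hK1
  have heq : Tendsto (fun t => e (q t)) 𝒰 (𝓝 (e 1)) := by
    rw [tendsto_iff_norm_sub_tendsto_zero]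
    have h1 : Tendsto (fun t => ‖e (d t * d0⁻¹) - e 1‖) 𝒰 (𝓝 0) := by
      have := (continuousAt_extChartAt (I := 𝓘(ℝ, E)) (1 : G)).tendsto.comp hc
      exact tendsto_iff_norm_sub_tendsto_zero.1 this
    refine squeeze_zero' (Eventually.of_forall fun _ => norm_nonneg _) ?_ h1
    filter_upwards [hev] with t ht
    exact hqmin t ht _ ht (hφc' t)
  have heq0 : Tendsto (fun t => e (q t) - e 1) 𝒰 (𝓝 0) := by
    simpa using heq.sub_const (e 1)
  -- normalisation
  let r : ℝ → ℝ := fun t => ‖t‖ + ‖e (q t) - e 1‖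
  have hr0 : Tendsto r 𝒰 (𝓝 0) := by
    have := h𝒰0.norm.add (tendsto_iff_norm_sub_tendsto_zero.1 heq)
    simpa [r] using this
  have hrpos : ∀ᶠ t in (𝒰 : Filter ℝ), 0 < r t := by
    filter_upwards [h𝒰ne] with t ht
    have := norm_pos_iff.2 ht
    positivity
  have hlim : ∃ p : ℝ × E, Tendsto (fun t => ((r t)⁻¹ • t, (r t)⁻¹ • (e (q t) - e 1))) 𝒰 (𝓝 p) := by
    have hmem : ((𝒰.map fun t => ((r t)⁻¹ • t, (r t)⁻¹ • (e (q t) - e 1)) : Ultrafilter (ℝ × E)) :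
        Filter (ℝ × E)) ≤ 𝓟 (Metric.closedBall 0 1) := by
      rw [Ultrafilter.coe_map, le_principal_iff, mem_map]
      filter_upwards [hrpos] with t ht
      rw [Set.mem_preimage, mem_closedBall_zero_iff, Prod.norm_def, sup_le_iff, norm_smul,
        norm_smul, norm_inv, Real.norm_of_nonneg ht.le, inv_mul_le_one₀ ht, inv_mul_le_one₀ ht]
      exact ⟨le_add_of_nonneg_right (norm_nonneg _), le_add_of_nonneg_left (norm_nonneg _)⟩
    obtain ⟨p, -, hp⟩ := (isCompact_closedBall (0 : ℝ × E) 1).ultrafilter_le_nhds _ hmem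
    exact ⟨p, hp⟩
  obtain ⟨⟨s, v⟩, hp⟩ := hlim
  have hs : Tendsto (fun t => (r t)⁻¹ • t) 𝒰 (𝓝 s) := (continuous_fst.tendsto _).comp hp
  have hv : Tendsto (fun t => (r t)⁻¹ • (e (q t) - e 1)) 𝒰 (𝓝 v) :=
    (continuous_snd.tendsto _).comp hp
  have hsv : ‖s‖ + ‖v‖ = 1 := by
    refine tendsto_nhds_unique (hs.norm.add hv.norm) (tendsto_const_nhds.congr' ?_)
    filter_upwards [hrpos] with t ht
    rw [norm_smul, norm_smul, ← mul_add, norm_inv, Real.norm_of_nonneg ht.le]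
    exact (inv_mul_cancel₀ ht.ne').symm
  have hes : ∀ t, d t * d0⁻¹ ∈ K → e.symm (e (q t)) = q t := fun t ht =>
    e.left_inv (hKs (hqK t ht))
  have hes1 : e.symm (e 1) = 1 := extChartAt_to_inv (I := 𝓘(ℝ, E)) (1 : G)
  have hesd : HasVDeriv e.symm (e 1) (ContinuousLinearMap.id ℝ E) := hasVDeriv_extChartAt_symm 1
  have hed : HasVDeriv e 1 (ContinuousLinearMap.id ℝ E) := hasVDeriv_extChartAt 1
  -- the differential of the orbit map relates `s` and `v`
  have hTv : (Ad a⁻¹ - vderiv τ 1 : E →L[ℝ] E) v = s • u := by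
    have h1 : HasFDerivAt (fun t => e (a⁻¹ * γ t)) ((1 : ℝ →L[ℝ] ℝ).smulRight u) 0 := by
      have := HasVDeriv.comp hed ((hγ.const_mul a⁻¹).vderiv_one (by simp [h0])) (by simp [h0])
      rw [ContinuousLinearMap.id_comp] at this
      exact hasVDeriv_iff_hasFDerivAt.1 this
    have h2 : HasFDerivAt (fun y => e (a⁻¹ * φ (e.symm y))) (Ad a⁻¹ - vderiv τ 1 : E →L[ℝ] E)
        (e 1) := by
      have h3 := ((HasLeftDeriv.of_vderiv_one hesd hes1).orbit hτ a).const_mul a⁻¹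
      have := HasVDeriv.comp hed (h3.vderiv_one (by simp [hes1])) (by simp [hes1])
      simp only [hes1, map_one, Ad_one, ContinuousLinearMap.id_comp, ContinuousLinearMap.comp_id]
        at this
      exact hasVDeriv_iff_hasFDerivAt.1 this
    have l1 := (hasFDerivWithinAt_univ.2 h1).lim h𝒰0 (.of_forall fun _ => Set.mem_univ _) hs
    have l2 := (hasFDerivWithinAt_univ.2 h2).lim heq0 (.of_forall fun _ => Set.mem_univ _) hv
    refine (tendsto_nhds_unique (l2.congr' ?_) l1).trans (by simp)
    filter_upwards [hev] with t ht
    simp only [add_sub_cancel, zero_add]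
    rw [hes t ht, hqφ t ht, h0, hes1]
    simp [φ]
  by_cases hs0 : s = 0
  · exfalso
    rw [hs0, zero_smul] at hTv
    rw [hs0, norm_zero, zero_add] at hsv
    obtain ⟨κ, hκ⟩ := exists_isOneParam (G := G) v
    have hstab := orbit_const_of_mem_ker hτ hTv hκ
    have h3 : HasFDerivAt (fun z : E × ℝ => e (e.symm z.1 * κ (-z.2)))
        (ContinuousLinearMap.fst ℝ E ℝ - (ContinuousLinearMap.snd ℝ E ℝ).smulRight v) (e 1, 0) := by
      have f1 : HasVDeriv (fun z : E × ℝ => e.symm z.1) (e 1, 0) (ContinuousLinearMap.fst ℝ E ℝ) :=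
        (HasVDeriv.comp (y := e 1) hesd (hasVDeriv_iff_hasFDerivAt.2
          (hasFDerivAt_fst (𝕜 := ℝ) (p := ((e 1, 0) : E × ℝ)))) rfl)
      have f2 : HasVDeriv (fun z : E × ℝ => κ (-z.2)) (e 1, 0)
          (-(ContinuousLinearMap.snd ℝ E ℝ).smulRight v) := by
        have := HasVDeriv.comp hκ.vderiv_zero (hasVDeriv_iff_hasFDerivAt.2
          ((hasFDerivAt_snd (𝕜 := ℝ) (p := ((e 1, 0) : E × ℝ))).neg)) neg_zero
        exact HasMFDerivAt.congr_mfderiv this (by ext z; simp)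
      have f3 := (HasLeftDeriv.of_vderiv_one f1 hes1).mul
        (HasLeftDeriv.of_vderiv_one f2 (by simp [hκ.zero]))
      have := HasVDeriv.comp hed (f3.vderiv_one (by simp [hes1, hκ.zero])) (by simp [hes1, hκ.zero])
      simp only [neg_zero, hκ.zero, inv_one, Ad_one, ContinuousLinearMap.id_comp,
        ← sub_eq_add_neg] at this
      exact hasVDeriv_iff_hasFDerivAt.1 this
    have hd3 : Tendsto (fun t => (r t)⁻¹ • ((e (q t) - e 1, r t) : E × ℝ)) 𝒰 (𝓝 (v, 1)) := by
      refine (hv.prodMk_nhds (tendsto_const_nhds (x := (1 : ℝ)))).congr' ?_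
      filter_upwards [hrpos] with t ht
      rw [Prod.smul_mk, smul_eq_mul, inv_mul_cancel₀ ht.ne']
    have l3 := (hasFDerivWithinAt_univ.2 h3).lim (heq0.prodMk_nhds hr0)
      (.of_forall fun _ => Set.mem_univ _) hd3
    simp only [Prod.mk_add_mk, add_sub_cancel, zero_add, neg_zero, hκ.zero, mul_one, hes1] at l3
    have l4 : Tendsto (fun t => (r t)⁻¹ • (e (q t * κ (-r t)) - e 1)) 𝒰 (𝓝 0) := by
      have : (ContinuousLinearMap.fst ℝ E ℝ - (ContinuousLinearMap.snd ℝ E ℝ).smulRight v) (v, 1) =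
          (0 : E) := by simp
      rw [this] at l3
      refine l3.congr' ?_
      filter_upwards [hev] with t ht
      rw [hes t ht]
    have hq1 : Tendsto (fun t => q t * κ (-r t)) 𝒰 (𝓝 1) := by
      have g1 : Tendsto q 𝒰 (𝓝 1) := by
        have := (continuousAt_extChartAt_symm (I := 𝓘(ℝ, E)) (1 : G)).tendsto.comp heq
        rw [extChartAt_to_inv] at this
        refine this.congr' ?_
        filter_upwards [hev] with t ht
        exact hes t ht
      have g2 : Tendsto κ (𝓝 0) (𝓝 1) := by
        have := (HasMFDerivAt.continuousAt (hκ.deriv 0)).tendsto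
        rwa [hκ.zero] at this
      have g3 : Tendsto (fun t => -r t) 𝒰 (𝓝 0) := by simpa using hr0.neg
      simpa using g1.mul (g2.comp g3)
    have l5 : ‖v‖ ≤ ‖(0 : E)‖ := by
      refine le_of_tendsto_of_tendsto hv.norm l4.norm ?_
      filter_upwards [hev, hq1 hK1] with t ht ht'
      rw [norm_smul, norm_smul]
      refine mul_le_mul_of_nonneg_left (hqmin t ht _ ht' ?_) (norm_nonneg _)
      rw [hφstab (hstab _), hqφ t ht]
    rw [hsv, norm_zero] at l5
    linarith
  · exact ⟨s⁻¹ • v, by rw [map_smul, hTv, smul_smul, inv_mul_cancel₀ hs0, one_smul]⟩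

end Orbit

section OrbitTangent

variable {E : Type*} [NormedAddCommGroup E] [NormedSpace ℝ E]
  {M : Type*} [TopologicalSpace M] [ChartedSpace E M]

/-- The equality of tangent vectors in the definition of `velocities`, split into the equality of
base points and the value of the derivative. -/
theorem mem_velocities_iff {N : Set M} {p : M} {u : E} :
    (u : TangentSpace 𝓘(ℝ, E) p) ∈ velocities N p ↔
      ∃ γ : ℝ → M, ContMDiff 𝓘(ℝ, ℝ) 𝓘(ℝ, E) ∞ γ ∧ (∀ t, γ t ∈ N) ∧ γ 0 = p ∧
        HasVDeriv γ 0 ((1 : ℝ →L[ℝ] ℝ).smulRight u) := by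
  constructor
  · rintro ⟨γ, hγ, hN, h⟩
    refine ⟨γ, hγ, hN, congrArg Bundle.TotalSpace.proj h, ?_⟩
    have h1 : tvec (γ 0) ((vderiv γ 0 : ℝ →L[ℝ] E) 1) = tvec p u := h
    obtain ⟨h2, h3⟩ := (Bundle.TotalSpace.mk.injEq _ _ _ _).mp h1
    have h4 : (vderiv γ 0 : ℝ →L[ℝ] E) 1 = u := by
      subst h2
      exact eq_of_heq h3
    have h5 := hasVDeriv_of_contMDiff hγ 0
    have h6 : (vderiv γ 0 : ℝ →L[ℝ] E) = (1 : ℝ →L[ℝ] ℝ).smulRight u := by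
      ext
      simp [h4]
    rwa [h6] at h5
  · rintro ⟨γ, hγ, hN, rfl, h⟩
    refine ⟨γ, hγ, hN, ?_⟩
    change tvec (γ 0) ((vderiv γ 0 : ℝ →L[ℝ] E) 1) = tvec (γ 0) u
    rw [h.vderiv_eq]
    simp

variable [FiniteDimensional ℝ E] [CompleteSpace E]
  {G : Type*} [TopologicalSpace G] [ChartedSpace E G] [Group G] [LieGroup 𝓘(ℝ, E) ∞ G]
  [T2Space G]

theorem mem_sigmaOrbit {G : Type*} [Group G] {σ : G ≃* G} {a q : G} :
    q ∈ sigmaOrbit σ a ↔ ∃ b, b * a * (σ b)⁻¹ = q := by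
  constructor
  · rintro ⟨⟨b, b'⟩, h, rfl⟩
    exact ⟨b, by rw [← show σ b = b' from h]⟩
  · rintro ⟨b, rfl⟩
    exact ⟨(b, σ b), rfl, rfl⟩

theorem sigmaOrbit_eq_of_mem {G : Type*} [Group G] {σ : G ≃* G} {a q : G}
    (h : q ∈ sigmaOrbit σ a) : sigmaOrbit σ q = sigmaOrbit σ a := by
  obtain ⟨b, rfl⟩ := mem_sigmaOrbit.1 h
  ext p
  rw [mem_sigmaOrbit, mem_sigmaOrbit]
  constructor
  · rintro ⟨d, rfl⟩
    exact ⟨d * b, by simp [mul_assoc]⟩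
  · rintro ⟨d, rfl⟩
    exact ⟨d * b⁻¹, by simp [mul_assoc]⟩

/-- The map `x ↦ Ad(q⁻¹) x - dσ x`: the infinitesimal action in the left trivialisation. -/
def moveMap (σ : G ≃* G) (q : G) : E →L[ℝ] E := Ad q⁻¹ - vderiv σ 1

omit [FiniteDimensional ℝ E] [CompleteSpace E] [T2Space G] in
/-- The action of `b` intertwines the infinitesimal actions at `a` and at `b · a`; in left
trivialisations its differential is `Ad (σ b)`. -/
theorem moveMap_orbit {σ : G ≃* G} (hσ : ContMDiff 𝓘(ℝ, E) 𝓘(ℝ, E) ∞ σ) (a b : G) (x : E) :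
    moveMap σ (b * a * (σ b)⁻¹) x = Ad (σ b) (moveMap σ a (Ad b⁻¹ x)) := by
  have h := vderiv_Ad (τ := σ.toMonoidHom) hσ b (Ad b⁻¹ x)
  rw [Ad_Ad_inv] at h
  have h' : (vderiv σ 1 : E →L[ℝ] E) x = Ad (σ b) ((vderiv σ 1 : E →L[ℝ] E) (Ad b⁻¹ x)) := h
  simp only [moveMap, sub_apply, h', mul_inv_rev, inv_inv, Ad_mul_apply, map_sub]

variable [CompactSpace G]

/-- The tangent space of the orbit is the image of the differential of the orbit map. -/
theorem velocities_sigmaOrbit {σ : G ≃* G} (hσ : ContMDiff 𝓘(ℝ, E) 𝓘(ℝ, E) ∞ σ) (a : G) :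
    velocities (sigmaOrbit σ a) a =
      Set.range fun x : E => (dlE a (moveMap σ a x) : E) := by
  refine Set.ext fun (u : E) => (mem_velocities_iff (u := u)).trans ?_
  constructor
  · rintro ⟨γ, -, hN, h0, h⟩
    have h1 : HasLeftDeriv γ 0 ((1 : ℝ →L[ℝ] ℝ).smulRight (dlInv a u)) := by
      have h2 : (dlE (γ 0)).comp ((1 : ℝ →L[ℝ] ℝ).smulRight (dlInv a u)) =
          (1 : ℝ →L[ℝ] ℝ).smulRight (u : E) := by
        ext
        simp [h0]
      rw [HasLeftDeriv, h2]
      exact h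
    obtain ⟨x, hx⟩ := exists_velocity_eq (τ := σ.toMonoidHom) hσ h0 h1
      fun t => mem_sigmaOrbit.1 (hN t)
    refine ⟨x, ?_⟩
    change dlE a (moveMap σ a x) = (u : E)
    rw [← dlE_dlInv a (u : E), ← hx]
    rfl
  · rintro ⟨x, rfl⟩
    obtain ⟨b, hb, hb0, hb'⟩ := exists_smooth_curve (1 : G) x
    refine ⟨fun t => b t * a * (σ (b t))⁻¹, ?_, fun t => mem_sigmaOrbit.2 ⟨_, rfl⟩,
      by simp [hb0], ?_⟩
    · exact (hb.mul contMDiff_const).mul (hσ.comp hb).inv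
    · have h := (HasLeftDeriv.of_vderiv_one hb' hb0).orbit (τ := σ.toMonoidHom) hσ a
      refine HasMFDerivAt.congr_mfderiv h ?_
      ext
      simp [hb0, Ad_one, moveMap]

theorem mem_tangentSubspace_sigmaOrbit {σ : G ≃* G} (hσ : ContMDiff 𝓘(ℝ, E) 𝓘(ℝ, E) ∞ σ)
    {a q : G} (hq : q ∈ sigmaOrbit σ a) {u : E} :
    (u : TangentSpace 𝓘(ℝ, E) q) ∈ tangentSubspace (sigmaOrbit σ a) q ↔
      ∃ x, dlE q (moveMap σ q x) = u := by
  have h : velocities (sigmaOrbit σ a) q =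
      (LinearMap.range ((dlE q).comp (moveMap σ q) : E →L[ℝ] E).toLinearMap : Set E) := by
    rw [← sigmaOrbit_eq_of_mem hq, velocities_sigmaOrbit hσ]
    rfl
  rw [tangentSubspace, h]
  have h2 := Submodule.span_eq
    (LinearMap.range ((dlE q).comp (moveMap σ q) : E →L[ℝ] E).toLinearMap)
  exact (SetLike.ext_iff.1 h2 u)

end OrbitTangent

/-! ### The Levi-Civita connection in left trivialisations -/

section LeviCivita

variable {E : Type*} [NormedAddCommGroup E] [NormedSpace ℝ E] [FiniteDimensional ℝ E]

/-- The product rule for a bilinear form. -/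
theorem HasVDeriv.bilin {E₁ : Type*} [NormedAddCommGroup E₁] [NormedSpace ℝ E₁]
    {M : Type*} [TopologicalSpace M] [ChartedSpace E₁ M] (B : LinearMap.BilinForm ℝ E)
    {f g : M → E} {x : M} {f' g' : E₁ →L[ℝ] E} (hf : HasVDeriv f x f') (hg : HasVDeriv g x g') :
    ∃ D : E₁ →L[ℝ] ℝ, HasVDeriv (fun z => B (f z) (g z)) x D ∧
      ∀ v, D v = B (f' v) (g x) + B (f x) (g' v) := by
  let B' : E →L[ℝ] E →L[ℝ] ℝ := LinearMap.toContinuousLinearMap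
    ((LinearMap.toContinuousLinearMap : (E →ₗ[ℝ] ℝ) ≃ₗ[ℝ] (E →L[ℝ] ℝ)).toLinearMap ∘ₗ B)
  have h1 : HasMFDerivAt 𝓘(ℝ, E₁) 𝓘(ℝ, E × E) (fun z => (f z, g z)) x (f'.prod g') :=
    ⟨hf.1.prodMk hg.1, hf.2.prodMk hg.2⟩
  have h2 := HasVDeriv.comp (hasVDeriv_iff_hasFDerivAt.2
    (B'.isBoundedBilinearMap.hasFDerivAt (f x, g x))) h1 rfl
  refine ⟨_, h2, fun v => ?_⟩
  change B (f x) (g' v) + B (f' v) (g x) = _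
  rw [add_comm]

variable [CompleteSpace E]
  {G : Type*} [TopologicalSpace G] [ChartedSpace E G] [Group G] [LieGroup 𝓘(ℝ, E) ∞ G]
  [T2Space G]

omit [FiniteDimensional ℝ E] [T2Space G] in
theorem biinvMetric_apply (c : ℝ) (p : G) (u v : E) :
    biinvMetric c p (u : TangentSpace 𝓘(ℝ, E) p) v = innerE G c (dlInv p u) (dlInv p v) := by
  have h : (dlE p).inverse = dlInv (E := E) p :=
    ContinuousLinearMap.inverse_eq (dlE_comp_dlInv p) (dlInv_comp_dlE p)
  have key : ∀ D : TangentSpace 𝓘(ℝ, E) p →L[ℝ] LieAlg E G, D = dlInv (E := E) p →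
      (innerForm (E := E) (G := G) c).compl₁₂ D.toLinearMap D.toLinearMap u v =
        innerE G c (dlInv p u) (dlInv p v) := by
    rintro _ rfl
    rfl
  exact key _ h

omit [FiniteDimensional ℝ E] [CompleteSpace E] [T2Space G] in
theorem eq_leftField (X : Π p : G, TangentSpace 𝓘(ℝ, E) p) :
    X = leftField fun p => dlInv (E := E) p (X p) := by
  funext p
  exact (dlE_dlInv (E := E) p (X p)).symm

omit [T2Space G] in
/-- The Koszul formula for a bi-invariant metric. -/
theorem leviCivita_leftField (c : ℝ)
    {f h k : G → E}
    (hf : ContMDiff 𝓘(ℝ, E) 𝓘(ℝ, E) ∞ f) (hh : ContMDiff 𝓘(ℝ, E) 𝓘(ℝ, E) ∞ h)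
    (hk : ContMDiff 𝓘(ℝ, E) 𝓘(ℝ, E) ∞ k) (p : G) :
    leviCivita (biinvMetric c) (leftField f) (leftField h) (leftField k) p =
      innerE G c ((vderiv h p : E →L[ℝ] E) (dlE p (f p))) (k p) +
        2⁻¹ * innerE G c (brk G (f p) (h p)) (k p) := by
  have hg : ∀ u v : G → E, (fun q => biinvMetric c q (leftField u q) (leftField v q)) =
      fun q => innerE G c (u q) (v q) := fun u v => by
    funext q
    refine (biinvMetric_apply c q _ _).trans ?_
    rw [leftField, leftField, dlInv_dlE, dlInv_dlE]
  have hd : ∀ u v w : G → E, ContMDiff 𝓘(ℝ, E) 𝓘(ℝ, E) ∞ u → ContMDiff 𝓘(ℝ, E) 𝓘(ℝ, E) ∞ v →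
      mvfderiv 𝓘(ℝ, E) (fun q => biinvMetric c q (leftField u q) (leftField v q)) p (leftField w p)
        = innerE G c ((vderiv u p : E →L[ℝ] E) (dlE p (w p))) (v p) +
          innerE G c (u p) ((vderiv v p : E →L[ℝ] E) (dlE p (w p))) := fun u v w hu hv => by
    obtain ⟨D, hD, hD'⟩ := HasVDeriv.bilin (innerE G c) (hasVDeriv_of_contMDiff hu p)
      (hasVDeriv_of_contMDiff hv p)
    rw [hg]
    change (vderiv (fun q => innerE G c (u q) (v q)) p : E →L[ℝ] ℝ) (dlE p (w p)) = _
    rw [hD.vderiv_eq, hD']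
  have hb : ∀ u v w : G → E, ContMDiff 𝓘(ℝ, E) 𝓘(ℝ, E) ∞ u → ContMDiff 𝓘(ℝ, E) 𝓘(ℝ, E) ∞ v →
      biinvMetric c p (VectorField.mlieBracket 𝓘(ℝ, E) (leftField u) (leftField v) p)
        (leftField w p) = innerE G c ((vderiv v p : E →L[ℝ] E) (dlE p (u p))) (w p) -
          innerE G c ((vderiv u p : E →L[ℝ] E) (dlE p (v p))) (w p) +
            innerE G c (brk G (u p) (v p)) (w p) :=
    fun u v w hu hv => by
      rw [bracketFormula hu hv p]
      refine (biinvMetric_apply c p _ _).trans ?_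
      rw [leftField, dlInv_dlE, dlInv_dlE]
      simp
  rw [leviCivita, hd _ _ _ hh hk, hd _ _ _ hf hk, hd _ _ _ hf hh, hb _ _ _ hf hh, hb _ _ _ hf hk,
    hb _ _ _ hh hk]
  have e1 := innerE_skew (G := G) c (f p) (k p) (h p)
  have e2 := innerE_skew (G := G) c (h p) (k p) (f p)
  rw [← brk_skew (h p) (f p), map_neg, neg_neg] at e2
  rw [innerE_comm (G := G) c (k p)] at e1 e2
  rw [e1, e2, innerE_comm (G := G) c (f p) ((vderiv k p : E →L[ℝ] E) (dlE p (h p))),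
    innerE_comm (G := G) c (f p) ((vderiv h p : E →L[ℝ] E) (dlE p (k p))),
    innerE_comm (G := G) c (h p) ((vderiv k p : E →L[ℝ] E) (dlE p (f p)))]
  ring

variable [CompactSpace G]

omit [CompactSpace G] in
/-- The second fundamental form of the orbit.  The tangency of `h` along the orbit determines the
normal part of its derivative: with `b` a curve with velocity `x` at `b 0 = 1`, the vector
`Ad (σ (b t)) ξ` is normal at `b t · a`, so its product with `h` vanishes identically, and the
derivative at `0` expresses `⟨dh, ξ⟩` by brackets. -/
theorem leviCivita_of_tangent (c : ℝ)
    {σ : G ≃* G} (hσ : ContMDiff 𝓘(ℝ, E) 𝓘(ℝ, E) ∞ σ) {a : G} {ξ : E}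
    (hξ : ∀ x, innerE G c (moveMap σ a x) ξ = 0)
    {f h k : G → E}
    (hf : ContMDiff 𝓘(ℝ, E) 𝓘(ℝ, E) ∞ f) (hh : ContMDiff 𝓘(ℝ, E) 𝓘(ℝ, E) ∞ h)
    (hk : ContMDiff 𝓘(ℝ, E) 𝓘(ℝ, E) ∞ k)
    (hht : ∀ q ∈ sigmaOrbit σ a, ∃ y, h q = moveMap σ q y) {x : E} (hfa : f a = moveMap σ a x)
    (hka : k a = ξ) :
    leviCivita (biinvMetric c) (leftField f) (leftField h) (leftField k) a =
      innerE G c ((2⁻¹ : ℝ) • brk G ξ ((Ad a⁻¹ + vderiv σ 1 : E →L[ℝ] E) x)) (h a) := by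
  rw [leviCivita_leftField c hf hh hk, hfa, hka]
  obtain ⟨b, -, hb0, hb⟩ := exists_smooth_curve (1 : G) x
  have hbL := HasLeftDeriv.of_vderiv_one hb hb0
  have h0 : (fun t => innerE G c (h (b t * a * (σ (b t))⁻¹)) (Ad (σ (b t)) ξ)) =
      fun _ => (0 : ℝ) := by
    funext t
    obtain ⟨y, hy⟩ := hht _ (mem_sigmaOrbit.2 ⟨b t, rfl⟩)
    rw [hy, moveMap_orbit hσ, innerE_Ad, hξ]
  have h1 := hbL.orbit (τ := σ.toMonoidHom) hσ a
  have h2 := HasVDeriv.comp (hasVDeriv_of_contMDiff hh a) h1 (by simp [hb0])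
  obtain ⟨D, hD, hD'⟩ := (hbL.map (τ := σ.toMonoidHom) hσ).Ad_apply ξ
  obtain ⟨D₂, h3, h4⟩ := HasVDeriv.bilin (innerE G c) h2 hD
  have h5 : D₂ = 0 := HasVDeriv.unique h3 (h0 ▸ hasVDeriv_const (0 : ℝ) (0 : ℝ))
  have h6 := h4 1
  rw [h5, hD'] at h6
  simp [hb0, Ad_one] at h6
  have h7 : innerE G c ((vderiv h a : E →L[ℝ] E) (dlE a (moveMap σ a x))) ξ =
      -innerE G c (h a) (brk G ((vderiv σ 1 : E →L[ℝ] E) x) ξ) := by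
    simp only [moveMap, sub_apply, map_sub, LinearMap.sub_apply]
    linarith
  have e1 := innerE_skew (G := G) c (moveMap σ a x) (h a) ξ
  have e2 : (Ad a⁻¹ + vderiv σ 1 : E →L[ℝ] E) x =
      moveMap σ a x + (2 : ℝ) • (vderiv σ 1 : E →L[ℝ] E) x := by
    simp only [moveMap, sub_apply, add_apply]
    module
  rw [h7, e1, e2, ← brk_skew ξ (_ + _), brk_add_left, brk_smul_left, map_smul, LinearMap.smul_apply,
    innerE_comm (G := G) c _ (h a)]
  simp only [map_neg, map_add, map_smul, smul_eq_mul]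
  ring

end LeviCivita

/-! ### The shape operators of the orbit -/

section Shape

variable {E : Type*} [NormedAddCommGroup E] [NormedSpace ℝ E] [FiniteDimensional ℝ E]
  [CompleteSpace E]
  {G : Type*} [TopologicalSpace G] [ChartedSpace E G] [Group G] [LieGroup 𝓘(ℝ, E) ∞ G]
  [T2Space G] [CompactSpace G]

theorem mem_orbit_self {G : Type*} [Group G] (σ : G ≃* G) (a : G) : a ∈ sigmaOrbit σ a :=
  mem_sigmaOrbit.2 ⟨1, by simp⟩

omit [FiniteDimensional ℝ E] [CompleteSpace E] [T2Space G] [CompactSpace G] in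
theorem contMDiff_moveMap (σ : G ≃* G) (x : E) :
    ContMDiff 𝓘(ℝ, E) 𝓘(ℝ, E) ∞ (fun q : G => moveMap σ q x) :=
  (contMDiff_Ad_inv_apply x).sub contMDiff_const

/-- An endomorphism `A` given by `A ((R - σ) x) = ½ [ξ, (R + σ) x]` up to normal vectors is the
unique shape operator in the normal direction `ξ`.  Uniqueness needs tangent fields with prescribed
values at `a`, and `q ↦ dl_q (moveMap σ q x)` is one. -/
theorem isShapeOperator_iff {σ : G ≃* G} (hσ : ContMDiff 𝓘(ℝ, E) 𝓘(ℝ, E) ∞ σ) {a : G} {c : ℝ}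
    (hpos : ∀ x : E, x ≠ 0 → 0 < innerE G c x x) {ξ : E}
    (hξ : ∀ x, innerE G c (moveMap σ a x) ξ = 0)
    {A : Module.End ℝ (tangentSubspace (E := E) (sigmaOrbit σ a) a)}
    (hA : ∀ (x : E) (u v : tangentSubspace (E := E) (sigmaOrbit σ a) a),
      dlE (E := E) a (moveMap σ a x) = u.1 →
      innerE G c (dlInv (E := E) a (A u).1) (dlInv (E := E) a v.1) =
        innerE G c ((2⁻¹ : ℝ) • brk G ξ ((Ad a⁻¹ + vderiv σ 1 : E →L[ℝ] E) x))
          (dlInv (E := E) a v.1))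
    (B : Module.End ℝ (tangentSubspace (E := E) (sigmaOrbit σ a) a)) :
    IsShapeOperator (E := E) (biinvMetric c) (sigmaOrbit σ a) a (dl a ξ) B ↔ B = A := by
  have hval : ∀ X Y Z : Π q : G, TangentSpace 𝓘(ℝ, E) q,
      SmoothField X → SmoothField Y → SmoothField Z →
      (∀ q ∈ sigmaOrbit σ a, X q ∈ tangentSubspace (sigmaOrbit σ a) q) →
      (∀ q ∈ sigmaOrbit σ a, Y q ∈ tangentSubspace (sigmaOrbit σ a) q) → Z a = dl a ξ →
      ∀ u v : tangentSubspace (E := E) (sigmaOrbit σ a) a, u.1 = X a → v.1 = Y a →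
        innerE G c (dlInv (E := E) a (A u).1) (dlInv (E := E) a v.1) =
          leviCivita (biinvMetric c) X Y Z a := by
    intro X Y Z hX hY hZ hXt hYt hZξ u v hu hv
    have hY' : ∀ q ∈ sigmaOrbit σ a, ∃ y, dlInv (E := E) q (Y q) = moveMap σ q y := fun q hq => by
      obtain ⟨y, hy⟩ := (mem_tangentSubspace_sigmaOrbit hσ hq).1 (hYt q hq)
      exact ⟨y, by rw [← hy, dlInv_dlE]⟩
    obtain ⟨x, hx⟩ := (mem_tangentSubspace_sigmaOrbit hσ (mem_orbit_self σ a)).1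
      (hXt a (mem_orbit_self σ a))
    have key := leviCivita_of_tangent c hσ hξ (contMDiff_dlInv hX) (contMDiff_dlInv hY)
      (contMDiff_dlInv hZ) hY' (x := x) (by rw [← hx, dlInv_dlE])
      (by rw [hZξ]; exact dlInv_dlE a ξ)
    rw [← eq_leftField X, ← eq_leftField Y, ← eq_leftField Z] at key
    rw [key, hA x u v (hx.trans hu.symm), hv]
  constructor
  · intro hB
    refine LinearMap.ext fun u => ?_
    obtain ⟨x, hx⟩ := (mem_tangentSubspace_sigmaOrbit hσ (mem_orbit_self σ a)).1 u.2
    have htan : ∀ x : E, ∀ q ∈ sigmaOrbit σ a, leftField (fun q => moveMap σ q x) q ∈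
        tangentSubspace (sigmaOrbit σ a) q := fun x q hq =>
      (mem_tangentSubspace_sigmaOrbit hσ hq).2 ⟨x, rfl⟩
    have h1 : ∀ v : tangentSubspace (E := E) (sigmaOrbit σ a) a,
        innerE G c (dlInv (E := E) a (B u).1) (dlInv (E := E) a v.1) =
          innerE G c (dlInv (E := E) a (A u).1) (dlInv (E := E) a v.1) := fun v => by
      obtain ⟨y, hy⟩ := (mem_tangentSubspace_sigmaOrbit hσ (mem_orbit_self σ a)).1 v.2
      have hs := fun z : E => smoothField_leftField (contMDiff_moveMap σ z)
      have hs' := smoothField_leftField (contMDiff_const (c := ξ) (I := 𝓘(ℝ, E)) (M := G) (n := ∞))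
      rw [hval _ _ _ (hs x) (hs y) hs' (htan x) (htan y) rfl u v hx.symm hy.symm,
        ← hB _ _ _ (hs x) (hs y) hs' (htan x) (htan y) rfl u hx.symm]
      refine Eq.trans ?_ (biinvMetric_apply c a _ _).symm
      rw [← hy]
      rfl
    have h2 := h1 (B u - A u)
    by_contra hne
    have h3 : dlInv (E := E) a (B u - A u).1 ≠ 0 := fun h0 => hne <| by
      have h4 : (B u - A u).1 = (0 : E) := by
        rw [← dlE_dlInv (E := E) a (B u - A u).1, h0, map_zero]
      exact sub_eq_zero.1 (Subtype.ext h4)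
    have h5 := hpos _ h3
    have h6 : dlInv (E := E) a (B u - A u).1 =
        dlInv (E := E) a (B u).1 - dlInv (E := E) a (A u).1 :=
      map_sub (dlInv (E := E) a) (B u).1 (A u).1
    rw [h6] at h2 h5
    rw [LinearMap.map_sub₂, h2, sub_self] at h5
    exact lt_irrefl _ h5
  · rintro rfl X Y Z hX hY hZ hXt hYt hZξ u hu
    rw [← hval X Y Z hX hY hZ hXt hYt hZξ u ⟨Y a, hYt a (mem_orbit_self σ a)⟩ hu rfl]
    exact biinvMetric_apply c a _ _

end Shape

/-! ### Transport of the linear model -/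

section Transport

/-- A linear family of endomorphisms of `p`, conjugated by `D`, with its eigenspaces. -/
theorem exists_transport {K V W : Type*} [AddCommGroup K] [Module ℝ K] [AddCommGroup V]
    [Module ℝ V] [AddCommGroup W] [Module ℝ W] (D : V ≃ₗ[ℝ] W) {p : Submodule ℝ V}
    {q : Submodule ℝ W} (hq : p.map D.toLinearMap = q) (A₀ : K →ₗ[ℝ] Module.End ℝ p) :
    ∃ A : K →ₗ[ℝ] Module.End ℝ q,
      (∀ ξ (u : p) (v : q), D u = v → D (A₀ ξ u) = A ξ v) ∧
      (∀ ξ μ, ((A ξ).eigenspace μ).map q.subtype =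
        (((A₀ ξ).eigenspace μ).map p.subtype).map D.toLinearMap) ∧
      (∀ μ : K → ℝ, (⨅ ξ, (A ξ).eigenspace (μ ξ)).map q.subtype =
        ((⨅ ξ, (A₀ ξ).eigenspace (μ ξ)).map p.subtype).map D.toLinearMap) := by
  subst hq
  let Φ : p ≃ₗ[ℝ] p.map D.toLinearMap := D.submoduleMap p
  have hΦ : ∀ u : p, (Φ u : W) = D u := fun u => rfl
  have hA : ∀ ξ (u : p), (Φ.conj (A₀ ξ)) (Φ u) = Φ (A₀ ξ u) := fun ξ u => by
    simp [LinearEquiv.conj_apply_apply]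
  have hS : ∀ (S : Submodule ℝ p) (S' : Submodule ℝ (p.map D.toLinearMap)),
      (∀ u, Φ u ∈ S' ↔ u ∈ S) → S'.map (p.map D.toLinearMap).subtype =
        (S.map p.subtype).map D.toLinearMap := fun S S' h => by
    ext w
    constructor
    · rintro ⟨v, hv, rfl⟩
      obtain ⟨u, rfl⟩ := Φ.surjective v
      exact ⟨u, ⟨u, (h u).1 hv, rfl⟩, rfl⟩
    · rintro ⟨_, ⟨u, hu, rfl⟩, rfl⟩
      exact ⟨Φ u, (h u).2 hu, rfl⟩
  have hE : ∀ ξ μ u, Φ u ∈ (Φ.conj (A₀ ξ)).eigenspace μ ↔ u ∈ (A₀ ξ).eigenspace μ :=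
    fun ξ μ u => by
      rw [Module.End.mem_eigenspace_iff, Module.End.mem_eigenspace_iff, hA, ← map_smul,
        Φ.injective.eq_iff]
  refine ⟨Φ.conj.toLinearMap ∘ₗ A₀, fun ξ u v huv => ?_, fun ξ μ => hS _ _ (hE ξ μ),
    fun μ => hS _ _ fun u => ?_⟩
  · have : v = Φ u := Subtype.ext huv.symm
    rw [this]
    exact (congrArg Subtype.val (hA ξ u)).symm
  · simp only [Submodule.mem_iInf]
    exact forall_congr' fun ξ => hE ξ (μ ξ) u

theorem iSup_movingIndex {L S : Type*} [LieRing L] [LieAlgebra ℝ L] [CompleteLattice S]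
    (B : LinearMap.BilinForm ℝ L) (P : Set L) (w : L) (f : L → Circle → S) :
    ⨆ i ∈ movingIndex B P w, f i.1 i.2 =
      (⨆ (ε : Circle) (_ : 0 ≤ (ε : ℂ).im) (_ : ε ≠ 1), f 0 ε) ⊔
        ⨆ α ∈ P, ⨆ (ε : Circle) (_ : ¬ IsResonant B w α ε), f α ε := by
  refine le_antisymm (iSup₂_le ?_) (sup_le ?_ ?_)
  · rintro ⟨α, ε⟩ (⟨h, h1, h2⟩ | ⟨h, h1⟩)
    · dsimp only at h h1 h2
      subst h
      exact le_sup_of_le_left (le_iSup_of_le ε (le_iSup₂_of_le h1 h2 le_rfl))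
    · exact le_sup_of_le_right (le_iSup₂_of_le α h (le_iSup₂_of_le ε h1 le_rfl))
  · exact iSup_le fun ε => iSup₂_le fun h1 h2 =>
      le_iSup₂_of_le (f := fun (i : L × Circle) (_ : i ∈ movingIndex B P w) => f i.1 i.2)
        ((0, ε) : L × Circle) (Or.inl ⟨rfl, h1, h2⟩) le_rfl
  · exact iSup₂_le fun α h => iSup₂_le fun ε h1 =>
      le_iSup₂_of_le (f := fun (i : L × Circle) (_ : i ∈ movingIndex B P w) => f i.1 i.2)
        ((α, ε) : L × Circle) (Or.inr ⟨h, h1⟩) le_rfl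

theorem iSup_stableIndex {L S : Type*} [LieRing L] [LieAlgebra ℝ L] [CompleteLattice S]
    (B : LinearMap.BilinForm ℝ L) (P : Set L) (w : L) (f : L → Circle → S) :
    ⨆ i ∈ stableIndex B P w, f i.1 i.2 =
      ⨆ α ∈ P, ⨆ (ε : Circle) (_ : IsResonant B w α ε), f α ε := by
  refine le_antisymm (iSup₂_le ?_) ?_
  · rintro ⟨α, ε⟩ ⟨h, h1⟩
    exact le_iSup₂_of_le α h (le_iSup₂_of_le ε h1 le_rfl)
  · exact iSup₂_le fun α h => iSup₂_le fun ε h1 =>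
      le_iSup₂_of_le (f := fun (i : L × Circle) (_ : i ∈ stableIndex B P w) => f i.1 i.2)
        ((α, ε) : L × Circle) ⟨h, h1⟩ le_rfl

theorem iSupIndep_restrict {S I : Type*} [CompleteLattice S] {s t : Set I} (hst : s ⊆ t)
    {f : I → S} (h : iSupIndep fun i : t => f i) : iSupIndep fun i : s => f i :=
  h.comp (f := Set.inclusion hst) (Set.inclusion_injective hst)

/-- `𝔱` is the summand with label `(0, 1)`, which is not a stable index. -/
theorem disjoint_stableIndex {L : Type*} [LieRing L] [LieAlgebra ℝ L] [FiniteDimensional ℝ L]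
    {B : LinearMap.BilinForm ℝ L}
    {s : L →ₗ[ℝ] L} {𝔱 : Submodule ℝ L} {P : Set L} (h : IsTwistedCartan B s 𝔱)
    (hP : IsHalfSystem B 𝔱 P) (w : L) :
    Disjoint 𝔱 (⨆ i : stableIndex B P w, jointR B s 𝔱 i.1.1 i.1.2) := by
  have h0 : ((0, 1) : L × Circle) ∈ halfIndex P := Or.inl ⟨rfl, by simp⟩
  have h1 := (iSupIndep_jointR h hP) ⟨_, h0⟩
  dsimp only at h1
  rw [jointR_zero_one h.maxAbelian] at h1
  refine h1.mono_right (iSup_le fun i => ?_)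
  refine le_iSup₂_of_le (⟨i.1, stableIndex_subset i.2⟩ : halfIndex P) (fun h2 => ?_) le_rfl
  have h3 : i.1.1 = 0 := congrArg (fun j : halfIndex P => j.1.1) h2
  exact (hP.1 i.2.1).2.1 h3

end Transport

/-- The differential of a left translation, as a linear equivalence. -/
def dlEquiv {E : Type*} [NormedAddCommGroup E] [NormedSpace ℝ E] [CompleteSpace E]
    {G : Type*} [TopologicalSpace G] [ChartedSpace E G] [Group G] [LieGroup 𝓘(ℝ, E) ∞ G] (a : G) :
    LieAlg E G ≃ₗ[ℝ] TangentSpace 𝓘(ℝ, E) a where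
  toLinearMap := (dl (E := E) a).toLinearMap
  invFun := dlInv (E := E) a
  left_inv x := dlInv_dlE (E := E) a x
  right_inv x := dlE_dlInv (E := E) a x

end SigmaAction

end

theorem proposition5p1
    {E : Type*} [NormedAddCommGroup E] [NormedSpace ℝ E] [FiniteDimensional ℝ E] [CompleteSpace E]
    {G : Type*} [TopologicalSpace G] [ChartedSpace E G] [Group G] [LieGroup 𝓘(ℝ, E) ∞ G]
    [T2Space G] [CompactSpace G] [ConnectedSpace G]
    [LieAlgebra.IsSemisimple ℝ (LieAlg E G)]
    (σ : G ≃* G) (hσ : ContMDiff 𝓘(ℝ, E) 𝓘(ℝ, E) ∞ σ)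
    (hσ' : ContMDiff 𝓘(ℝ, E) 𝓘(ℝ, E) ∞ σ.symm)
    (c : ℝ) (hc : 0 < c)
    (𝔱 : Submodule ℝ (LieAlg E G)) (h𝔱 : IsMaximalAbelian σ 𝔱)
    (P : Set (LieAlg E G)) (hP : IsPositiveSystem c 𝔱 P)
    (w : LieAlg E G) (hw : w ∈ 𝔱)
    (a : G) (ha : a = lieExp w)
    (N : Set G) (hN : N = sigmaOrbit σ a) :
    -- the tangent space
    (velocities N a =
      (Submodule.map (dl a).toLinearMap
        ((⨆ (ε : Circle) (_ : 0 ≤ (ε : ℂ).im) (_ : ε ≠ 1), realSpace c σ 𝔱 0 ε) ⊔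
          ⨆ α ∈ P, ⨆ (ε : Circle) (_ : ¬ Resonant c w α ε),
            realSpace c σ 𝔱 α ε) : Set (TangentSpace 𝓘(ℝ, E) a))) ∧
    -- the normal space
    (normalSubspace (biinvMetric c) N a =
      Submodule.map (dl a).toLinearMap
        (𝔱 ⊔ ⨆ α ∈ P, ⨆ (ε : Circle) (_ : Resonant c w α ε),
          realSpace c σ 𝔱 α ε)) ∧
    -- the sums are direct
    iSupIndep (fun i : tangentIndex c P w => realSpace c σ 𝔱 i.1.1 i.1.2) ∧
    iSupIndep (fun i : normalIndex c P w => realSpace c σ 𝔱 i.1.1 i.1.2) ∧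
    Disjoint 𝔱 (⨆ i : normalIndex c P w, realSpace c σ 𝔱 i.1.1 i.1.2) ∧
    -- the shape operators in the directions of `𝔱` and their eigenspaces
    ∃ A : 𝔱 →ₗ[ℝ] Module.End ℝ (tangentSubspace (E := E) N a),
      (∀ (ξ : 𝔱) (B : Module.End ℝ (tangentSubspace (E := E) N a)),
        IsShapeOperator (E := E) (biinvMetric c) N a (dl a ξ) B ↔
          B = A ξ) ∧
      (∀ ε : Circle, 0 ≤ (ε : ℂ).im → ε ≠ 1 → ∀ x ∈ realSpace c σ 𝔱 0 ε,
        ∀ u : tangentSubspace (E := E) N a,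
          (u : TangentSpace 𝓘(ℝ, E) a) = dl a x → ∀ ξ : 𝔱, A ξ u = 0) ∧
      (∀ α ∈ P, ∀ ε : Circle, ¬ Resonant c w α ε →
        ∀ x ∈ realSpace c σ 𝔱 α ε,
        ∀ u : tangentSubspace (E := E) N a,
          (u : TangentSpace 𝓘(ℝ, E) a) = dl a x → ∀ ξ : 𝔱,
            A ξ u = (-(innerForm c α ξ / 2) *
              Real.cot ((innerForm c α w + Complex.arg (ε : ℂ)) / 2)) • u) ∧
      -- the eigenspaces of each `A ξ` are the sums of the summands with the same eigenvalue
      (∀ (ξ : 𝔱) (μ : ℝ),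
        ((A ξ).eigenspace μ).map (Submodule.subtype _) =
          Submodule.map (dl a).toLinearMap
            (⨆ i ∈ tangentIndex c P w,
              ⨆ _ : curvature c w (ξ : LieAlg E G) i.1 i.2 = μ,
                realSpace c σ 𝔱 i.1 i.2)) ∧
      -- the same for the common eigenspaces of the family
      (∀ μ : 𝔱 → ℝ,
        (⨅ ξ : 𝔱, (A ξ).eigenspace (μ ξ)).map (Submodule.subtype _) =
          Submodule.map (dl a).toLinearMap
            (⨆ i ∈ tangentIndex c P w,
              ⨆ _ : ∀ ξ : 𝔱, curvature c w (ξ : LieAlg E G) i.1 i.2 = μ ξ,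
                realSpace c σ 𝔱 i.1 i.2)) := by
  subst ha hN
  have _ : @FiniteDimensional ℝ (LieAlg E G) _ LieRing.toAddCommGroup LieAlgebra.toModule :=
    inferInstanceAs (FiniteDimensional ℝ E)
  have h : IsTwistedCartan (L := LieAlg E G) (innerForm c) (dAut σ) 𝔱 :=
    isTwistedCartan hσ hσ' hc h𝔱
  have hP' : IsHalfSystem (L := LieAlg E G) (innerForm c) 𝔱 P := hP
  set a : G := lieExp w with ha
  -- the linear model applies with `R = Ad a⁻¹`; its root spaces and index sets are those of the
  -- statement by definition, and `T x = moveMap σ a x`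
  have hRiso := innerForm_AdL (E := E) (G := G) c a⁻¹
  have hR : ∀ α ∈ 𝔱, ∀ z ∈ rootC (L := LieAlg E G) (innerForm c) 𝔱 α,
      (AdL (E := E) (a⁻¹)).baseChange ℂ z =
        Complex.exp (-(Complex.I * (innerForm c α w : ℂ))) • z := fun α _ z hz =>
    AdL_inv_lieExp_baseChange (mem_rootC.1 hz w hw)
  set T : LieAlg E G →ₗ[ℝ] LieAlg E G := AdL (E := E) a⁻¹ - dAut σ with hT
  have hrange := (range_sub_eq (L := LieAlg E G) hR h hP').trans
    (iSup_movingIndex (L := LieAlg E G) (innerForm c) P w _)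
  have hker := (ker_sub_eq (L := LieAlg E G) hRiso hR h hP').trans
    (congrArg (𝔱 ⊔ ·) (iSup_stableIndex (L := LieAlg E G) (innerForm c) P w _))
  have htan : Submodule.map (dlEquiv (E := E) a).toLinearMap (LinearMap.range T) =
      tangentSubspace (E := E) (sigmaOrbit σ a) a := by
    ext u
    refine Iff.trans ?_ (mem_tangentSubspace_sigmaOrbit hσ (mem_orbit_self σ a)).symm
    constructor
    · rintro ⟨_, ⟨x, rfl⟩, rfl⟩
      exact ⟨x, rfl⟩
    · rintro ⟨x, rfl⟩
      exact ⟨_, ⟨x, rfl⟩, rfl⟩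
  have h𝔱ker : ∀ ξ ∈ 𝔱, ∀ x : E, innerE (E := E) G c (moveMap (E := E) σ a x) ξ = 0 := fun ξ hξ =>
    (mem_ker_iff_orthogonal (L := LieAlg E G) hRiso hR h ξ).1
      (hker.symm.le (Submodule.mem_sup_left hξ))
  refine ⟨?_, ?_, iSupIndep_restrict (f := fun i : LieAlg E G × Circle => realSpace c σ 𝔱 i.1 i.2)
      movingIndex_subset (iSupIndep_jointR h hP'),
    iSupIndep_restrict (f := fun i : LieAlg E G × Circle => realSpace c σ 𝔱 i.1 i.2)
      stableIndex_subset (iSupIndep_jointR h hP'),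
    disjoint_stableIndex (L := LieAlg E G) h hP' w, ?_⟩
  · rw [velocities_sigmaOrbit hσ a]
    refine Eq.trans ?_ (congrArg (fun S : Submodule ℝ (LieAlg E G) =>
      ((S.map (dl (E := E) a).toLinearMap : Submodule ℝ _) : Set (TangentSpace 𝓘(ℝ, E) a))) hrange)
    ext u
    constructor
    · rintro ⟨x, rfl⟩
      exact ⟨_, ⟨x, rfl⟩, rfl⟩
    · rintro ⟨_, ⟨x, rfl⟩, rfl⟩
      exact ⟨x, rfl⟩
  · refine Eq.trans ?_ (congrArg (fun S : Submodule ℝ (LieAlg E G) =>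
      S.map (dl (E := E) a).toLinearMap) hker)
    ext v
    have hv : v ∈ normalSubspace (biinvMetric (E := E) c) (sigmaOrbit σ a) a ↔
        dlInv (E := E) a v ∈ LinearMap.ker T := by
      refine Iff.trans ?_ (mem_ker_iff_orthogonal (L := LieAlg E G) hRiso hR h _).symm
      constructor
      · intro h1 x
        have h2 := h1 _ ((mem_tangentSubspace_sigmaOrbit hσ (mem_orbit_self σ a)).2 ⟨x, rfl⟩)
        rw [← h2]
        refine ((biinvMetric_apply c a _ _).trans ?_).symm
        rw [dlInv_dlE]
        rfl
      · intro h1 u hu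
        obtain ⟨x, rfl⟩ := (mem_tangentSubspace_sigmaOrbit hσ (mem_orbit_self σ a)).1 hu
        refine (biinvMetric_apply c a _ _).trans ?_
        rw [dlInv_dlE]
        exact h1 x
    rw [hv]
    constructor
    · intro h1
      exact ⟨_, h1, dlE_dlInv (E := E) a v⟩
    · rintro ⟨x, hx, rfl⟩
      have : dlInv (E := E) a (dlE (E := E) a x) = x := dlInv_dlE (E := E) a x
      exact this.symm ▸ hx
  · obtain ⟨A₀, hA₀, hcot, heig, hcommon⟩ :=
      exists_modelShape (L := LieAlg E G) h hP' hRiso hR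
    obtain ⟨A, hA, hAeig, hAcommon⟩ := exists_transport (dlEquiv (E := E) a) htan A₀
    have hmodel : ∀ i ∈ movingIndex (L := LieAlg E G) (innerForm c) P w,
        ∀ x ∈ jointR (L := LieAlg E G) (innerForm c) (dAut σ) 𝔱 i.1 i.2,
        ∀ u : tangentSubspace (E := E) (sigmaOrbit σ a) a,
          (u : TangentSpace 𝓘(ℝ, E) a) = dl a x → ∀ ξ : 𝔱,
            A ξ u = curvature c w (ξ : LieAlg E G) i.1 i.2 • u := by
      intro i hi x hx u hu ξ
      have hxr : x ∈ LinearMap.range T := by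
        rw [range_sub_eq (L := LieAlg E G) hR h hP']
        exact (le_iSup₂_of_le (f := fun (i : LieAlg E G × Circle) _ =>
          jointR (L := LieAlg E G) (innerForm c) (dAut σ) 𝔱 i.1 i.2) i hi le_rfl) hx
      refine Subtype.ext ?_
      rw [← hA ξ ⟨x, hxr⟩ u hu.symm, hcot i hi ⟨x, hxr⟩ hx ξ]
      exact (map_smul (dlEquiv (E := E) a) _ x).trans
        (congrArg (curvature c w (ξ : LieAlg E G) i.1 i.2 • ·) hu.symm)
    refine ⟨A, fun ξ B => isShapeOperator_iff hσ h.pos (h𝔱ker ξ ξ.2) (fun x u v hx => ?_) B,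
      fun ε h1 h2 x hx u hu ξ => ?_, fun α hα ε hε x hx u hu ξ =>
        hmodel (α, ε) (Or.inr ⟨hα, hε⟩) x hx u hu ξ, fun ξ μ => ?_, fun μ => ?_⟩
    · obtain ⟨_, ⟨y, rfl⟩, hy⟩ := htan.ge v.2
      have h1 := hA₀ ξ x ⟨T x, ⟨x, rfl⟩⟩ ⟨T y, ⟨y, rfl⟩⟩ rfl
      have h2 := hA ξ ⟨T x, ⟨x, rfl⟩⟩ u hx
      have h3 : dlInv (E := E) a v.1 = T y := by
        rw [← hy]
        exact dlInv_dlE (E := E) a (T y)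
      have h4 : dlInv (E := E) a (A ξ u).1 = (A₀ ξ ⟨T x, ⟨x, rfl⟩⟩).1 := by
        rw [← h2]
        exact dlInv_dlE (E := E) a _
      rw [h3, h4]
      exact h1
    · rw [hmodel (0, ε) (Or.inl ⟨rfl, h1, h2⟩) x hx u hu ξ]
      simp [curvature]
    · exact (hAeig ξ μ).trans (congrArg (Submodule.map (dl (E := E) a).toLinearMap) (heig ξ μ))
    · exact (hAcommon μ).trans (congrArg (Submodule.map (dl (E := E) a).toLinearMap) (hcommon μ))
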